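/- Let $(M,g)$ be a connected compact smooth Riemannian manifold without boundary, of dimension $n\ge 2$, with Levi-Civita connection $\nabla$. Assume that $(M,g)$ has quasi-negative sectional curvature: all sectional curvatures are nonpositive, and there is a point at which all sectional curvatures are strictly negative. For a smooth $1$-form $\theta\in\Omega^1(M)$ put $(\delta^*\theta)_{ij}=\tfrac12(\nabla_i\theta_j+\nabla_j\theta_i)$, $\delta\theta=-\nabla^l\theta_l$, and $$(E\theta)_{kij}=2(n+1)\nabla_k(\delta^*\theta)_{ij}+2g_{ij}\nabla_k(\delta\theta)+g_{kj}\nabla_i(\delta\theta)+g_{ki}\nabla_j(\delta\theta).$$ Then $E$ maps $\Omega^1(M)$ to $C^\infty(T^*M\otimes S^2_0M)$, where $S^2_0M$ is the bundle of trace-free symmetric covariant $2$-tensors, and it has a formal adjoint $E^*:C^\infty(T^*M\otimes S^2_0M)\to\Omega^1(M)$, i.e. a map with $\langle E\theta,\Phi\rangle_{L^2}=\langle\theta,E^*\Phi\rangle_{L^2}$ for all $\theta\in\Omega^1(M)$ and $\Phi\in C^\infty(T^*M\otimes S^2_0M)$, where $\langle S,T\rangle_{L^2}=\int_M g(S,T)\,dv_g$.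 The Eisenhart operator $E^*E:\Omega^1(M)\to\Omega^1(M)$ is positive definite: it is symmetric with respect to $\langle\cdot,\cdot\rangle_{L^2}$, and $\langle E^*E\theta,\theta\rangle_{L^2}>0$ for every $\theta\in\Omega^1(M)$ with $\theta\ne 0$. Moreover $\ker E=\{0\}$, and every infinitesimal projective transformation of $(M,g)$ vanishes identically, where an infinitesimal projective transformation is a smooth vector field that generates, in a neighbourhood of every point, a local one-parameter group of diffeomorphisms mapping geodesics to geodesics (as unparametrised curves). -/

import Mathlib

open scoped Manifold ContDiff Topology
open MeasureTheory Set

noncomputable section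

namespace EisenhartOp

/-! ### Tensor calculus in coordinates

Here `G u` is the matrix of metric coefficients `g_ij` at the point with coordinates `u`, and a
covariant tensor field of rank `r` is given by its components `F u I`, with `I` a multi-index. -/

namespace Coord

variable {n : ℕ}

/-- The partial derivative `∂_i f`. -/
def pd (i : Fin n) (f : EuclideanSpace ℝ (Fin n) → ℝ) (u : EuclideanSpace ℝ (Fin n)) : ℝ :=
  fderiv ℝ f u (EuclideanSpace.single i 1)

/-- The Christoffel symbol `Γ^m_ij` of the Levi-Civita connection. -/
def christoffel (G : EuclideanSpace ℝ (Fin n) → Matrix (Fin n) (Fin n) ℝ)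
    (u : EuclideanSpace ℝ (Fin n)) (m i j : Fin n) : ℝ :=
  (1 / 2) * ∑ l, (G u)⁻¹ m l *
    (pd i (fun w => G w j l) u + pd j (fun w => G w i l) u - pd l (fun w => G w i j) u)

/-- The curvature components `R^l_kij`, normalised by `R(∂_i, ∂_j) ∂_k = ∑_l R^l_kij ∂_l`, where
`R(X, Y) = ∇_X ∇_Y - ∇_Y ∇_X - ∇_[X, Y]`. -/
def riemann (G : EuclideanSpace ℝ (Fin n) → Matrix (Fin n) (Fin n) ℝ)
    (u : EuclideanSpace ℝ (Fin n)) (l k i j : Fin n) : ℝ :=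
  pd i (fun w => christoffel G w l j k) u - pd j (fun w => christoffel G w l i k) u
    + ∑ m, (christoffel G u l i m * christoffel G u m j k
      - christoffel G u l j m * christoffel G u m i k)

/-- The covariant derivative `∇_k F_{i_1 … i_r}`; the index of differentiation comes first. -/
def covDeriv {r : ℕ} (G : EuclideanSpace ℝ (Fin n) → Matrix (Fin n) (Fin n) ℝ)
    (F : EuclideanSpace ℝ (Fin n) → (Fin r → Fin n) → ℝ)
    (u : EuclideanSpace ℝ (Fin n)) (I : Fin (r + 1) → Fin n) : ℝ :=
  pd (I 0) (fun w => F w (Fin.tail I)) u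
    - ∑ a : Fin r, ∑ m : Fin n,
        christoffel G u m (I 0) (Fin.tail I a) * F u (Function.update (Fin.tail I) a m)

/-- `(δ^* θ)_ij = (∇_i θ_j + ∇_j θ_i) / 2`, that is, half the Lie derivative of the metric along
the vector field dual to `θ`. -/
def symDeriv (G : EuclideanSpace ℝ (Fin n) → Matrix (Fin n) (Fin n) ℝ)
    (θ : EuclideanSpace ℝ (Fin n) → (Fin 1 → Fin n) → ℝ)
    (u : EuclideanSpace ℝ (Fin n)) (I : Fin 2 → Fin n) : ℝ :=
  (1 / 2) * (covDeriv G θ u ![I 0, I 1] + covDeriv G θ u ![I 1, I 0])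

/-- The codifferential `δθ = - g^ij ∇_i θ_j`. -/
def codiff (G : EuclideanSpace ℝ (Fin n) → Matrix (Fin n) (Fin n) ℝ)
    (θ : EuclideanSpace ℝ (Fin n) → (Fin 1 → Fin n) → ℝ)
    (u : EuclideanSpace ℝ (Fin n)) : ℝ :=
  - ∑ i, ∑ j, (G u)⁻¹ i j * covDeriv G θ u ![i, j]

/-- `(Eθ)_kij = 2 (n + 1) ∇_k (δ^* θ)_ij + 2 g_ij ∇_k δθ + g_kj ∇_i δθ + g_ki ∇_j δθ`,
with `(k, i, j) = (K 0, K 1, K 2)`. -/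
def eisenhart (G : EuclideanSpace ℝ (Fin n) → Matrix (Fin n) (Fin n) ℝ)
    (θ : EuclideanSpace ℝ (Fin n) → (Fin 1 → Fin n) → ℝ)
    (u : EuclideanSpace ℝ (Fin n)) (K : Fin 3 → Fin n) : ℝ :=
  2 * ((n : ℝ) + 1) * covDeriv G (symDeriv G θ) u K
    + 2 * G u (K 1) (K 2) * pd (K 0) (codiff G θ) u
    + G u (K 0) (K 2) * pd (K 1) (codiff G θ) u
    + G u (K 0) (K 1) * pd (K 2) (codiff G θ) u

end Coord

/-! ### Tensor fields on a manifold -/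

/-- Smooth Riemannian metrics on `M`. -/
abbrev Metric (n : ℕ) (M : Type*) [TopologicalSpace M] [ChartedSpace (EuclideanSpace ℝ (Fin n)) M]
    [IsManifold (𝓡 n) ∞ M] :=
  Bundle.ContMDiffRiemannianMetric (𝓡 n) ∞ (EuclideanSpace ℝ (Fin n))
    (fun x : M => TangentSpace (𝓡 n) x)

/-- Covariant tensors of rank `r` at the point `x`. -/
abbrev CovTensor (n r : ℕ) {M : Type*} [TopologicalSpace M]
    [ChartedSpace (EuclideanSpace ℝ (Fin n)) M] (x : M) :=
  MultilinearMap ℝ (fun _ : Fin r => TangentSpace (𝓡 n) x) ℝ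

/-- Covariant tensor fields of rank `r` on `M`, with no regularity imposed. -/
abbrev TensorField (n r : ℕ) (M : Type*) [TopologicalSpace M]
    [ChartedSpace (EuclideanSpace ℝ (Fin n)) M] :=
  (x : M) → CovTensor n r x

section Manifold

variable {n : ℕ} {M : Type*} [TopologicalSpace M] [ChartedSpace (EuclideanSpace ℝ (Fin n)) M]

/-- The coordinate vector `∂_i` of the chart `e` at the point with coordinates `u`. -/
def frame (e : OpenPartialHomeomorph M (EuclideanSpace ℝ (Fin n)))
    (u : EuclideanSpace ℝ (Fin n)) (i : Fin n) : TangentSpace (𝓡 n) (e.symm u) :=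
  mfderiv (𝓡 n) (𝓡 n) e.symm u (EuclideanSpace.single i (1 : ℝ) : EuclideanSpace ℝ (Fin n))

/-- The `i`-th coordinate of tangent vectors at `x` in the chart `e`, as a linear form. -/
def coord (e : OpenPartialHomeomorph M (EuclideanSpace ℝ (Fin n))) (x : M) (i : Fin n) :
    TangentSpace (𝓡 n) x →ₗ[ℝ] ℝ :=
  ((EuclideanSpace.proj i : EuclideanSpace ℝ (Fin n) →L[ℝ] ℝ) : EuclideanSpace ℝ (Fin n) →ₗ[ℝ] ℝ) ∘ₗ
    (((NormedSpace.fromTangentSpace (e x) : TangentSpace (𝓡 n) (e x) ≃L[ℝ] _) :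
      TangentSpace (𝓡 n) (e x) →L[ℝ] EuclideanSpace ℝ (Fin n)) ∘L
        mfderiv (𝓡 n) (𝓡 n) e x : TangentSpace (𝓡 n) x →L[ℝ] EuclideanSpace ℝ (Fin n))

/-- The components of a tensor field in the chart `e`. -/
def comp {r : ℕ} (e : OpenPartialHomeomorph M (EuclideanSpace ℝ (Fin n)))
    (T : TensorField n r M) (u : EuclideanSpace ℝ (Fin n)) (I : Fin r → Fin n) : ℝ :=
  T (e.symm u) (fun a => frame e u (I a))

/-- The tensor at `x` with components `c` in the chart `e`. -/
def ofComp {r : ℕ} (e : OpenPartialHomeomorph M (EuclideanSpace ℝ (Fin n))) (x : M)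
    (c : (Fin r → Fin n) → ℝ) : CovTensor n r x :=
  ∑ I : Fin r → Fin n, c I •
    (MultilinearMap.mkPiAlgebra ℝ (Fin r) ℝ).compLinearMap (fun a => coord e x (I a))

variable (n M) in
/-- Smooth covariant tensor fields of rank `r`; for `r = 1` this is `Ω¹(M)`. -/
def smoothTensor (r : ℕ) : Set (TensorField n r M) :=
  {T | ∀ e ∈ atlas (EuclideanSpace ℝ (Fin n)) M, ∀ I : Fin r → Fin n,
    ContDiffOn ℝ ∞ (fun u => comp e T u I) e.target}

variable (n M) in
theorem exists_chart_cover [CompactSpace M] [Nonempty M] :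
    ∃ c : ℕ → M, ⋃ i, (chartAt (EuclideanSpace ℝ (Fin n)) (c i)).source = univ := by
  obtain ⟨t, ht⟩ := CompactSpace.elim_nhds_subcover
    (fun x : M => (chartAt (EuclideanSpace ℝ (Fin n)) x).source)
    (fun x => chart_source_mem_nhds _ x)
  have hne : (t : Set M).Nonempty := by
    obtain ⟨y⟩ := ‹Nonempty M›
    have hy : y ∈ ⋃ x ∈ t, (chartAt (EuclideanSpace ℝ (Fin n)) x).source := by
      rw [ht]; trivial
    obtain ⟨x, hx, -⟩ := mem_iUnion₂.1 hy
    exact ⟨x, hx⟩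
  obtain ⟨c, hc⟩ := t.countable_toSet.exists_eq_range hne
  refine ⟨c, eq_univ_of_forall fun y => ?_⟩
  have hy : y ∈ ⋃ x ∈ t, (chartAt (EuclideanSpace ℝ (Fin n)) x).source := by
    rw [ht]; trivial
  obtain ⟨x, hx, hyx⟩ := mem_iUnion₂.1 hy
  have hx' : x ∈ range c := hc ▸ (Finset.mem_coe.2 hx)
  obtain ⟨i, rfl⟩ := hx'
  exact mem_iUnion.2 ⟨i, hyx⟩

variable (n M) in
/-- A sequence of points of `M` whose preferred charts cover `M`. -/
def chartSeq [CompactSpace M] [Nonempty M] : ℕ → M := (exists_chart_cover n M).choose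

variable [IsManifold (𝓡 n) ∞ M]

/-- The metric coefficients in the chart `e`. -/
def metricComp (g : Metric n M) (e : OpenPartialHomeomorph M (EuclideanSpace ℝ (Fin n)))
    (u : EuclideanSpace ℝ (Fin n)) : Matrix (Fin n) (Fin n) ℝ :=
  Matrix.of fun i j => g.inner (e.symm u) (frame e u i) (frame e u j)

/-- The operator `E` on 1-forms, its value at `x` being computed in the preferred chart at `x`. -/
def eisenhart (g : Metric n M) (θ : TensorField n 1 M) : TensorField n 3 M := fun x =>
  ofComp (chartAt (EuclideanSpace ℝ (Fin n)) x) x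
    (Coord.eisenhart (metricComp g (chartAt (EuclideanSpace ℝ (Fin n)) x))
      (comp (chartAt (EuclideanSpace ℝ (Fin n)) x) θ) (chartAt (EuclideanSpace ℝ (Fin n)) x x))

/-- The `i`-th standard basis vector of the model space, seen in `T_x M` (as a vector space,
`T_x M` is the model space). Contractions with the metric do not depend on the basis. -/
def tbasis (x : M) (i : Fin n) : TangentSpace (𝓡 n) x :=
  (EuclideanSpace.single i (1 : ℝ) : EuclideanSpace ℝ (Fin n))

/-- The inverse Gram matrix `g^ij` at `x`. -/
def gramInv (g : Metric n M) (x : M) : Matrix (Fin n) (Fin n) ℝ :=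
  (Matrix.of fun i j => g.inner x (tbasis x i) (tbasis x j))⁻¹

/-- The inner product `g(S, T) = g^{i_1 j_1} ⋯ g^{i_r j_r} S_{i_1 … i_r} T_{j_1 … j_r}`
that the metric induces on covariant tensors at `x`. -/
def tensorInner {r : ℕ} (g : Metric n M) (x : M) (S T : CovTensor n r x) : ℝ :=
  ∑ I : Fin r → Fin n, ∑ J : Fin r → Fin n,
    (∏ a, gramInv g x (I a) (J a)) * S (fun a => tbasis x (I a)) * T (fun a => tbasis x (J a))

/-- Smooth sections of `T^*M ⊗ S²₀M`: symmetric and trace-free in the last two arguments. -/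
def smoothSymTraceFree (g : Metric n M) : Set (TensorField n 3 M) :=
  {Φ | Φ ∈ smoothTensor n M 3 ∧
    (∀ (x : M) (v w z : TangentSpace (𝓡 n) x), Φ x ![v, w, z] = Φ x ![v, z, w]) ∧
    ∀ (x : M) (v : TangentSpace (𝓡 n) x),
      ∑ i, ∑ j, gramInv g x i j * Φ x ![v, tbasis x i, tbasis x j] = 0}

/-! ### Curvature -/

/-- The sectional curvature of the plane spanned by `v` and `w`. -/
def sectional (g : Metric n M) (x : M) (v w : TangentSpace (𝓡 n) x) : ℝ :=
  let e := chartAt (EuclideanSpace ℝ (Fin n)) x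
  (∑ i, ∑ j, ∑ k, ∑ l, ∑ p, metricComp g e (e x) l p * Coord.riemann (metricComp g e) (e x) l k i j
      * coord e x i v * coord e x j w * coord e x k w * coord e x p v)
    / (g.inner x v v * g.inner x w w - g.inner x v w ^ 2)

/-- Quasi-negative sectional curvature: nonpositive on all tangent planes, and negative on all
tangent planes at some point. -/
def QuasiNegative (g : Metric n M) : Prop :=
  (∀ (x : M) (v w : TangentSpace (𝓡 n) x), LinearIndependent ℝ ![v, w] → sectional g x v w ≤ 0) ∧
  ∃ x : M, ∀ v w : TangentSpace (𝓡 n) x, LinearIndependent ℝ ![v, w] → sectional g x v w < 0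

/-! ### Geodesics and infinitesimal projective transformations -/

/-- The `m`-th coordinate of `D/dt γ'` at time `t` in the chart `e`. -/
def accel (g : Metric n M) (e : OpenPartialHomeomorph M (EuclideanSpace ℝ (Fin n)))
    (γ : ℝ → M) (t : ℝ) (m : Fin n) : ℝ :=
  deriv (deriv (fun s => e (γ s))) t m
    + ∑ i, ∑ j, Coord.christoffel (metricComp g e) (e (γ t)) m i j
        * deriv (fun s => e (γ s)) t i * deriv (fun s => e (γ s)) t j

/-- `γ` is a geodesic, with affine parameter, on the open set `J` of times. -/
def IsGeodesicOn (g : Metric n M) (γ : ℝ → M) (J : Set ℝ) : Prop :=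
  ContMDiffOn 𝓘(ℝ, ℝ) (𝓡 n) ∞ γ J ∧
  ∀ t ∈ J, ∀ e ∈ atlas (EuclideanSpace ℝ (Fin n)) M, γ t ∈ e.source →
    ∀ m, accel g e γ t m = 0

/-- `γ` is a geodesic up to its parametrisation: `D/dt γ'` is everywhere a multiple of `γ'`. -/
def IsPregeodesicOn (g : Metric n M) (γ : ℝ → M) (J : Set ℝ) : Prop :=
  ContMDiffOn 𝓘(ℝ, ℝ) (𝓡 n) ∞ γ J ∧
  ∀ t ∈ J, ∀ e ∈ atlas (EuclideanSpace ℝ (Fin n)) M, γ t ∈ e.source →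
    ∃ c : ℝ, ∀ m, accel g e γ t m = c * deriv (fun s => e (γ s)) t m

/-- `ξ` is an infinitesimal projective transformation: a smooth vector field that generates, in a
neighbourhood of any point, a local one-parameter group of transformations mapping geodesics to
geodesics (not necessarily with their affine parameter). -/
def IsInfinitesimalProjective (g : Metric n M) (ξ : (x : M) → TangentSpace (𝓡 n) x) : Prop :=
  ContMDiff (𝓡 n) (𝓡 n).tangent ∞ (fun x => (⟨x, ξ x⟩ : TangentBundle (𝓡 n) M)) ∧
  ∀ x : M, ∃ U : Set M, IsOpen U ∧ x ∈ U ∧ ∃ ε : ℝ, 0 < ε ∧ ∃ F : ℝ → M → M,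
    ContMDiffOn (𝓘(ℝ, ℝ).prod (𝓡 n)) (𝓡 n) ∞ (Function.uncurry F) (Ioo (-ε) ε ×ˢ U) ∧
    (∀ y ∈ U, F 0 y = y) ∧
    (∀ y ∈ U, IsMIntegralCurveOn (fun t => F t y) ξ (Ioo (-ε) ε)) ∧
    ∀ t ∈ Ioo (-ε) ε, ∀ (a b : ℝ) (γ : ℝ → M), IsGeodesicOn g γ (Ioo a b) →
      MapsTo γ (Ioo a b) U → IsPregeodesicOn g (fun s => F t (γ s)) (Ioo a b)

/-! ### The Riemannian volume, the `L²` product and formal adjoints -/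

variable [MeasurableSpace M]

/-- The measure `√(det g_ij) du¹ ⋯ duⁿ` on the domain of the chart `e`, as a measure on `M`. -/
def chartVolume (g : Metric n M) (e : OpenPartialHomeomorph M (EuclideanSpace ℝ (Fin n))) :
    Measure M :=
  ((volume.restrict e.target).withDensity
    (fun u => ENNReal.ofReal (Real.sqrt (metricComp g e u).det))).map e.symm

/-- The Riemannian volume measure `dv_g`: it is glued from the measures `√(det g_ij) du¹ ⋯ duⁿ`
of a sequence of charts that covers `M`, each used on the part of its domain that the earlier
charts do not meet. By the change of variables formula the choice of the charts is immaterial. -/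
def vol [CompactSpace M] [Nonempty M] (g : Metric n M) : Measure M :=
  Measure.sum fun k : ℕ =>
    (chartVolume g (chartAt (EuclideanSpace ℝ (Fin n)) (chartSeq n M k))).restrict
      (disjointed (fun i => (chartAt (EuclideanSpace ℝ (Fin n)) (chartSeq n M i)).source) k)

/-- The `L²` inner product of covariant tensor fields. -/
def l2 {r : ℕ} [CompactSpace M] [Nonempty M] (g : Metric n M) (S T : TensorField n r M) : ℝ :=
  ∫ x, tensorInner g x (S x) (T x) ∂(vol g)

/-- `A` is a formal adjoint of `E : Ω¹(M) → C^∞(T^*M ⊗ S²₀M)`. (Outside the smooth sections of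
`T^*M ⊗ S²₀M` the values of `A` are of no significance.) -/
def IsFormalAdjoint [CompactSpace M] [Nonempty M] (g : Metric n M)
    (A : TensorField n 3 M → TensorField n 1 M) : Prop :=
  (∀ Φ ∈ smoothSymTraceFree g, A Φ ∈ smoothTensor n M 1) ∧
  ∀ θ ∈ smoothTensor n M 1, ∀ Φ ∈ smoothSymTraceFree g,
    l2 g (eisenhart g θ) Φ = l2 g θ (A Φ)

/-- The operator `P : Ω¹(M) → Ω¹(M)` is (symmetric and) positive definite for the `L²` product. -/
def IsPositiveDefinite [CompactSpace M] [Nonempty M] (g : Metric n M)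
    (P : TensorField n 1 M → TensorField n 1 M) : Prop :=
  (∀ θ ∈ smoothTensor n M 1, P θ ∈ smoothTensor n M 1) ∧
  (∀ θ ∈ smoothTensor n M 1, ∀ η ∈ smoothTensor n M 1, l2 g (P θ) η = l2 g θ (P η)) ∧
  ∀ θ ∈ smoothTensor n M 1, θ ≠ 0 → 0 < l2 g (P θ) θ

end Manifold

end EisenhartOp

end

/-! Everything but the existence of the adjoint follows from the injectivity of E on smooth 1-forms.
For a formal adjoint A one has ⟨A E θ, η⟩ = ⟨E θ, E η⟩, so A ∘ E is symmetric and ⟨A E θ, θ⟩ = ‖E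
θ‖², which is positive as soon as E θ ≠ 0 (`isPositiveDefinite_of_injective`).

Injectivity is a Bochner argument. Let E θ = 0, let ξ be the vector field dual to θ, and put W(y) =
α (∇_y θ)(ξ) - (∇_ξ θ)(y) + c (div ξ) θ(y). The equation E θ = 0 and the Ricci identity express the
traces of ∇²θ that occur in div W through Ric(ξ, ξ) and the derivative of div ξ along ξ. The latter
cancels when c = 1 - 2α/(n+1), and then div W = α |∇θ|² - tr(∇θ ∘ ∇θ) + c (div ξ)² - (α + 1) Ric(ξ,
ξ) (`MetricOn.diverg_bochnerForm`). As tr(∇θ ∘ ∇θ) ≤ |∇θ|² and Ric ≤ 0, the right side is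
nonnegative and controls |∇θ|² if α > 1 and c ≥ 0, that is 1 < α ≤ (n+1)/2. This range is nonempty
for n ≥ 2, and α = (n+3)/4 is its midpoint. By the divergence theorem (`integral_divField`) div W
has integral zero, hence vanishes; so θ is parallel and all the curvature terms are zero. Where the
curvature is strictly negative this forces ξ = 0, and a parallel form on a connected manifold has
constant length, so θ = 0 (`eq_zero_of_eisenhart_eq_zero`).

For an infinitesimal projective transformation ξ, differentiating the pregeodesic equation along the
flow shows that (L_ξ ∇)(v, v) is a multiple of v (`MetricOn.lieGam_parallel`). Polarising and taking
a trace gives (n+1)(L_ξ ∇)(x, y) = τ(y) x + τ(x) y for a linear form τ (`bilin_eq_of_parallel`), and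
in terms of the dual 1-form this implies E θ = 0 (`MetricOn.eisLocal_eq_zero_of_parallel`).
Injectivity then gives ξ = 0.

The adjoint exists by integration by parts in charts, glued with a partition of unity
(`exists_isFormalAdjoint`). The tensor calculus takes place on open subsets of a vector space, with
bilinear maps instead of indices. `Transition` carries it from chart to chart, and
`MetricOn.eisenhart_eq` ties it to the formulas in components. -/

noncomputable section

set_option maxSynthPendingDepth 3
set_option linter.unusedSectionVars false

namespace EisenhartOp

/-! ### Linear algebra: Gram matrices and contractions -/

section LinearAlgebra

variable {n : ℕ} {V : Type*} [AddCommGroup V] [Module ℝ V]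

/-- The Gram matrix of a family of vectors. -/
def gramOf (B : V →ₗ[ℝ] V →ₗ[ℝ] ℝ) (b : Fin n → V) : Matrix (Fin n) (Fin n) ℝ :=
  Matrix.of fun i j => B (b i) (b j)

theorem gramOf_basis_change (B : V →ₗ[ℝ] V →ₗ[ℝ] ℝ) (b b' : Module.Basis (Fin n) ℝ V) :
    gramOf B b' = (b.toMatrix b').transpose * gramOf B b * b.toMatrix b' := by
  ext i j
  have h : ∀ j, b' j = ∑ k, b.toMatrix b' k j • b k := fun j => by
    simp [Module.Basis.toMatrix_apply]
  simp only [gramOf, Matrix.of_apply, Matrix.mul_apply, Matrix.transpose_apply, Finset.sum_mul]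
  rw [h i, h j]
  simp only [map_sum, map_smul, LinearMap.sum_apply, LinearMap.smul_apply, smul_eq_mul]
  rw [Finset.sum_congr rfl]
  intro l _
  rw [Finset.mul_sum]
  exact Finset.sum_congr rfl fun k _ => by ring

/-- The inverse Gram matrix transforms contravariantly, which is why contractions do not depend on
the basis. Degenerate forms are covered as well: the base change is invertible, and
`Matrix.mul_inv_rev` holds for singular matrices, whose inverse is zero. -/
theorem toMatrix_mul_gramOf_inv_mul (B : V →ₗ[ℝ] V →ₗ[ℝ] ℝ) (b b' : Module.Basis (Fin n) ℝ V) :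
    b.toMatrix b' * (gramOf B b')⁻¹ * (b.toMatrix b').transpose = (gramOf B b)⁻¹ := by
  have h1 : b.toMatrix b' * b'.toMatrix b = 1 := b.toMatrix_mul_toMatrix_flip b'
  have h2 : (b.toMatrix b')⁻¹ = b'.toMatrix b := Matrix.inv_eq_right_inv h1
  have h3 : ((b.toMatrix b').transpose)⁻¹ = (b'.toMatrix b).transpose := by
    rw [← Matrix.transpose_nonsing_inv, h2]
  rw [gramOf_basis_change B b b', Matrix.mul_inv_rev, Matrix.mul_inv_rev, h2, h3]
  calc b.toMatrix b' * (b'.toMatrix b * ((gramOf B b)⁻¹ * (b'.toMatrix b).transpose))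
        * (b.toMatrix b').transpose
      = (b.toMatrix b' * b'.toMatrix b) * (gramOf B b)⁻¹
        * ((b'.toMatrix b).transpose * (b.toMatrix b').transpose) := by
        simp only [Matrix.mul_assoc]
    _ = _ := by rw [← Matrix.transpose_mul, h1]; simp

/-- The full contraction of two multilinear forms of the same rank, expressed in a basis. -/
def contraction {r : ℕ} (B : V →ₗ[ℝ] V →ₗ[ℝ] ℝ) (b : Fin n → V)
    (S T : MultilinearMap ℝ (fun _ : Fin r => V) ℝ) : ℝ :=
  ∑ I : Fin r → Fin n, ∑ J : Fin r → Fin n,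
    (∏ a, (gramOf B b)⁻¹ (I a) (J a)) * S (fun a => b (I a)) * T (fun a => b (J a))

theorem multilinear_basis_change {r : ℕ} (S : MultilinearMap ℝ (fun _ : Fin r => V) ℝ)
    (b b' : Module.Basis (Fin n) ℝ V) (I : Fin r → Fin n) :
    S (fun a => b' (I a))
      = ∑ K : Fin r → Fin n, (∏ a, b.toMatrix b' (K a) (I a)) * S (fun a => b (K a)) := by
  have h : ∀ j, b' j = ∑ k, b.toMatrix b' k j • b k := fun j => by
    simp [Module.Basis.toMatrix_apply]
  calc S (fun a => b' (I a)) = S (fun a => ∑ k, b.toMatrix b' k (I a) • b k) := by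
        congr 1; ext a; exact h _
    _ = _ := by
        rw [S.map_sum]
        exact Finset.sum_congr rfl fun K _ => by rw [S.map_smul_univ, smul_eq_mul]

/-- This lets `tensorInner`, defined with the standard basis, be computed in coordinate frames for
smoothness and in orthonormal bases for positivity. -/
theorem contraction_basis_change {r : ℕ} (B : V →ₗ[ℝ] V →ₗ[ℝ] ℝ)
    (b b' : Module.Basis (Fin n) ℝ V) (S T : MultilinearMap ℝ (fun _ : Fin r => V) ℝ) :
    contraction B b' S T = contraction B b S T := by
  unfold contraction
  -- The base change acts on each slot separately, so the double sum over multi-indices factors into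
  -- a product over slots, and each factor is the rank one identity.
  have key : ∀ K L : Fin r → Fin n, ∑ I : Fin r → Fin n, ∑ J : Fin r → Fin n,
      (∏ a, (gramOf B b')⁻¹ (I a) (J a)) * (∏ a, b.toMatrix b' (K a) (I a))
        * (∏ a, b.toMatrix b' (L a) (J a)) = ∏ a, (gramOf B b)⁻¹ (K a) (L a) := by
    intro K L
    rw [← toMatrix_mul_gramOf_inv_mul B b b']
    simp only [Matrix.mul_apply, Matrix.transpose_apply, Finset.sum_mul]
    have e1 : ∀ I : Fin r → Fin n, ∑ J : Fin r → Fin n,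
        (∏ a, (gramOf B b')⁻¹ (I a) (J a)) * (∏ a, b.toMatrix b' (K a) (I a))
        * (∏ a, b.toMatrix b' (L a) (J a)) = ∏ a, ∑ j, (gramOf B b')⁻¹ (I a) j
          * b.toMatrix b' (K a) (I a) * b.toMatrix b' (L a) j := by
      intro I
      rw [Finset.prod_univ_sum]
      simp [Finset.prod_mul_distrib, Fintype.piFinset_univ]
    rw [Finset.sum_congr rfl fun I _ => e1 I]
    have e2 := (Finset.prod_univ_sum (fun _ : Fin r => (Finset.univ : Finset (Fin n)))
      (fun a i => ∑ j, (gramOf B b')⁻¹ i j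
          * b.toMatrix b' (K a) i * b.toMatrix b' (L a) j)).symm
    rw [Fintype.piFinset_univ] at e2
    rw [e2]
    refine Finset.prod_congr rfl fun a _ => ?_
    rw [Finset.sum_comm]
    exact Finset.sum_congr rfl fun i _ => Finset.sum_congr rfl fun j _ => by ring
  calc _ = ∑ I : Fin r → Fin n, ∑ J : Fin r → Fin n, ∑ K : Fin r → Fin n, ∑ L : Fin r → Fin n,
        ((∏ a, (gramOf B b')⁻¹ (I a) (J a)) * (∏ a, b.toMatrix b' (K a) (I a))
        * (∏ a, b.toMatrix b' (L a) (J a))) * (S (fun a => b (K a)) * T (fun a => b (L a))) := by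
        refine Finset.sum_congr rfl fun I _ => Finset.sum_congr rfl fun J _ => ?_
        rw [multilinear_basis_change S b b' I, multilinear_basis_change T b b' J, mul_assoc,
          Finset.sum_mul_sum, Finset.mul_sum]
        refine Finset.sum_congr rfl fun K _ => ?_
        rw [Finset.mul_sum]
        exact Finset.sum_congr rfl fun L _ => by ring
    _ = ∑ K : Fin r → Fin n, ∑ L : Fin r → Fin n, (∑ I : Fin r → Fin n, ∑ J : Fin r → Fin n,
        (∏ a, (gramOf B b')⁻¹ (I a) (J a)) * (∏ a, b.toMatrix b' (K a) (I a))
        * (∏ a, b.toMatrix b' (L a) (J a))) * (S (fun a => b (K a)) * T (fun a => b (L a))) := by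
        simp only [Finset.sum_mul]
        rw [Finset.sum_congr rfl fun I _ => Finset.sum_comm, Finset.sum_comm]
        refine Finset.sum_congr rfl fun K _ => ?_
        rw [Finset.sum_congr rfl fun I _ => Finset.sum_comm, Finset.sum_comm]
    _ = _ := by
        refine Finset.sum_congr rfl fun K _ => Finset.sum_congr rfl fun L _ => ?_
        rw [key]; ring

/-- The trace of a bilinear form `C` with respect to the form `B`, expressed in a basis. -/
def traceIn (B C : V →ₗ[ℝ] V →ₗ[ℝ] ℝ) (b : Fin n → V) : ℝ :=
  ∑ i, ∑ j, (gramOf B b)⁻¹ i j * C (b i) (b j)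

theorem traceIn_eq_trace (B C : V →ₗ[ℝ] V →ₗ[ℝ] ℝ) (b : Fin n → V) :
    traceIn B C b = ((gramOf B b)⁻¹ * (gramOf C b).transpose).trace := by
  simp [traceIn, Matrix.trace, Matrix.mul_apply, gramOf]

/-- The trace is that of G⁻¹ Cᵀ, and cyclicity moves the base change matrix around to where it
completes the inverse Gram matrix of the other basis. -/
theorem traceIn_basis_change (B C : V →ₗ[ℝ] V →ₗ[ℝ] ℝ) (b b' : Module.Basis (Fin n) ℝ V) :
    traceIn B C b' = traceIn B C b := by
  rw [traceIn_eq_trace, traceIn_eq_trace, ← toMatrix_mul_gramOf_inv_mul B b b',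
    gramOf_basis_change C b b', Matrix.transpose_mul, Matrix.transpose_mul,
    Matrix.transpose_transpose,
    show (gramOf B b')⁻¹ * ((b.toMatrix b').transpose * ((gramOf C b).transpose * b.toMatrix b'))
      = ((gramOf B b')⁻¹ * (b.toMatrix b').transpose * (gramOf C b).transpose) * b.toMatrix b' by
      simp only [Matrix.mul_assoc], Matrix.trace_mul_comm]
  simp only [Matrix.mul_assoc]

/-- A positive definite symmetric bilinear form. -/
structure PosForm (B : V →ₗ[ℝ] V →ₗ[ℝ] ℝ) : Prop where
  symm : ∀ x y, B x y = B y x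
  pos : ∀ x, x ≠ 0 → 0 < B x x

theorem PosForm.eq_of_forall {B : V →ₗ[ℝ] V →ₗ[ℝ] ℝ} (hB : PosForm B) {x y : V}
    (h : ∀ z, B x z = B y z) : x = y := by
  by_contra hne
  have h1 := hB.pos (x - y) (sub_ne_zero.2 hne)
  have h2 : B (x - y) (x - y) = 0 := by
    rw [map_sub B, LinearMap.sub_apply, h, sub_self]
  exact h1.ne' h2

/-- An orthogonal basis, each vector divided by its length. Most of the pointwise identities and
inequalities below are checked in such a basis, where contractions are plain sums. -/
theorem PosForm.exists_orthonormal {B : V →ₗ[ℝ] V →ₗ[ℝ] ℝ} (hB : PosForm B)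
    (b₀ : Module.Basis (Fin n) ℝ V) :
    ∃ b : Module.Basis (Fin n) ℝ V, ∀ i j, B (b i) (b j) = if i = j then 1 else 0 := by
  have : Module.Finite ℝ V := Module.Finite.of_basis b₀
  have hn : Module.finrank ℝ V = n := by simpa using Module.finrank_eq_card_basis b₀
  have hs : LinearMap.IsSymm B := ⟨fun x y => hB.symm x y⟩
  obtain ⟨v, hv⟩ := LinearMap.BilinForm.exists_orthogonal_basis hs
  subst hn
  have hp : ∀ i, 0 < B (v i) (v i) := fun i => hB.pos _ (v.ne_zero i)
  have hu : ∀ i, IsUnit ((Real.sqrt (B (v i) (v i)))⁻¹) := fun i =>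
    (inv_ne_zero (Real.sqrt_pos.2 (hp i)).ne').isUnit
  refine ⟨v.isUnitSMul hu, fun i j => ?_⟩
  simp only [Module.Basis.isUnitSMul_apply, map_smul, LinearMap.smul_apply, smul_eq_mul]
  split_ifs with h
  · subst h
    have := Real.mul_self_sqrt (hp i).le
    have h0 := (Real.sqrt_pos.2 (hp i)).ne'
    field_simp
    linarith
  · have : B (v i) (v j) = 0 := hv h
    rw [this]; simp

theorem gramOf_orthonormal {B : V →ₗ[ℝ] V →ₗ[ℝ] ℝ} {b : Fin n → V}
    (hb : ∀ i j, B (b i) (b j) = if i = j then 1 else 0) : gramOf B b = 1 := by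
  ext i j; simp [gramOf, hb, Matrix.one_apply]

theorem traceIn_orthonormal {B : V →ₗ[ℝ] V →ₗ[ℝ] ℝ} (C : V →ₗ[ℝ] V →ₗ[ℝ] ℝ) {b : Fin n → V}
    (hb : ∀ i j, B (b i) (b j) = if i = j then 1 else 0) : traceIn B C b = ∑ i, C (b i) (b i) := by
  simp [traceIn, gramOf_orthonormal hb, Matrix.one_apply]

theorem contraction_orthonormal {r : ℕ} {B : V →ₗ[ℝ] V →ₗ[ℝ] ℝ} {b : Fin n → V}
    (hb : ∀ i j, B (b i) (b j) = if i = j then 1 else 0)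
    (S T : MultilinearMap ℝ (fun _ : Fin r => V) ℝ) :
    contraction B b S T = ∑ I : Fin r → Fin n, S (fun a => b (I a)) * T (fun a => b (I a)) := by
  unfold contraction
  refine Finset.sum_congr rfl fun I _ => ?_
  rw [Finset.sum_eq_single I]
  · simp [gramOf_orthonormal hb]
  · intro J _ hJ
    obtain ⟨a, ha⟩ := Function.ne_iff.1 hJ
    have : ∏ a, (gramOf B b)⁻¹ (I a) (J a) = 0 := by
      refine Finset.prod_eq_zero (Finset.mem_univ a) ?_
      simp [gramOf_orthonormal hb, ha.symm]
    rw [this]; ring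
  · simp

theorem orthonormal_expand {B : V →ₗ[ℝ] V →ₗ[ℝ] ℝ} {b : Module.Basis (Fin n) ℝ V}
    (hb : ∀ i j, B (b i) (b j) = if i = j then 1 else 0) (x : V) :
    x = ∑ i, B x (b i) • b i := by
  have h : ∀ j, B x (b j) = b.repr x j := fun j => by
    conv_lhs => rw [← b.sum_repr x, map_sum, LinearMap.sum_apply]
    simp [hb, -Module.Basis.sum_repr]
  simp_rw [h]
  exact (b.sum_repr x).symm

theorem PosForm.contraction_self_nonneg {r : ℕ} {B : V →ₗ[ℝ] V →ₗ[ℝ] ℝ} (hB : PosForm B)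
    (b : Module.Basis (Fin n) ℝ V) (S : MultilinearMap ℝ (fun _ : Fin r => V) ℝ) :
    0 ≤ contraction B b S S := by
  obtain ⟨b', hb'⟩ := hB.exists_orthonormal b
  rw [← contraction_basis_change B b b', contraction_orthonormal hb']
  exact Finset.sum_nonneg fun _ _ => mul_self_nonneg _

theorem PosForm.contraction_self_eq_zero {r : ℕ} {B : V →ₗ[ℝ] V →ₗ[ℝ] ℝ} (hB : PosForm B)
    (b : Module.Basis (Fin n) ℝ V) {S : MultilinearMap ℝ (fun _ : Fin r => V) ℝ}
    (h : contraction B b S S = 0) : S = 0 := by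
  obtain ⟨b', hb'⟩ := hB.exists_orthonormal b
  rw [← contraction_basis_change B b b', contraction_orthonormal hb',
    Finset.sum_eq_zero_iff_of_nonneg fun _ _ => mul_self_nonneg _] at h
  refine Module.Basis.ext_multilinear (fun _ => b') fun I => ?_
  simpa using h I (Finset.mem_univ _)

theorem PosForm.gramOf_det_pos {B : V →ₗ[ℝ] V →ₗ[ℝ] ℝ} (hB : PosForm B)
    (b : Module.Basis (Fin n) ℝ V) : 0 < (gramOf B b).det := by
  obtain ⟨b', hb'⟩ := hB.exists_orthonormal b
  rw [gramOf_basis_change B b' b, gramOf_orthonormal hb']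
  have h : b'.toMatrix b * b.toMatrix b' = 1 := b'.toMatrix_mul_toMatrix_flip b
  have h0 : (b'.toMatrix b).det ≠ 0 := fun h0 => by
    have := congrArg Matrix.det h
    rw [Matrix.det_mul, h0, zero_mul, Matrix.det_one] at this
    exact zero_ne_one this
  simpa using mul_self_pos.2 h0

theorem contraction_comm {r : ℕ} {B : V →ₗ[ℝ] V →ₗ[ℝ] ℝ} (hB : ∀ x y, B x y = B y x)
    (b : Fin n → V) (S T : MultilinearMap ℝ (fun _ : Fin r => V) ℝ) :
    contraction B b S T = contraction B b T S := by
  unfold contraction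
  rw [Finset.sum_comm]
  have h : (gramOf B b)⁻¹.transpose = (gramOf B b)⁻¹ := by
    rw [Matrix.transpose_nonsing_inv]
    congr 1
    ext i j
    exact hB _ _
  refine Finset.sum_congr rfl fun I _ => Finset.sum_congr rfl fun J _ => ?_
  have : ∀ a, (gramOf B b)⁻¹ (J a) (I a) = (gramOf B b)⁻¹ (I a) (J a) := fun a => by
    conv_lhs => rw [← h]
    rfl
  simp_rw [this]
  ring

end LinearAlgebra

/-! ### Riemannian calculus on open subsets of Euclidean space -/

section Smoothness

variable {E F H : Type*} [NormedAddCommGroup E] [NormedSpace ℝ E] [NormedAddCommGroup F]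
  [NormedSpace ℝ F] [NormedAddCommGroup H] [NormedSpace ℝ H]

theorem contDiffOn_matrix_det {n : ℕ} {A : E → Matrix (Fin n) (Fin n) ℝ} {Ω : Set E}
    (hA : ∀ i j, ContDiffOn ℝ ∞ (fun u => A u i j) Ω) : ContDiffOn ℝ ∞ (fun u => (A u).det) Ω := by
  simp only [Matrix.det_apply']
  exact ContDiffOn.sum fun σ _ => contDiffOn_const.mul (contDiffOn_prod fun i _ => hA _ _)

theorem contDiffOn_matrix_inv {n : ℕ} {A : E → Matrix (Fin n) (Fin n) ℝ} {Ω : Set E}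
    (hA : ∀ i j, ContDiffOn ℝ ∞ (fun u => A u i j) Ω) (hd : ∀ u ∈ Ω, (A u).det ≠ 0) (i j : Fin n) :
    ContDiffOn ℝ ∞ (fun u => (A u)⁻¹ i j) Ω := by
  simp only [Matrix.inv_def, Ring.inverse_eq_inv', Matrix.smul_apply, smul_eq_mul,
    Matrix.adjugate_apply]
  refine ((contDiffOn_matrix_det hA).inv hd).mul (contDiffOn_matrix_det fun k l => ?_)
  by_cases h : k = j
  · subst h; simp only [Matrix.updateRow_self]; exact contDiffOn_const
  · simp only [Matrix.updateRow_ne h]; exact hA _ _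

theorem fderiv_apply_const {f : E → F →L[ℝ] H} {u : E} (hf : DifferentiableAt ℝ f u) (z : E)
    (y : F) : fderiv ℝ (fun w => f w y) u z = fderiv ℝ f u z y := by
  rw [fderiv_clm_apply hf (differentiableAt_const y)]; simp

theorem fderiv_apply_const₂ {K : Type*} [NormedAddCommGroup K] [NormedSpace ℝ K]
    {f : E → F →L[ℝ] H →L[ℝ] K} {u : E} (hf : DifferentiableAt ℝ f u) (z : E)
    (y : F) (x : H) : fderiv ℝ (fun w => f w y x) u z = fderiv ℝ f u z y x := by
  rw [fderiv_apply_const (f := fun w => f w y) (hf.clm_apply (differentiableAt_const y)),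
    fderiv_apply_const hf]

end Smoothness

/-! ### Bilinear forms, duality and metric traces -/

variable {E : Type*} [NormedAddCommGroup E] [NormedSpace ℝ E]

variable (E) in
/-- Continuous bilinear forms. -/
abbrev Form : Type _ := E →L[ℝ] E →L[ℝ] ℝ

theorem contDiffOn_form [FiniteDimensional ℝ E] {F : Type*} [NormedAddCommGroup F] [NormedSpace ℝ F]
    {Ω : Set F} {B : F → Form E} (h : ∀ x y, ContDiffOn ℝ ∞ (fun u => B u x y) Ω) :
    ContDiffOn ℝ ∞ B Ω :=
  contDiffOn_clm_apply.2 fun x => contDiffOn_clm_apply.2 fun y => h x y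

/-- The vector dual to a linear form. -/
def raise (B : Form E) : (E →L[ℝ] ℝ) →L[ℝ] E := ContinuousLinearMap.inverse B

/-- Positivity gives injectivity, and a finite-dimensional space and its dual have equal dimension.
Hence `raise`, which takes a default value on non-invertible forms, is a true inverse on positive
ones. -/
theorem exists_equiv_of_posForm [FiniteDimensional ℝ E] {B : Form E}
    (hB : PosForm B.toLinearMap₁₂) : ∃ e : E ≃L[ℝ] (E →L[ℝ] ℝ), (e : E →L[ℝ] E →L[ℝ] ℝ) = B := by
  have hinj : Function.Injective (B : E →ₗ[ℝ] E →L[ℝ] ℝ) := fun x y h =>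
    hB.eq_of_forall fun z => congrArg (fun l : E →L[ℝ] ℝ => l z) h
  have hd : Module.finrank ℝ E = Module.finrank ℝ (E →L[ℝ] ℝ) := by
    rw [← LinearEquiv.finrank_eq (LinearMap.toContinuousLinearMap : (E →ₗ[ℝ] ℝ) ≃ₗ[ℝ] E →L[ℝ] ℝ)]
    exact (Subspace.dual_finrank_eq (K := ℝ) (V := E)).symm
  exact ⟨(LinearEquiv.ofInjectiveOfFinrankEq (B : E →ₗ[ℝ] E →L[ℝ] ℝ) hinj
    hd).toContinuousLinearEquiv, by ext; rfl⟩

theorem form_raise [FiniteDimensional ℝ E] {B : Form E} (hB : PosForm B.toLinearMap₁₂)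
    (l : E →L[ℝ] ℝ) (y : E) : B (raise B l) y = l y := by
  obtain ⟨e, rfl⟩ := exists_equiv_of_posForm hB
  simp [raise]

variable (E) in
/-- The trace, as a continuous linear form. -/
def traceCLM [FiniteDimensional ℝ E] : (E →L[ℝ] E) →L[ℝ] ℝ :=
  LinearMap.toContinuousLinearMap
    ((LinearMap.trace ℝ E).comp (ContinuousLinearMap.coeLM ℝ : (E →L[ℝ] E) →ₗ[ℝ] E →ₗ[ℝ] E))

theorem traceCLM_apply [FiniteDimensional ℝ E] {n : ℕ} (A : E →L[ℝ] E)
    (b : Module.Basis (Fin n) ℝ E) : traceCLM E A = ∑ i, b.repr (A (b i)) i := by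
  change LinearMap.trace ℝ E (A : E →ₗ[ℝ] E) = _
  rw [LinearMap.trace_eq_matrix_trace ℝ b, Matrix.trace]
  exact Finset.sum_congr rfl fun i _ => by
    rw [Matrix.diag_apply, LinearMap.toMatrix_apply]; rfl

theorem traceCLM_orthonormal [FiniteDimensional ℝ E] {n : ℕ} {B : Form E} (A : E →L[ℝ] E)
    {b : Module.Basis (Fin n) ℝ E} (hb : ∀ i j, B (b i) (b j) = if i = j then 1 else 0) :
    traceCLM E A = ∑ i, B (A (b i)) (b i) := by
  rw [traceCLM_apply A b]
  refine Finset.sum_congr rfl fun i _ => ?_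
  conv_lhs => rw [orthonormal_expand (B := B.toLinearMap₁₂) hb (A (b i))]
  simp [Finsupp.single_apply]

/-- The trace of the bilinear form `C` with respect to `B`. -/
def formTrace [FiniteDimensional ℝ E] (B C : Form E) : ℝ := traceCLM E ((raise B).comp C)

theorem formTrace_orthonormal [FiniteDimensional ℝ E] {n : ℕ} {B : Form E}
    (hB : PosForm B.toLinearMap₁₂) (C : Form E) {b : Module.Basis (Fin n) ℝ E}
    (hb : ∀ i j, B (b i) (b j) = if i = j then 1 else 0) : formTrace B C = ∑ i, C (b i) (b i) := by
  refine (traceCLM_orthonormal ((raise B).comp C) hb).trans ?_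
  exact Finset.sum_congr rfl fun i _ => form_raise hB _ _

theorem formTrace_eq_traceIn [FiniteDimensional ℝ E] {n : ℕ} {B : Form E}
    (hB : PosForm B.toLinearMap₁₂) (C : Form E) (b : Module.Basis (Fin n) ℝ E) :
    formTrace B C = traceIn B.toLinearMap₁₂ C.toLinearMap₁₂ b := by
  obtain ⟨b', hb'⟩ := hB.exists_orthonormal b
  rw [formTrace_orthonormal hB C hb', ← traceIn_basis_change _ _ b b', traceIn_orthonormal _ hb']
  rfl

/-! ### Metrics, the Levi-Civita connection and covariant derivatives -/

/-- A smooth Riemannian metric on an open set. -/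
structure MetricOn (Ω : Set E) (G : E → Form E) : Prop where
  isOpen : IsOpen Ω
  smooth : ContDiffOn ℝ ∞ G Ω
  pos : ∀ u ∈ Ω, PosForm (G u).toLinearMap₁₂

/-- The Koszul expression `(x, y, z) ↦ (D x y z + D y x z - D z x y) / 2`. -/
def koszulForm (D : E →L[ℝ] E →L[ℝ] E →L[ℝ] ℝ) : E →L[ℝ] E →L[ℝ] E →L[ℝ] ℝ :=
  (1 / 2 : ℝ) • (D + D.flip - (ContinuousLinearMap.flipₗᵢ ℝ E E ℝ :
    (E →L[ℝ] E →L[ℝ] ℝ) →L[ℝ] (E →L[ℝ] E →L[ℝ] ℝ)).comp D.flip)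

theorem koszulForm_apply (D : E →L[ℝ] E →L[ℝ] E →L[ℝ] ℝ) (x y z : E) :
    koszulForm D x y z = (1 / 2) * (D x y z + D y x z - D z x y) := by
  simp only [koszulForm, smul_apply, sub_apply, add_apply, ContinuousLinearMap.flip_apply,
    smul_eq_mul]
  rfl

/-- The Levi-Civita connection, as a bilinear map. -/
def gam (G : E → Form E) (u : E) : E →L[ℝ] E →L[ℝ] E :=
  (ContinuousLinearMap.compL ℝ E (E →L[ℝ] ℝ) E (raise (G u))).comp (koszulForm (fderiv ℝ G u))

theorem gam_apply (G : E → Form E) (u x y : E) :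
    gam G u x y = raise (G u) (koszulForm (fderiv ℝ G u) x y) := rfl

/-- The covariant derivative `(∇_z θ)(y)` of a 1-form. -/
def nabla₁ (G : E → Form E) (θ : E → E →L[ℝ] ℝ) (u : E) : Form E :=
  fderiv ℝ θ u - (ContinuousLinearMap.compL ℝ E E ℝ (θ u)).comp (gam G u)

theorem nabla₁_apply (G : E → Form E) (θ : E → E →L[ℝ] ℝ) (u z y : E) :
    nabla₁ G θ u z y = fderiv ℝ θ u z y - θ u (gam G u z y) := by
  simp [nabla₁]

/-- The covariant derivative `(∇_z h)(y, x)` of a covariant 2-tensor. -/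
def nabla₂ (G : E → Form E) (h : E → Form E) (u z y x : E) : ℝ :=
  fderiv ℝ h u z y x - h u (gam G u z y) x - h u y (gam G u z x)

/-- The symmetrised covariant derivative `δ^* θ`. -/
def symNabla (G : E → Form E) (θ : E → E →L[ℝ] ℝ) (u : E) : Form E :=
  (1 / 2 : ℝ) • (nabla₁ G θ u + (nabla₁ G θ u).flip)

theorem symNabla_apply (G : E → Form E) (θ : E → E →L[ℝ] ℝ) (u y x : E) :
    symNabla G θ u y x = (1 / 2) * (nabla₁ G θ u y x + nabla₁ G θ u x y) := by
  simp [symNabla, mul_add]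

/-- The divergence of the vector field dual to a 1-form. -/
def diverg [FiniteDimensional ℝ E] (G : E → Form E) (θ : E → E →L[ℝ] ℝ) (u : E) : ℝ :=
  formTrace (G u) (nabla₁ G θ u)

/-- The Eisenhart operator, `(z, y, x) ↦ (Eθ)(z, y, x)`. -/
def eisLocal [FiniteDimensional ℝ E] (n : ℕ) (G : E → Form E) (θ : E → E →L[ℝ] ℝ) (u z y x : E) : ℝ :=
  2 * ((n : ℝ) + 1) * nabla₂ G (symNabla G θ) u z y x
    - 2 * G u y x * fderiv ℝ (diverg G θ) u z
    - G u z x * fderiv ℝ (diverg G θ) u y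
    - G u z y * fderiv ℝ (diverg G θ) u x

/-- The curvature operator `R(x, y) z`. -/
def curv (G : E → Form E) (u x y z : E) : E :=
  fderiv ℝ (gam G) u x y z - fderiv ℝ (gam G) u y x z
    + gam G u x (gam G u y z) - gam G u y (gam G u x z)

namespace MetricOn

variable [FiniteDimensional ℝ E] [CompleteSpace E] {Ω : Set E} {G : E → Form E} (hG : MetricOn Ω G)
include hG

theorem mem_nhds {u : E} (hu : u ∈ Ω) : Ω ∈ 𝓝 u := hG.isOpen.mem_nhds hu

theorem contDiffAt {u : E} (hu : u ∈ Ω) : ContDiffAt ℝ ∞ G u :=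
  hG.smooth.contDiffAt (hG.mem_nhds hu)

theorem differentiableAt {u : E} (hu : u ∈ Ω) : DifferentiableAt ℝ G u :=
  (hG.contDiffAt hu).differentiableAt (by simp)

theorem symm {u : E} (hu : u ∈ Ω) (x y : E) : G u x y = G u y x := (hG.pos u hu).symm x y

/-- Inversion of continuous linear maps is smooth at every invertible one. -/
theorem smooth_raise :
    ContDiffOn ℝ ∞ (fun u => raise (G u)) Ω := fun u hu => by
  obtain ⟨e, he⟩ := exists_equiv_of_posForm (hG.pos u hu)
  have h := contDiffAt_map_inverse (𝕜 := ℝ) (n := ∞) e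
  rw [he] at h
  exact (h.comp u (hG.contDiffAt hu)).contDiffWithinAt

theorem smooth_formTrace {C : E → Form E}
    (hC : ContDiffOn ℝ ∞ C Ω) : ContDiffOn ℝ ∞ (fun u => formTrace (G u) (C u)) Ω :=
  (traceCLM E).contDiff.comp_contDiffOn (hG.smooth_raise.clm_comp hC)

theorem eq_of_forall {u : E} (hu : u ∈ Ω) {x y : E} (h : ∀ z, G u x z = G u y z) :
    x = y := (hG.pos u hu).eq_of_forall h

theorem fderiv_symm {u : E} (hu : u ∈ Ω) (z x y : E) :
    fderiv ℝ G u z x y = fderiv ℝ G u z y x := by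
  rw [← fderiv_apply_const₂ (hG.differentiableAt hu), ← fderiv_apply_const₂ (hG.differentiableAt hu)]
  congr 1
  refine Filter.EventuallyEq.fderiv_eq ?_
  filter_upwards [hG.mem_nhds hu] with w hw using hG.symm hw x y

theorem koszul {u : E} (hu : u ∈ Ω) (x y z : E) : G u (gam G u x y) z
    = (1 / 2) * (fderiv ℝ G u x y z + fderiv ℝ G u y x z - fderiv ℝ G u z x y) := by
  rw [gam_apply, form_raise (hG.pos u hu), koszulForm_apply]

theorem gam_symm {u : E} (hu : u ∈ Ω) (x y : E) : gam G u x y = gam G u y x := by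
  refine hG.eq_of_forall hu fun z => ?_
  rw [hG.koszul hu, hG.koszul hu, hG.fderiv_symm hu z x y]; ring

/-- Compatibility of the connection with the metric, ∇g = 0: in the sum of two Koszul expressions
all derivatives of the metric but one cancel by symmetry. -/
theorem fderiv_metric {u : E} (hu : u ∈ Ω) (z x y : E) :
    fderiv ℝ G u z x y = G u (gam G u z x) y + G u x (gam G u z y) := by
  rw [hG.symm hu x, hG.koszul hu, hG.koszul hu]
  linarith [hG.fderiv_symm hu z y x, hG.fderiv_symm hu x y z, hG.fderiv_symm hu y x z]

theorem smooth_fderiv {F : Type*} [NormedAddCommGroup F] [NormedSpace ℝ F] {f : E → F}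
    (hf : ContDiffOn ℝ ∞ f Ω) : ContDiffOn ℝ ∞ (fderiv ℝ f) Ω :=
  hf.fderiv_of_isOpen hG.isOpen (by simp)

theorem smooth_gam : ContDiffOn ℝ ∞ (gam G) Ω := by
  refine contDiffOn_clm_apply.2 fun x => contDiffOn_clm_apply.2 fun y => ?_
  simp only [gam_apply]
  refine hG.smooth_raise.clm_apply (contDiffOn_clm_apply.2 fun z => ?_)
  have hD := hG.smooth_fderiv hG.smooth
  have h3 : ∀ a b c : E, ContDiffOn ℝ ∞ (fun u => fderiv ℝ G u a b c) Ω := fun a b c =>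
    ((hD.clm_apply contDiffOn_const).clm_apply contDiffOn_const).clm_apply contDiffOn_const
  simp only [koszulForm_apply]
  exact contDiffOn_const.mul (((h3 x y z).add (h3 y x z)).sub (h3 z x y))

variable {θ : E → E →L[ℝ] ℝ}

theorem smooth_nabla₁ (hθ : ContDiffOn ℝ ∞ θ Ω) : ContDiffOn ℝ ∞ (nabla₁ G θ) Ω := by
  refine contDiffOn_form fun z y => ?_
  simp only [nabla₁_apply]
  exact (((hG.smooth_fderiv hθ).clm_apply contDiffOn_const).clm_apply contDiffOn_const).sub
    (hθ.clm_apply ((hG.smooth_gam.clm_apply contDiffOn_const).clm_apply contDiffOn_const))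

theorem smooth_symNabla (hθ : ContDiffOn ℝ ∞ θ Ω) : ContDiffOn ℝ ∞ (symNabla G θ) Ω := by
  refine contDiffOn_form fun z y => ?_
  simp only [symNabla_apply]
  have h := hG.smooth_nabla₁ hθ
  exact contDiffOn_const.mul (((h.clm_apply contDiffOn_const).clm_apply contDiffOn_const).add
    ((h.clm_apply contDiffOn_const).clm_apply contDiffOn_const))

theorem smooth_diverg (hθ : ContDiffOn ℝ ∞ θ Ω) : ContDiffOn ℝ ∞ (diverg G θ) Ω :=
  hG.smooth_formTrace (hG.smooth_nabla₁ hθ)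

theorem smooth_nabla₂ {h : E → Form E} (hh : ContDiffOn ℝ ∞ h Ω) (z y x : E) :
    ContDiffOn ℝ ∞ (fun u => nabla₂ G h u z y x) Ω := by
  unfold nabla₂
  have hg : ∀ a b, ContDiffOn ℝ ∞ (fun u => gam G u a b) Ω := fun a b =>
    (hG.smooth_gam.clm_apply contDiffOn_const).clm_apply contDiffOn_const
  exact (((((hG.smooth_fderiv hh).clm_apply contDiffOn_const).clm_apply contDiffOn_const).clm_apply
    contDiffOn_const).sub ((hh.clm_apply (hg z y)).clm_apply contDiffOn_const)).sub
    ((hh.clm_apply contDiffOn_const).clm_apply (hg z x))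

theorem smooth_eisLocal (hθ : ContDiffOn ℝ ∞ θ Ω) (z y x : E) :
    ContDiffOn ℝ ∞ (fun u => eisLocal n G θ u z y x) Ω := by
  unfold eisLocal
  have hg : ∀ a b, ContDiffOn ℝ ∞ (fun u => G u a b) Ω := fun a b =>
    (hG.smooth.clm_apply contDiffOn_const).clm_apply contDiffOn_const
  have hd : ∀ a, ContDiffOn ℝ ∞ (fun u => fderiv ℝ (diverg G θ) u a) Ω := fun a =>
    (hG.smooth_fderiv (hG.smooth_diverg hθ)).clm_apply contDiffOn_const
  exact (((contDiffOn_const.mul (hG.smooth_nabla₂ (hG.smooth_symNabla hθ) z y x)).sub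
    ((contDiffOn_const.mul (hg y x)).mul (hd z))).sub ((hg z x).mul (hd y))).sub
    ((hg z y).mul (hd x))

/-- Taking traces commutes with covariant differentiation. -/
theorem fderiv_formTrace {h : E → Form E} (hh : ContDiffOn ℝ ∞ h Ω) {u : E} (hu : u ∈ Ω)
    {b : Module.Basis (Fin n) ℝ E}
    (hb : ∀ i j, G u (b i) (b j) = if i = j then 1 else 0) (z : E) :
    fderiv ℝ (fun w => formTrace (G w) (h w)) u z = ∑ i, nabla₂ G h u z (b i) (b i) := by
  -- With h = g(A ·, ·), the metric trace of h is the ordinary trace of A, which commutes with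
  -- differentiation. The connection terms cancel because `gam G u z` composed with A has the same
  -- trace in either order.
  set A : E → E →L[ℝ] E := fun w => (raise (G w)).comp (h w) with hA
  have hAs : ContDiffOn ℝ ∞ A Ω := hG.smooth_raise.clm_comp hh
  have hAd : DifferentiableAt ℝ A u :=
    (hAs.contDiffAt (hG.mem_nhds hu)).differentiableAt (by simp)
  have hhd : DifferentiableAt ℝ h u :=
    (hh.contDiffAt (hG.mem_nhds hu)).differentiableAt (by simp)
  have hGA : ∀ w ∈ Ω, ∀ x y, h w x y = G w (A w x) y := fun w hw x y =>
    (form_raise (hG.pos w hw) _ _).symm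
  have h1 : fderiv ℝ (fun w => formTrace (G w) (h w)) u z = traceCLM E (fderiv ℝ A u z) := by
    change fderiv ℝ (fun w => traceCLM E (A w)) u z = _
    rw [show (fun w => traceCLM E (A w)) = traceCLM E ∘ A from rfl,
      fderiv_comp u (traceCLM E).differentiableAt hAd]
    simp
  have h2 : ∀ x y, fderiv ℝ h u z x y
      = fderiv ℝ G u z (A u x) y + G u (fderiv ℝ A u z x) y := fun x y => by
    rw [← fderiv_apply_const₂ hhd]
    have e : (fun w => h w x y) =ᶠ[𝓝 u] fun w => G w (A w x) y := by
      filter_upwards [hG.mem_nhds hu] with w hw using hGA w hw x y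
    have hAx : DifferentiableAt ℝ (fun w => A w x) u := hAd.clm_apply (differentiableAt_const x)
    rw [e.fderiv_eq, fderiv_apply_const (f := fun w => G w (A w x))
      ((hG.differentiableAt hu).clm_apply hAx), fderiv_clm_apply (hG.differentiableAt hu) hAx]
    simp [fderiv_apply_const hAd, add_comm]
  rw [h1, traceCLM_orthonormal (fderiv ℝ A u z) hb]
  have h3 : ∑ i, G u (gam G u z (A u (b i))) (b i) = ∑ i, G u (A u (gam G u z (b i))) (b i) := by
    have t1 := traceCLM_orthonormal ((gam G u z).comp (A u)) hb
    have t2 := traceCLM_orthonormal ((A u).comp (gam G u z)) hb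
    simp only [ContinuousLinearMap.comp_apply] at t1 t2
    rw [← t1, ← t2]
    exact LinearMap.trace_mul_comm ℝ ((gam G u z : E →L[ℝ] E) : E →ₗ[ℝ] E) (A u : E →ₗ[ℝ] E)
  have h4 : ∀ i, nabla₂ G h u z (b i) (b i) = G u (fderiv ℝ A u z (b i)) (b i)
      + (G u (gam G u z (A u (b i))) (b i) - G u (A u (gam G u z (b i))) (b i)) := fun i => by
    rw [nabla₂, h2, hG.fderiv_metric hu, hGA u hu, hGA u hu]; ring
  simp only [h4, Finset.sum_add_distrib, Finset.sum_sub_distrib, h3, sub_self, add_zero]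

end MetricOn

/-! ### Naturality under changes of coordinates -/

variable {E : Type*} [NormedAddCommGroup E] [NormedSpace ℝ E]

/-- The vector field dual to a 1-form. -/
def sharp (G : E → Form E) (θ : E → E →L[ℝ] ℝ) (u : E) : E := raise (G u) (θ u)

/-- The coefficient of the leading term in `bochnerForm`. -/
def bochnerLead (n : ℕ) : ℝ := ((n : ℝ) + 3) / 4

/-- The coefficient of the divergence term in `bochnerForm`. -/
def bochnerDiv (n : ℕ) : ℝ := ((n : ℝ) - 1) / (2 * ((n : ℝ) + 1))

/-- The 1-form `α ∇_y ξ · ξ - ∇_ξ ξ · y + c (div ξ) ξ · y`, where `ξ` is dual to `θ`. -/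
def bochnerForm [FiniteDimensional ℝ E] (n : ℕ) (G : E → Form E) (θ : E → E →L[ℝ] ℝ) (u : E) :
    E →L[ℝ] ℝ :=
  bochnerLead n • (nabla₁ G θ u).flip (sharp G θ u) - nabla₁ G θ u (sharp G θ u)
    + (bochnerDiv n * diverg G θ u) • θ u

theorem bochnerForm_apply [FiniteDimensional ℝ E] (n : ℕ) (G : E → Form E) (θ : E → E →L[ℝ] ℝ)
    (u y : E) : bochnerForm n G θ u y = bochnerLead n * nabla₁ G θ u y (sharp G θ u)
      - nabla₁ G θ u (sharp G θ u) y + bochnerDiv n * diverg G θ u * θ u y := by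
  simp [bochnerForm]

/-- `φ` is a smooth isometric immersion of `(Ω, G')` into `(Ω', G)`. -/
structure Transition (Ω Ω' : Set E) (φ : E → E) (G' G : E → Form E) : Prop where
  source : MetricOn Ω G'
  target : MetricOn Ω' G
  maps : MapsTo φ Ω Ω'
  smooth : ContDiffOn ℝ ∞ φ Ω
  bij : ∀ u ∈ Ω, Function.Bijective (fderiv ℝ φ u)
  metric : ∀ u ∈ Ω, ∀ x y, G' u x y = G (φ u) (fderiv ℝ φ u x) (fderiv ℝ φ u y)

/-- `θ'` is the pull-back of the 1-form `θ`. -/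
def Pull₁ (Ω : Set E) (φ : E → E) (θ' θ : E → E →L[ℝ] ℝ) : Prop :=
  ∀ u ∈ Ω, ∀ y, θ' u y = θ (φ u) (fderiv ℝ φ u y)

/-- `h'` is the pull-back of the 2-tensor `h`. -/
def Pull₂ (Ω : Set E) (φ : E → E) (h' h : E → Form E) : Prop :=
  ∀ u ∈ Ω, ∀ y x, h' u y x = h (φ u) (fderiv ℝ φ u y) (fderiv ℝ φ u x)

theorem fderiv_comp_apply {F H : Type*} [NormedAddCommGroup F] [NormedSpace ℝ F]
    [NormedAddCommGroup H] [NormedSpace ℝ H] {c : E → F →L[ℝ] H} {φ : E → E} {g : E → F} {u : E}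
    (hc : DifferentiableAt ℝ c (φ u)) (hφ : DifferentiableAt ℝ φ u) (hg : DifferentiableAt ℝ g u)
    (z : E) : fderiv ℝ (fun w => c (φ w) (g w)) u z
      = fderiv ℝ c (φ u) (fderiv ℝ φ u z) (g u) + c (φ u) (fderiv ℝ g u z) := by
  have h1 : DifferentiableAt ℝ (fun w => c (φ w)) u := hc.comp u hφ
  rw [fderiv_clm_apply h1 hg]
  have : fderiv ℝ (fun w => c (φ w)) u = (fderiv ℝ c (φ u)).comp (fderiv ℝ φ u) :=
    fderiv_comp u hc hφ
  simp [this, add_comm]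

namespace Transition

variable [FiniteDimensional ℝ E] [CompleteSpace E] {Ω Ω' : Set E} {φ : E → E} {G' G : E → Form E}
  (T : Transition Ω Ω' φ G' G)
include T

theorem contDiffAt {u : E} (hu : u ∈ Ω) : ContDiffAt ℝ ∞ φ u :=
  T.smooth.contDiffAt (T.source.mem_nhds hu)

theorem differentiableAt {u : E} (hu : u ∈ Ω) : DifferentiableAt ℝ φ u :=
  (T.contDiffAt hu).differentiableAt (by simp)

theorem differentiableAt_fderiv {u : E} (hu : u ∈ Ω) : DifferentiableAt ℝ (fderiv ℝ φ) u :=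
  ((T.source.smooth_fderiv T.smooth).contDiffAt (T.source.mem_nhds hu)).differentiableAt (by simp)

theorem second_symm {u : E} (hu : u ∈ Ω) (x y : E) :
    fderiv ℝ (fderiv ℝ φ) u x y = fderiv ℝ (fderiv ℝ φ) u y x :=
  (T.contDiffAt hu).isSymmSndFDerivAt 
    (by simpa using WithTop.coe_le_coe.2 (le_top : (2 : ℕ∞) ≤ ⊤)) x y

theorem fderiv_pull₁ {θ' θ : E → E →L[ℝ] ℝ} (h : Pull₁ Ω φ θ' θ) (hθ' : ContDiffOn ℝ ∞ θ' Ω)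
    (hθ : ContDiffOn ℝ ∞ θ Ω') {u : E} (hu : u ∈ Ω) (z y : E) :
    fderiv ℝ θ' u z y = fderiv ℝ θ (φ u) (fderiv ℝ φ u z) (fderiv ℝ φ u y)
      + θ (φ u) (fderiv ℝ (fderiv ℝ φ) u z y) := by
  have hd' : DifferentiableAt ℝ θ' u :=
    (hθ'.contDiffAt (T.source.mem_nhds hu)).differentiableAt (by simp)
  have hd : DifferentiableAt ℝ θ (φ u) :=
    (hθ.contDiffAt (T.target.mem_nhds (T.maps hu))).differentiableAt (by simp)
  have e : (fun w => θ' w y) =ᶠ[𝓝 u] fun w => θ (φ w) (fderiv ℝ φ w y) := by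
    filter_upwards [T.source.mem_nhds hu] with w hw using h w hw y
  rw [← fderiv_apply_const hd', e.fderiv_eq, fderiv_comp_apply hd (T.differentiableAt hu)
    ((T.differentiableAt_fderiv hu).clm_apply (differentiableAt_const y)),
    fderiv_apply_const (T.differentiableAt_fderiv hu)]

theorem fderiv_pull₂ {h' h : E → Form E} (hp : Pull₂ Ω φ h' h) (hh' : ContDiffOn ℝ ∞ h' Ω)
    (hh : ContDiffOn ℝ ∞ h Ω') {u : E} (hu : u ∈ Ω) (z y x : E) :
    fderiv ℝ h' u z y x
      = fderiv ℝ h (φ u) (fderiv ℝ φ u z) (fderiv ℝ φ u y) (fderiv ℝ φ u x)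
      + h (φ u) (fderiv ℝ (fderiv ℝ φ) u z y) (fderiv ℝ φ u x)
      + h (φ u) (fderiv ℝ φ u y) (fderiv ℝ (fderiv ℝ φ) u z x) := by
  have hd' : DifferentiableAt ℝ h' u :=
    (hh'.contDiffAt (T.source.mem_nhds hu)).differentiableAt (by simp)
  have hd : DifferentiableAt ℝ h (φ u) :=
    (hh.contDiffAt (T.target.mem_nhds (T.maps hu))).differentiableAt (by simp)
  have hφ := T.differentiableAt hu
  have hφ2 := T.differentiableAt_fderiv hu
  have e : (fun w => h' w y x) =ᶠ[𝓝 u] fun w => h (φ w) (fderiv ℝ φ w y) (fderiv ℝ φ w x) := by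
    filter_upwards [T.source.mem_nhds hu] with w hw using hp w hw y x
  have hy : DifferentiableAt ℝ (fun w => fderiv ℝ φ w y) u :=
    hφ2.clm_apply (differentiableAt_const y)
  have hx : DifferentiableAt ℝ (fun w => fderiv ℝ φ w x) u :=
    hφ2.clm_apply (differentiableAt_const x)
  have hhφ : DifferentiableAt ℝ (fun w => h (φ w)) u := hd.comp u hφ
  have h1 : DifferentiableAt ℝ (fun w => h (φ w) (fderiv ℝ φ w y)) u := hhφ.clm_apply hy
  rw [← fderiv_apply_const₂ hd', e.fderiv_eq, fderiv_clm_apply h1 hx]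
  simp only [add_apply, ContinuousLinearMap.comp_apply, ContinuousLinearMap.flip_apply]
  rw [fderiv_comp_apply hd hφ hy, fderiv_apply_const hφ2, fderiv_apply_const hφ2]
  simp only [add_apply]
  ring

/-- The transformation law of the Christoffel symbols. In the Koszul formula for the pulled back
metric the second derivatives of φ appear six times, and by their symmetry only one pair survives.
The inhomogeneous term is what cancels against the derivative of a pulled back tensor, so that
covariant derivatives become natural. -/
theorem fderiv_gam {u : E} (hu : u ∈ Ω) (x y : E) : fderiv ℝ φ u (gam G' u x y)
    = fderiv ℝ (fderiv ℝ φ) u x y + gam G (φ u) (fderiv ℝ φ u x) (fderiv ℝ φ u y) := by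
  refine T.target.eq_of_forall (T.maps hu) fun z' => ?_
  obtain ⟨z, rfl⟩ := (T.bij u hu).2 z'
  have hD := T.fderiv_pull₂ T.metric T.source.smooth T.target.smooth hu
  rw [← T.metric u hu, T.source.koszul hu, map_add, add_apply, T.target.koszul (T.maps hu),
    hD, hD, hD, T.second_symm hu z x, T.second_symm hu z y, T.second_symm hu y x,
    T.target.symm (T.maps hu) (fderiv ℝ φ u x), T.target.symm (T.maps hu) (fderiv ℝ φ u y)]
  ring

theorem pull_nabla₁ {θ' θ : E → E →L[ℝ] ℝ} (h : Pull₁ Ω φ θ' θ) (hθ' : ContDiffOn ℝ ∞ θ' Ω)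
    (hθ : ContDiffOn ℝ ∞ θ Ω') : Pull₂ Ω φ (nabla₁ G' θ') (nabla₁ G θ) := by
  intro u hu z y
  rw [nabla₁_apply, nabla₁_apply, T.fderiv_pull₁ h hθ' hθ hu, h u hu, T.fderiv_gam hu, map_add]
  ring

theorem pull_symNabla {θ' θ : E → E →L[ℝ] ℝ} (h : Pull₁ Ω φ θ' θ) (hθ' : ContDiffOn ℝ ∞ θ' Ω)
    (hθ : ContDiffOn ℝ ∞ θ Ω') : Pull₂ Ω φ (symNabla G' θ') (symNabla G θ) := by
  intro u hu z y
  have hp := T.pull_nabla₁ h hθ' hθ u hu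
  rw [symNabla_apply, symNabla_apply, hp, hp]

theorem pull_nabla₂ {h' h : E → Form E} (hp : Pull₂ Ω φ h' h) (hh' : ContDiffOn ℝ ∞ h' Ω)
    (hh : ContDiffOn ℝ ∞ h Ω') {u : E} (hu : u ∈ Ω) (z y x : E) : nabla₂ G' h' u z y x
      = nabla₂ G h (φ u) (fderiv ℝ φ u z) (fderiv ℝ φ u y) (fderiv ℝ φ u x) := by
  rw [nabla₂, nabla₂, T.fderiv_pull₂ hp hh' hh hu, hp u hu, hp u hu, T.fderiv_gam hu,
    T.fderiv_gam hu]
  simp only [map_add, add_apply]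
  ring

/-- The derivative of φ is an isometry, so it carries orthonormal bases to orthonormal bases, in
which traces are diagonal sums. -/
theorem formTrace_eq {h' h : E → Form E} (hp : Pull₂ Ω φ h' h) {u : E} (hu : u ∈ Ω) :
    formTrace (G' u) (h' u) = formTrace (G (φ u)) (h (φ u)) := by
  obtain ⟨b, hb⟩ := (T.source.pos u hu).exists_orthonormal (Module.finBasis ℝ E)
  let e : E ≃ₗ[ℝ] E := LinearEquiv.ofBijective (fderiv ℝ φ u : E →ₗ[ℝ] E) (T.bij u hu)
  have hb' : ∀ i j, G (φ u) (b.map e i) (b.map e j) = if i = j then 1 else 0 := fun i j => by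
    rw [← hb i j]
    exact (T.metric u hu (b i) (b j)).symm
  rw [formTrace_orthonormal (T.source.pos u hu) _ hb,
    formTrace_orthonormal (T.target.pos _ (T.maps hu)) _ hb']
  exact Finset.sum_congr rfl fun i _ => hp u hu _ _

theorem diverg_eq {θ' θ : E → E →L[ℝ] ℝ} (h : Pull₁ Ω φ θ' θ) (hθ' : ContDiffOn ℝ ∞ θ' Ω)
    (hθ : ContDiffOn ℝ ∞ θ Ω') {u : E} (hu : u ∈ Ω) : diverg G' θ' u = diverg G θ (φ u) :=
  T.formTrace_eq (T.pull_nabla₁ h hθ' hθ) hu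

/-- Naturality of the Eisenhart operator; it makes the choice of the preferred chart in `eisenhart`
harmless. -/
theorem eisLocal_eq (n : ℕ) {θ' θ : E → E →L[ℝ] ℝ} (h : Pull₁ Ω φ θ' θ)
    (hθ' : ContDiffOn ℝ ∞ θ' Ω) (hθ : ContDiffOn ℝ ∞ θ Ω') {u : E} (hu : u ∈ Ω) (z y x : E) :
    eisLocal n G' θ' u z y x
      = eisLocal n G θ (φ u) (fderiv ℝ φ u z) (fderiv ℝ φ u y) (fderiv ℝ φ u x) := by
  have hd : ∀ a, fderiv ℝ (diverg G' θ') u a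
      = fderiv ℝ (diverg G θ) (φ u) (fderiv ℝ φ u a) := fun a => by
    have e : diverg G' θ' =ᶠ[𝓝 u] diverg G θ ∘ φ := by
      filter_upwards [T.source.mem_nhds hu] with w hw using T.diverg_eq h hθ' hθ hw
    rw [e.fderiv_eq, fderiv_comp u (((T.target.smooth_diverg hθ).contDiffAt
      (T.target.mem_nhds (T.maps hu))).differentiableAt (by simp)) (T.differentiableAt hu)]
    rfl
  rw [eisLocal, eisLocal, T.pull_nabla₂ (T.pull_symNabla h hθ' hθ) (T.source.smooth_symNabla hθ')
    (T.target.smooth_symNabla hθ) hu, hd, hd, hd, T.metric u hu, T.metric u hu, T.metric u hu]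

theorem fderiv_sharp {θ' θ : E → E →L[ℝ] ℝ} (h : Pull₁ Ω φ θ' θ) {u : E} (hu : u ∈ Ω) :
    fderiv ℝ φ u (sharp G' θ' u) = sharp G θ (φ u) := by
  refine T.target.eq_of_forall (T.maps hu) fun z' => ?_
  obtain ⟨z, rfl⟩ := (T.bij u hu).2 z'
  rw [← T.metric u hu, sharp, sharp, form_raise (T.source.pos u hu),
    form_raise (T.target.pos _ (T.maps hu)), h u hu]

theorem pull_bochnerForm (n : ℕ) {θ' θ : E → E →L[ℝ] ℝ} (h : Pull₁ Ω φ θ' θ)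
    (hθ' : ContDiffOn ℝ ∞ θ' Ω) (hθ : ContDiffOn ℝ ∞ θ Ω') :
    Pull₁ Ω φ (bochnerForm n G' θ') (bochnerForm n G θ) := by
  intro u hu y
  have hp := T.pull_nabla₁ h hθ' hθ u hu
  rw [bochnerForm_apply, bochnerForm_apply, hp, hp, T.fderiv_sharp h hu, T.diverg_eq h hθ' hθ hu,
    h u hu]

/-- The covariant acceleration of a curve is a vector. -/
theorem acceleration_eq {c : ℝ → E} {t : ℝ} (hc : ∀ᶠ s in 𝓝 t, DifferentiableAt ℝ c s)
    (hc2 : DifferentiableAt ℝ (deriv c) t) (hu : c t ∈ Ω) :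
    deriv (deriv fun s => φ (c s)) t
      + gam G (φ (c t)) (deriv (fun s => φ (c s)) t) (deriv (fun s => φ (c s)) t)
    = fderiv ℝ φ (c t) (deriv (deriv c) t + gam G' (c t) (deriv c t) (deriv c t)) := by
  have hct : DifferentiableAt ℝ c t := hc.self_of_nhds
  have hd : ∀ s, DifferentiableAt ℝ c s → c s ∈ Ω →
      deriv (fun s => φ (c s)) s = fderiv ℝ φ (c s) (deriv c s) := fun s h1 h2 =>
    ((T.differentiableAt h2).hasFDerivAt.comp_hasDerivAt s h1.hasDerivAt).deriv
  have e : (deriv fun s => φ (c s)) =ᶠ[𝓝 t] fun s => fderiv ℝ φ (c s) (deriv c s) := by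
    filter_upwards [hc, hct.continuousAt.preimage_mem_nhds (T.source.mem_nhds hu)] with s h1 h2
      using hd s h1 h2
  have h3 : HasDerivAt (fun s => fderiv ℝ φ (c s) (deriv c s))
      (fderiv ℝ (fderiv ℝ φ) (c t) (deriv c t) (deriv c t)
        + fderiv ℝ φ (c t) (deriv (deriv c) t)) t := by
    have h4 : HasDerivAt (fun s => fderiv ℝ φ (c s)) (fderiv ℝ (fderiv ℝ φ) (c t) (deriv c t)) t :=
      (T.differentiableAt_fderiv hu).hasFDerivAt.comp_hasDerivAt t hct.hasDerivAt
    exact h4.clm_apply hc2.hasDerivAt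
  rw [e.deriv_eq, h3.deriv, hd t hct hu, map_add, T.fderiv_gam hu]
  abel

end Transition

variable {E : Type*} [NormedAddCommGroup E] [NormedSpace ℝ E]

/-! ### The Eisenhart operator in coordinates -/

theorem fin_three_ne : (0 : Fin 3) ≠ 1 ∧ (0 : Fin 3) ≠ 2 ∧ (1 : Fin 3) ≠ 2 ∧ (1 : Fin 3) ≠ 0 ∧
    (2 : Fin 3) ≠ 0 ∧ (2 : Fin 3) ≠ 1 := by decide

theorem fin_three_cases (i : Fin 3) : i = 0 ∨ i = 1 ∨ i = 2 := by omega

/-- The Eisenhart operator at a point, as a trilinear form. -/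
def eisMultilinear [FiniteDimensional ℝ E] (n : ℕ) (G : E → Form E) (θ : E → E →L[ℝ] ℝ) (u : E) :
    MultilinearMap ℝ (fun _ : Fin 3 => E) ℝ where
  toFun v := eisLocal n G θ u (v 0) (v 1) (v 2)
  map_update_add' v i x y := by
    obtain rfl | rfl | rfl := fin_three_cases i
    · simp only [Function.update_self, Function.update_of_ne fin_three_ne.2.2.2.1,
        Function.update_of_ne fin_three_ne.2.2.2.2.1, eisLocal, nabla₂, map_add, add_apply]
      ring
    · simp only [Function.update_self, Function.update_of_ne fin_three_ne.1,
        Function.update_of_ne fin_three_ne.2.2.2.2.2, eisLocal, nabla₂, map_add, add_apply]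
      ring
    · simp only [Function.update_self, Function.update_of_ne fin_three_ne.2.1,
        Function.update_of_ne fin_three_ne.2.2.1, eisLocal, nabla₂, map_add]
      ring
  map_update_smul' v i c x := by
    obtain rfl | rfl | rfl := fin_three_cases i
    · simp only [Function.update_self, Function.update_of_ne fin_three_ne.2.2.2.1,
        Function.update_of_ne fin_three_ne.2.2.2.2.1, eisLocal, nabla₂, map_smul, smul_apply, smul_eq_mul]
      ring
    · simp only [Function.update_self, Function.update_of_ne fin_three_ne.1,
        Function.update_of_ne fin_three_ne.2.2.2.2.2, eisLocal, nabla₂, map_smul, smul_apply, smul_eq_mul]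
      ring
    · simp only [Function.update_self, Function.update_of_ne fin_three_ne.2.1,
        Function.update_of_ne fin_three_ne.2.2.1, eisLocal, nabla₂, map_smul, smul_eq_mul]
      ring

namespace MetricOn

variable [FiniteDimensional ℝ E] [CompleteSpace E] {Ω : Set E} {G : E → Form E} (hG : MetricOn Ω G)
  {θ : E → E →L[ℝ] ℝ}
include hG

theorem nabla₂_symNabla_symm (hθ : ContDiffOn ℝ ∞ θ Ω) {u : E} (hu : u ∈ Ω) (z y x : E) :
    nabla₂ G (symNabla G θ) u z y x = nabla₂ G (symNabla G θ) u z x y := by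
  have hs : ∀ w, ∀ a b, symNabla G θ w a b = symNabla G θ w b a := fun w a b => by
    rw [symNabla_apply, symNabla_apply]; ring
  have hd : DifferentiableAt ℝ (symNabla G θ) u :=
    ((hG.smooth_symNabla hθ).contDiffAt (hG.mem_nhds hu)).differentiableAt (by simp)
  have h1 : fderiv ℝ (symNabla G θ) u z y x = fderiv ℝ (symNabla G θ) u z x y := by
    rw [← fderiv_apply_const₂ hd, ← fderiv_apply_const₂ hd]
    simp only [hs _ y x]
  rw [nabla₂, nabla₂, h1, hs u (gam G u z y) x, hs u y (gam G u z x)]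
  ring

theorem eisLocal_symm (n : ℕ) (hθ : ContDiffOn ℝ ∞ θ Ω) {u : E} (hu : u ∈ Ω) (z y x : E) :
    eisLocal n G θ u z y x = eisLocal n G θ u z x y := by
  rw [eisLocal, eisLocal, hG.nabla₂_symNabla_symm hθ hu, hG.symm hu y x]
  ring

theorem diverg_eq_formTrace_symNabla {u : E} (hu : u ∈ Ω) :
    diverg G θ u = formTrace (G u) (symNabla G θ u) := by
  obtain ⟨b, hb⟩ := (hG.pos u hu).exists_orthonormal (Module.finBasis ℝ E)
  rw [diverg, formTrace_orthonormal (hG.pos u hu) _ hb, formTrace_orthonormal (hG.pos u hu) _ hb]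
  exact Finset.sum_congr rfl fun i _ => by rw [symNabla_apply]; ring

variable {n : ℕ} {u : E} {b : Module.Basis (Fin n) ℝ E}

/-- The skew part of ∇θ has no trace, so the divergence is the trace of δ^*θ, and taking traces
commutes with covariant differentiation. -/
theorem fderiv_diverg (hθ : ContDiffOn ℝ ∞ θ Ω) (hu : u ∈ Ω)
    (hb : ∀ i j, G u (b i) (b j) = if i = j then 1 else 0) (z : E) :
    fderiv ℝ (diverg G θ) u z = ∑ i, nabla₂ G (symNabla G θ) u z (b i) (b i) := by
  rw [← hG.fderiv_formTrace (hG.smooth_symNabla hθ) hu hb]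
  congr 1
  refine Filter.EventuallyEq.fderiv_eq ?_
  filter_upwards [hG.mem_nhds hu] with w hw using hG.diverg_eq_formTrace_symNabla hw

omit hG in
theorem sum_mul_apply (hb : ∀ i j, G u (b i) (b j) = if i = j then 1 else 0)
    (l : E →L[ℝ] ℝ) (z : E) : ∑ i, G u z (b i) * l (b i) = l z := by
  have h := orthonormal_expand (B := (G u).toLinearMap₁₂) hb z
  conv_rhs => rw [h]
  simp

/-- The four terms contribute 2(n+1), -2n, -1 and -1 times the differential of the divergence. -/
theorem trace_eisLocal (hθ : ContDiffOn ℝ ∞ θ Ω) (hu : u ∈ Ω)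
    (hb : ∀ i j, G u (b i) (b j) = if i = j then 1 else 0) (z : E) :
    ∑ i, eisLocal n G θ u z (b i) (b i) = 0 := by
  simp only [eisLocal, Finset.sum_sub_distrib, ← Finset.mul_sum]
  rw [← hG.fderiv_diverg hθ hu hb, sum_mul_apply hb, ← Finset.sum_mul, ← Finset.mul_sum]
  simp only [hb]
  simp
  ring

/-! ### The Bochner formula -/

theorem smooth_sharp (hθ : ContDiffOn ℝ ∞ θ Ω) : ContDiffOn ℝ ∞ (sharp G θ) Ω :=
  hG.smooth_raise.clm_apply hθ

theorem smooth_bochnerForm (hθ : ContDiffOn ℝ ∞ θ Ω) :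
    ContDiffOn ℝ ∞ (bochnerForm n G θ) Ω := by
  refine contDiffOn_clm_apply.2 fun y => ?_
  simp only [bochnerForm_apply]
  have h1 := hG.smooth_nabla₁ hθ
  have h2 := hG.smooth_sharp hθ
  exact ((contDiffOn_const.mul ((h1.clm_apply contDiffOn_const).clm_apply h2)).sub
    ((h1.clm_apply h2).clm_apply contDiffOn_const)).add
    ((contDiffOn_const.mul (hG.smooth_diverg hθ)).mul (hθ.clm_apply contDiffOn_const))

theorem metric_sharp (hu : u ∈ Ω) (y : E) : G u (sharp G θ u) y = θ u y :=
  form_raise (hG.pos u hu) _ _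

/-- `(∇_z θ)(y)` is the inner product of `∇_z ξ` with `y`, if `θ` is dual to `ξ`. -/
theorem nabla₁_eq {X : E → E} (hX : ContDiffOn ℝ ∞ X Ω) (hθ : ContDiffOn ℝ ∞ θ Ω)
    (h : ∀ w ∈ Ω, ∀ y, θ w y = G w (X w) y) (hu : u ∈ Ω) (z y : E) :
    nabla₁ G θ u z y = G u (fderiv ℝ X u z + gam G u z (X u)) y := by
  have hd : DifferentiableAt ℝ θ u :=
    (hθ.contDiffAt (hG.mem_nhds hu)).differentiableAt (by simp)
  have hXd : DifferentiableAt ℝ X u :=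
    (hX.contDiffAt (hG.mem_nhds hu)).differentiableAt (by simp)
  have e : θ =ᶠ[𝓝 u] fun w => G w (X w) := by
    filter_upwards [hG.mem_nhds hu] with w hw
    ext y; exact h w hw y
  rw [nabla₁_apply, e.fderiv_eq, fderiv_clm_apply (hG.differentiableAt hu) hXd, h u hu]
  simp only [add_apply, ContinuousLinearMap.comp_apply, ContinuousLinearMap.flip_apply, map_add]
  rw [hG.fderiv_metric hu]
  ring

theorem nabla₁_eq_sharp (hθ : ContDiffOn ℝ ∞ θ Ω) (hu : u ∈ Ω) (z y : E) : nabla₁ G θ u z y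
    = G u (fderiv ℝ (sharp G θ) u z + gam G u z (sharp G θ u)) y :=
  hG.nabla₁_eq (hG.smooth_sharp hθ) hθ (fun _ hw y => (hG.metric_sharp hw y).symm) hu z y

/-- Second derivatives of θ cancel by symmetry, and the terms with ∇θ in the direction `gam G u z y`
cancel because the connection is torsion-free. What remains of the connection and its derivative is
the curvature. -/
theorem ricci_identity (hθ : ContDiffOn ℝ ∞ θ Ω) (hu : u ∈ Ω) (z y x : E) :
    nabla₂ G (nabla₁ G θ) u z y x - nabla₂ G (nabla₁ G θ) u y z x = - θ u (curv G u z y x) := by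
  have hd : DifferentiableAt ℝ θ u :=
    (hθ.contDiffAt (hG.mem_nhds hu)).differentiableAt (by simp)
  have hd2 : DifferentiableAt ℝ (fderiv ℝ θ) u :=
    ((hG.smooth_fderiv hθ).contDiffAt (hG.mem_nhds hu)).differentiableAt (by simp)
  have hg : DifferentiableAt ℝ (gam G) u :=
    (hG.smooth_gam.contDiffAt (hG.mem_nhds hu)).differentiableAt (by simp)
  have hn : DifferentiableAt ℝ (nabla₁ G θ) u :=
    ((hG.smooth_nabla₁ hθ).contDiffAt (hG.mem_nhds hu)).differentiableAt (by simp)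
  have hsymm : fderiv ℝ (fderiv ℝ θ) u z y = fderiv ℝ (fderiv ℝ θ) u y z :=
    (hθ.contDiffAt (hG.mem_nhds hu)).isSymmSndFDerivAt
      (by simpa using WithTop.coe_le_coe.2 (le_top : (2 : ℕ∞) ≤ ⊤)) z y
  have key : ∀ a c, fderiv ℝ (nabla₁ G θ) u a c x = fderiv ℝ (fderiv ℝ θ) u a c x
      - (fderiv ℝ θ u a (gam G u c x) + θ u (fderiv ℝ (gam G) u a c x)) := fun a c => by
    rw [← fderiv_apply_const₂ hn]
    simp only [nabla₁_apply]
    have h1 : DifferentiableAt ℝ (fun w => fderiv ℝ θ w c x) u :=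
      (hd2.clm_apply (differentiableAt_const c)).clm_apply (differentiableAt_const x)
    have h2 : DifferentiableAt ℝ (fun w => gam G w c x) u :=
      (hg.clm_apply (differentiableAt_const c)).clm_apply (differentiableAt_const x)
    rw [fderiv_fun_sub h1 (hd.clm_apply h2), sub_apply, fderiv_apply_const₂ hd2,
      fderiv_clm_apply hd h2]
    simp only [add_apply, ContinuousLinearMap.comp_apply, ContinuousLinearMap.flip_apply]
    rw [fderiv_apply_const₂ hg]
    ring
  rw [nabla₂, nabla₂, key, key, hsymm, curv, hG.gam_symm hu y z]
  simp only [map_sub, map_add, nabla₁_apply]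
  ring

theorem nabla₂_nabla₁_add (hθ : ContDiffOn ℝ ∞ θ Ω) (hu : u ∈ Ω) (z y x : E) :
    nabla₂ G (nabla₁ G θ) u z y x + nabla₂ G (nabla₁ G θ) u z x y
      = 2 * nabla₂ G (symNabla G θ) u z y x := by
  have hn : DifferentiableAt ℝ (nabla₁ G θ) u :=
    ((hG.smooth_nabla₁ hθ).contDiffAt (hG.mem_nhds hu)).differentiableAt (by simp)
  have hs : DifferentiableAt ℝ (symNabla G θ) u :=
    ((hG.smooth_symNabla hθ).contDiffAt (hG.mem_nhds hu)).differentiableAt (by simp)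
  have h1 : fderiv ℝ (symNabla G θ) u z y x
      = (1 / 2) * (fderiv ℝ (nabla₁ G θ) u z y x + fderiv ℝ (nabla₁ G θ) u z x y) := by
    have hyx : ∀ y x, DifferentiableAt ℝ (fun w => nabla₁ G θ w y x) u := fun y x =>
      (hn.clm_apply (differentiableAt_const y)).clm_apply (differentiableAt_const x)
    rw [← fderiv_apply_const₂ hs]
    simp only [symNabla_apply]
    have e : fderiv ℝ (fun w => (1 / 2 : ℝ) * (nabla₁ G θ w y x + nabla₁ G θ w x y)) u = _ :=
      (((hyx y x).hasFDerivAt.add (hyx x y).hasFDerivAt).const_mul (1 / 2 : ℝ)).fderiv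
    rw [e, smul_apply, add_apply, fderiv_apply_const₂ hn, fderiv_apply_const₂ hn, smul_eq_mul]
  rw [nabla₂, nabla₂, nabla₂, h1, symNabla_apply, symNabla_apply]
  ring

/-- The Leibniz rule: the derivative of `sharp G θ` and the connection terms combine to the
covariant derivative of ξ. -/
theorem nabla₁_bochnerForm (hθ : ContDiffOn ℝ ∞ θ Ω) (hu : u ∈ Ω) (z y : E) :
    nabla₁ G (bochnerForm n G θ) u z y
      = bochnerLead n * (nabla₂ G (nabla₁ G θ) u z y (sharp G θ u)
          + nabla₁ G θ u y (fderiv ℝ (sharp G θ) u z + gam G u z (sharp G θ u)))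
        - (nabla₂ G (nabla₁ G θ) u z (sharp G θ u) y
          + nabla₁ G θ u (fderiv ℝ (sharp G θ) u z + gam G u z (sharp G θ u)) y)
        + bochnerDiv n * (fderiv ℝ (diverg G θ) u z * θ u y
          + diverg G θ u * nabla₁ G θ u z y) := by
  have hd : DifferentiableAt ℝ θ u :=
    (hθ.contDiffAt (hG.mem_nhds hu)).differentiableAt (by simp)
  have hn : DifferentiableAt ℝ (nabla₁ G θ) u :=
    ((hG.smooth_nabla₁ hθ).contDiffAt (hG.mem_nhds hu)).differentiableAt (by simp)
  have hs : DifferentiableAt ℝ (sharp G θ) u :=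
    ((hG.smooth_sharp hθ).contDiffAt (hG.mem_nhds hu)).differentiableAt (by simp)
  have hv : DifferentiableAt ℝ (diverg G θ) u :=
    ((hG.smooth_diverg hθ).contDiffAt (hG.mem_nhds hu)).differentiableAt (by simp)
  have hW : DifferentiableAt ℝ (bochnerForm n G θ) u :=
    ((hG.smooth_bochnerForm hθ).contDiffAt (hG.mem_nhds hu)).differentiableAt (by simp)
  have hny : DifferentiableAt ℝ (fun w => nabla₁ G θ w y) u :=
    hn.clm_apply (differentiableAt_const y)
  have d1 : DifferentiableAt ℝ (fun w => nabla₁ G θ w y (sharp G θ w)) u := hny.clm_apply hs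
  have hns : DifferentiableAt ℝ (fun w => nabla₁ G θ w (sharp G θ w)) u := hn.clm_apply hs
  have d2 : DifferentiableAt ℝ (fun w => nabla₁ G θ w (sharp G θ w) y) u :=
    hns.clm_apply (differentiableAt_const y)
  have hθy : DifferentiableAt ℝ (fun w => θ w y) u := hd.clm_apply (differentiableAt_const y)
  have d3 : DifferentiableAt ℝ (fun w => bochnerDiv n * diverg G θ w * θ w y) u :=
    (hv.const_mul _).mul hθy
  have key : fderiv ℝ (bochnerForm n G θ) u z y
      = bochnerLead n * (fderiv ℝ (nabla₁ G θ) u z y (sharp G θ u)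
          + nabla₁ G θ u y (fderiv ℝ (sharp G θ) u z))
        - (fderiv ℝ (nabla₁ G θ) u z (sharp G θ u) y
          + nabla₁ G θ u (fderiv ℝ (sharp G θ) u z) y)
        + bochnerDiv n * (fderiv ℝ (diverg G θ) u z * θ u y
          + diverg G θ u * fderiv ℝ θ u z y) := by
    rw [← fderiv_apply_const hW]
    simp only [bochnerForm_apply]
    have e : fderiv ℝ (fun w => bochnerLead n * nabla₁ G θ w y (sharp G θ w)
        - nabla₁ G θ w (sharp G θ w) y + bochnerDiv n * diverg G θ w * θ w y) u = _ :=
      (((d1.hasFDerivAt.const_mul (bochnerLead n)).sub d2.hasFDerivAt).add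
        ((hv.hasFDerivAt.const_mul (bochnerDiv n)).mul hθy.hasFDerivAt)).fderiv
    have e2 : fderiv ℝ (fun w => nabla₁ G θ w (sharp G θ w) y) u z
        = fderiv ℝ (nabla₁ G θ) u z (sharp G θ u) y
          + nabla₁ G θ u (fderiv ℝ (sharp G θ) u z) y := by
      rw [fderiv_apply_const hns, fderiv_clm_apply hn hs]
      simp only [add_apply, ContinuousLinearMap.comp_apply, ContinuousLinearMap.flip_apply]
      ring
    rw [e]
    simp only [add_apply, sub_apply, smul_apply, smul_eq_mul]
    rw [e2, fderiv_clm_apply hny hs, fderiv_apply_const hd]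
    simp only [add_apply, ContinuousLinearMap.comp_apply, ContinuousLinearMap.flip_apply]
    rw [fderiv_apply_const hn]
    ring
  rw [nabla₁_apply, key, bochnerForm_apply, nabla₂, nabla₂, nabla₁_apply G θ u z y]
  simp only [map_add, add_apply]
  ring

/-- The Bochner formula for solutions of the Eisenhart equation. -/
theorem diverg_bochnerForm (hθ : ContDiffOn ℝ ∞ θ Ω) (hu : u ∈ Ω)
    (hb : ∀ i j, G u (b i) (b j) = if i = j then 1 else 0)
    (h0 : ∀ z y x, eisLocal n G θ u z y x = 0) :
    diverg G (bochnerForm n G θ) u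
      = bochnerLead n * (∑ i, ∑ j, nabla₁ G θ u (b i) (b j) ^ 2)
        - ∑ i, ∑ j, nabla₁ G θ u (b i) (b j) * nabla₁ G θ u (b j) (b i)
        + bochnerDiv n * diverg G θ u ^ 2
        - (bochnerLead n + 1)
          * ∑ i, G u (curv G u (sharp G θ u) (b i) (b i)) (sharp G θ u) := by
  set ξ := sharp G θ u with hξ
  set D : E →L[ℝ] E := fderiv ℝ (sharp G θ) u + (gam G u).flip ξ with hD
  have hDz : ∀ z, fderiv ℝ (sharp G θ) u z + gam G u z ξ = D z := fun z => by simp [hD]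
  have hDb : ∀ i, D (b i) = ∑ j, nabla₁ G θ u (b i) (b j) • b j := fun i => by
    rw [orthonormal_expand (B := (G u).toLinearMap₁₂) hb (D (b i))]
    refine Finset.sum_congr rfl fun j _ => ?_
    rw [hG.nabla₁_eq_sharp hθ hu, hDz]; rfl
  have hn1 : ((n : ℝ) + 1) ≠ 0 := by positivity
  -- Dividing the differential of the divergence by n + 1 turns E θ = 0 into an equation for the
  -- symmetrised ∇²θ with coefficients 2, 1, 1.
  set ψ : E →L[ℝ] ℝ := ((n : ℝ) + 1)⁻¹ • fderiv ℝ (diverg G θ) u with hψ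
  have hψ' : ∀ z, fderiv ℝ (diverg G θ) u z = ((n : ℝ) + 1) * ψ z := fun z => by
    simp [hψ]; field_simp
  have hP : ∀ z y x, nabla₂ G (nabla₁ G θ) u z y x + nabla₂ G (nabla₁ G θ) u z x y
      = 2 * G u y x * ψ z + G u z x * ψ y + G u z y * ψ x := fun z y x => by
    rw [hG.nabla₂_nabla₁_add hθ hu]
    have h := h0 z y x
    rw [eisLocal, hψ', hψ', hψ'] at h
    have h' : ((n : ℝ) + 1) * (2 * nabla₂ G (symNabla G θ) u z y x)
        = ((n : ℝ) + 1) * (2 * G u y x * ψ z + G u z x * ψ y + G u z y * ψ x) := by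
      linear_combination h
    exact mul_left_cancel₀ hn1 h'
  have hR : ∀ z y x, nabla₂ G (nabla₁ G θ) u z y x = nabla₂ G (nabla₁ G θ) u y z x
      - G u (curv G u z y x) ξ := fun z y x => by
    have h := hG.ricci_identity hθ hu z y x
    rw [← hG.metric_sharp hu, hG.symm hu] at h
    linarith
  have hcurv : ∀ z y x, curv G u z y x = - curv G u y z x := fun z y x => by
    simp only [curv]; abel
  set ρ : ℝ := ∑ i, G u (curv G u ξ (b i) (b i)) ξ with hρ
  have hψξ : ∑ i, G u ξ (b i) * ψ (b i) = ψ ξ := sum_mul_apply hb ψ ξ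
  have hψξ' : ∑ i, G u (b i) ξ * ψ (b i) = ψ ξ := by
    rw [← hψξ]; exact Finset.sum_congr rfl fun i _ => by rw [hG.symm hu]
  -- The Ricci identity moves ξ into the first slot, at the price of the curvature term ρ = Ric(ξ,
  -- ξ). The last two slots then coincide, and the Eisenhart equation determines the term outright.
  have s2 : ∑ i, nabla₂ G (nabla₁ G θ) u (b i) ξ (b i) = ((n : ℝ) + 1) * ψ ξ + ρ := by
    have h1 : ∀ i, nabla₂ G (nabla₁ G θ) u (b i) ξ (b i)
        = (G u (b i) (b i) * ψ ξ + G u ξ (b i) * ψ (b i))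
          + G u (curv G u ξ (b i) (b i)) ξ := fun i => by
      rw [hR, hcurv]
      have := hP ξ (b i) (b i)
      simp only [map_neg, neg_apply]
      linarith
    simp only [h1, Finset.sum_add_distrib, hψξ, ← Finset.sum_mul, ← hρ]
    simp only [hb]
    simp
    ring
  -- The Eisenhart equation exchanges the last two slots, which reduces this trace to the previous
  -- one.
  have s1 : ∑ i, nabla₂ G (nabla₁ G θ) u (b i) (b i) ξ = 2 * ψ ξ - ρ := by
    have h1 : ∀ i, nabla₂ G (nabla₁ G θ) u (b i) (b i) ξ
        = (3 * (G u (b i) ξ * ψ (b i)) + G u (b i) (b i) * ψ ξ)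
          - nabla₂ G (nabla₁ G θ) u (b i) ξ (b i) := fun i => by
      have := hP (b i) (b i) ξ
      linarith
    simp only [h1, Finset.sum_sub_distrib, Finset.sum_add_distrib, s2, ← Finset.mul_sum, hψξ',
      ← Finset.sum_mul]
    simp only [hb]
    simp
    ring
  have s3 : ∑ i, nabla₁ G θ u (b i) (D (b i)) = ∑ i, ∑ j, nabla₁ G θ u (b i) (b j) ^ 2 := by
    refine Finset.sum_congr rfl fun i _ => ?_
    rw [hDb, map_sum]
    exact Finset.sum_congr rfl fun j _ => by rw [map_smul, smul_eq_mul, sq]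
  have s4 : ∑ i, nabla₁ G θ u (D (b i)) (b i)
      = ∑ i, ∑ j, nabla₁ G θ u (b i) (b j) * nabla₁ G θ u (b j) (b i) := by
    refine Finset.sum_congr rfl fun i _ => ?_
    rw [hDb, map_sum, sum_apply]
    exact Finset.sum_congr rfl fun j _ => by rw [map_smul, smul_apply, smul_eq_mul]
  have s5 : ∑ i, fderiv ℝ (diverg G θ) u (b i) * θ u (b i) = ((n : ℝ) + 1) * ψ ξ := by
    rw [← hψξ, Finset.mul_sum]
    refine Finset.sum_congr rfl fun i _ => ?_
    rw [hψ', ← hG.metric_sharp hu]; ring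
  have s6 : ∑ i, nabla₁ G θ u (b i) (b i) = diverg G θ u :=
    (formTrace_orthonormal (hG.pos u hu) _ hb).symm
  rw [diverg, formTrace_orthonormal (hG.pos u hu) _ hb]
  simp only [hG.nabla₁_bochnerForm hθ hu, ← hξ, hDz, Finset.sum_add_distrib, Finset.sum_sub_distrib,
    ← Finset.mul_sum, s1, s2, s3, s4, s5, s6]
  -- The total coefficient of ψ ξ in the divergence is 2α - (n+1) + c(n+1); `bochnerDiv` is chosen
  -- to make it vanish.
  have hc : bochnerDiv n * ((n : ℝ) + 1) = (n : ℝ) + 1 - 2 * bochnerLead n := by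
    rw [bochnerDiv, bochnerLead]; field_simp; ring
  linear_combination ψ ξ * hc

end MetricOn

variable {E : Type*} [NormedAddCommGroup E] [NormedSpace ℝ E]

/-! ### The Lie derivative of the connection -/

/-- The Lie derivative of the connection along the vector field `X`. -/
def lieGam (G : E → Form E) (X : E → E) (u : E) : E →L[ℝ] E →L[ℝ] E :=
  fderiv ℝ (fderiv ℝ X) u - (ContinuousLinearMap.compL ℝ E E E (fderiv ℝ X u)).comp (gam G u)
    + fderiv ℝ (gam G) u (X u) + (gam G u).comp (fderiv ℝ X u)
    + ((ContinuousLinearMap.compL ℝ E E E).flip (fderiv ℝ X u)).comp (gam G u)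

theorem lieGam_apply (G : E → Form E) (X : E → E) (u x y : E) : lieGam G X u x y
    = fderiv ℝ (fderiv ℝ X) u x y - fderiv ℝ X u (gam G u x y) + fderiv ℝ (gam G) u (X u) x y
      + gam G u (fderiv ℝ X u x) y + gam G u x (fderiv ℝ X u y) := by
  simp [lieGam]

/-- A symmetric bilinear map with `B(v, v)` parallel to `v` for all `v` is determined by its
trace. -/
theorem bilin_eq_of_parallel {n : ℕ} (b : Module.Basis (Fin n) ℝ E) {B : E →L[ℝ] E →L[ℝ] E}
    (hs : ∀ x y, B x y = B y x)
    (h : ∀ (v : E) (f g : E →ₗ[ℝ] ℝ), f (B v v) * g v = g (B v v) * f v) (f : E →ₗ[ℝ] ℝ) (x y : E) :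
    ((n : ℝ) + 1) * f (B x y)
      = (∑ l, b.repr (B y (b l)) l) * f x + (∑ l, b.repr (B x (b l)) l) * f y := by
  -- The hypothesis is a cubic identity in v. Inclusion and exclusion over x, y, z isolates its
  -- trilinear part, where every term occurs twice.
  have pol : ∀ (z : E) (g : E →ₗ[ℝ] ℝ), f (B x y) * g z + f (B y z) * g x + f (B x z) * g y
      = g (B x y) * f z + g (B y z) * f x + g (B x z) * f y := fun z g => by
    have h1 := h (x + y + z) f g
    have h2 := h (x + y) f g
    have h3 := h (y + z) f g
    have h4 := h (x + z) f g
    have h5 := h x f g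
    have h6 := h y f g
    have h7 := h z f g
    simp only [map_add, add_apply] at h1 h2 h3 h4
    rw [hs y x, hs z x, hs z y] at h1
    rw [hs y x] at h2
    rw [hs z y] at h3
    rw [hs z x] at h4
    linear_combination (1 / 2) * (h1 - h2 - h3 - h4 + h5 + h6 + h7)
  have hc : ∀ w : E, ∑ l, b.repr w l * f (b l) = f w := fun w => by
    conv_rhs => rw [← b.sum_repr w, map_sum]
    simp only [map_smul, smul_eq_mul]
  have hc2 : ∀ (w : E), ∑ l, f (B w (b l)) * b.repr x l = f (B w x) := fun w => by
    conv_rhs => rw [← b.sum_repr x, map_sum, map_sum]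
    exact Finset.sum_congr rfl fun l _ => by rw [map_smul, map_smul, smul_eq_mul, mul_comm]
  have hc3 : ∀ (w : E), ∑ l, f (B w (b l)) * b.repr y l = f (B w y) := fun w => by
    conv_rhs => rw [← b.sum_repr y, map_sum, map_sum]
    exact Finset.sum_congr rfl fun l _ => by rw [map_smul, map_smul, smul_eq_mul, mul_comm]
  -- Take z to be the l-th basis vector, g the l-th coordinate, and sum over l. The left side
  -- becomes (n + 2) f(B x y), the right side f(B x y) plus the two trace terms.
  have hsum := Finset.sum_congr rfl fun (l : Fin n) (_ : l ∈ Finset.univ) => pol (b l) (b.coord l)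
  simp only [Finset.sum_add_distrib, Module.Basis.coord_apply, Module.Basis.repr_self,
    Finsupp.single_eq_same, mul_one, Finset.sum_const, Finset.card_univ, Fintype.card_fin, hc,
    hc2, hc3, ← Finset.sum_mul, nsmul_eq_mul] at hsum
  rw [hs y x] at hsum
  linarith

namespace MetricOn

variable [FiniteDimensional ℝ E] [CompleteSpace E] {Ω : Set E} {G : E → Form E} (hG : MetricOn Ω G)
  {θ : E → E →L[ℝ] ℝ} {X : E → E} {u : E}
include hG

theorem lieGam_symm (hX : ContDiffOn ℝ ∞ X Ω) (hu : u ∈ Ω) (x y : E) :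
    lieGam G X u x y = lieGam G X u y x := by
  have hg : DifferentiableAt ℝ (gam G) u :=
    (hG.smooth_gam.contDiffAt (hG.mem_nhds hu)).differentiableAt (by simp)
  have h1 : fderiv ℝ (fderiv ℝ X) u x y = fderiv ℝ (fderiv ℝ X) u y x :=
    (hX.contDiffAt (hG.mem_nhds hu)).isSymmSndFDerivAt
      (by simpa using WithTop.coe_le_coe.2 (le_top : (2 : ℕ∞) ≤ ⊤)) x y
  have h2 : fderiv ℝ (gam G) u (X u) x y = fderiv ℝ (gam G) u (X u) y x := by
    rw [← fderiv_apply_const₂ hg, ← fderiv_apply_const₂ hg]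
    congr 1
    refine Filter.EventuallyEq.fderiv_eq ?_
    filter_upwards [hG.mem_nhds hu] with w hw using hG.gam_symm hw x y
  rw [lieGam_apply, lieGam_apply, h1, h2, hG.gam_symm hu y x, hG.gam_symm hu y, hG.gam_symm hu _ x]
  abel

/-- The covariant derivative of the Lie derivative of the metric. -/
theorem two_mul_nabla₂_symNabla (hX : ContDiffOn ℝ ∞ X Ω) (hθ : ContDiffOn ℝ ∞ θ Ω)
    (h : ∀ w ∈ Ω, ∀ y, θ w y = G w (X w) y) (hu : u ∈ Ω) (z y x : E) :
    2 * nabla₂ G (symNabla G θ) u z y x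
      = G u (lieGam G X u z y) x + G u y (lieGam G X u z x) := by
  have hGd := hG.differentiableAt hu
  have hg : DifferentiableAt ℝ (gam G) u :=
    (hG.smooth_gam.contDiffAt (hG.mem_nhds hu)).differentiableAt (by simp)
  have hXd : DifferentiableAt ℝ X u :=
    (hX.contDiffAt (hG.mem_nhds hu)).differentiableAt (by simp)
  have hX2 : DifferentiableAt ℝ (fderiv ℝ X) u :=
    ((hG.smooth_fderiv hX).contDiffAt (hG.mem_nhds hu)).differentiableAt (by simp)
  have hG2 : DifferentiableAt ℝ (fderiv ℝ G) u :=
    ((hG.smooth_fderiv hG.smooth).contDiffAt (hG.mem_nhds hu)).differentiableAt (by simp)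
  have hs : DifferentiableAt ℝ (symNabla G θ) u :=
    ((hG.smooth_symNabla hθ).contDiffAt (hG.mem_nhds hu)).differentiableAt (by simp)
  have hsymm : fderiv ℝ (fderiv ℝ G) u z (X u) = fderiv ℝ (fderiv ℝ G) u (X u) z :=
    (hG.contDiffAt hu).isSymmSndFDerivAt
      (by simpa using WithTop.coe_le_coe.2 (le_top : (2 : ℕ∞) ≤ ⊤)) z (X u)
  -- Half the Lie derivative of the metric in coordinates, with no connection in it, so that it can
  -- be differentiated directly.
  have hL : ∀ w ∈ Ω, ∀ a c, symNabla G θ w a c = (1 / 2) * (fderiv ℝ G w (X w) a c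
      + G w (fderiv ℝ X w a) c + G w a (fderiv ℝ X w c)) := fun w hw a c => by
    rw [symNabla_apply, hG.nabla₁_eq hX hθ h hw, hG.nabla₁_eq hX hθ h hw, hG.fderiv_metric hw,
      hG.symm hw a, hG.symm hw a, hG.gam_symm hw (X w), hG.gam_symm hw (X w), map_add, map_add,
      add_apply, add_apply]
    ring
  -- Differentiating ∇g = 0 along X trades second derivatives of the metric for derivatives of `gam
  -- G`, which are what `lieGam` contains.
  have dG : ∀ a c, fderiv ℝ (fderiv ℝ G) u (X u) z a c
      = fderiv ℝ G u (X u) (gam G u z a) c + G u (fderiv ℝ (gam G) u (X u) z a) c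
        + fderiv ℝ G u (X u) a (gam G u z c) + G u a (fderiv ℝ (gam G) u (X u) z c) := by
    intro a c
    have hga : ∀ a, DifferentiableAt ℝ (fun w => gam G w z a) u := fun a =>
      (hg.clm_apply (differentiableAt_const z)).clm_apply (differentiableAt_const a)
    have hGz : DifferentiableAt ℝ (fun w => fderiv ℝ G w z) u :=
      hG2.clm_apply (differentiableAt_const z)
    have e : (fun w => fderiv ℝ G w z a c)
        =ᶠ[𝓝 u] fun w => G w (gam G w z a) c + G w a (gam G w z c) := by
      filter_upwards [hG.mem_nhds hu] with w hw using hG.fderiv_metric hw z a c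
    have h1 : DifferentiableAt ℝ (fun w => G w (gam G w z a)) u := hGd.clm_apply (hga a)
    have h2 : DifferentiableAt ℝ (fun w => G w a) u := hGd.clm_apply (differentiableAt_const a)
    rw [← fderiv_apply_const hG2, ← fderiv_apply_const₂ hGz, e.fderiv_eq,
      fderiv_fun_add (h1.clm_apply (differentiableAt_const c)) (h2.clm_apply (hga c)), add_apply,
      fderiv_apply_const h1, fderiv_clm_apply hGd (hga a), fderiv_clm_apply h2 (hga c)]
    simp only [add_apply, ContinuousLinearMap.comp_apply, ContinuousLinearMap.flip_apply]
    rw [fderiv_apply_const hGd, fderiv_apply_const₂ hg, fderiv_apply_const₂ hg]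
    ring
  have key : fderiv ℝ (symNabla G θ) u z y x = (1 / 2) * (fderiv ℝ (fderiv ℝ G) u z (X u) y x
      + fderiv ℝ G u (fderiv ℝ X u z) y x
      + (fderiv ℝ G u z (fderiv ℝ X u y) x + G u (fderiv ℝ (fderiv ℝ X) u z y) x)
      + (fderiv ℝ G u z y (fderiv ℝ X u x) + G u y (fderiv ℝ (fderiv ℝ X) u z x))) := by
    have hXa : ∀ a, DifferentiableAt ℝ (fun w => fderiv ℝ X w a) u := fun a =>
      hX2.clm_apply (differentiableAt_const a)
    have e : (fun w => symNabla G θ w y x) =ᶠ[𝓝 u] fun w => (1 / 2) * (fderiv ℝ G w (X w) y x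
      + G w (fderiv ℝ X w y) x + G w y (fderiv ℝ X w x)) := by
      filter_upwards [hG.mem_nhds hu] with w hw using hL w hw y x
    have h0 : DifferentiableAt ℝ (fun w => fderiv ℝ G w (X w)) u := hG2.clm_apply hXd
    have h1 : DifferentiableAt ℝ (fun w => fderiv ℝ G w (X w) y x) u :=
      (h0.clm_apply (differentiableAt_const y)).clm_apply (differentiableAt_const x)
    have h2' : DifferentiableAt ℝ (fun w => G w (fderiv ℝ X w y)) u := hGd.clm_apply (hXa y)
    have h2 := h2'.clm_apply (differentiableAt_const x)
    have h3' : DifferentiableAt ℝ (fun w => G w y) u := hGd.clm_apply (differentiableAt_const y)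
    have h3 := h3'.clm_apply (hXa x)
    have e2 : fderiv ℝ (fun w => (1 / 2 : ℝ) * (fderiv ℝ G w (X w) y x
      + G w (fderiv ℝ X w y) x + G w y (fderiv ℝ X w x))) u = _ :=
      (((h1.hasFDerivAt.add h2.hasFDerivAt).add h3.hasFDerivAt).const_mul (1 / 2 : ℝ)).fderiv
    rw [← fderiv_apply_const₂ hs, e.fderiv_eq, e2]
    simp only [add_apply, smul_apply, smul_eq_mul]
    rw [fderiv_apply_const₂ h0, fderiv_clm_apply hG2 hXd, fderiv_apply_const h2',
      fderiv_clm_apply hGd (hXa y), fderiv_clm_apply h3' (hXa x)]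
    simp only [add_apply, ContinuousLinearMap.comp_apply, ContinuousLinearMap.flip_apply]
    rw [fderiv_apply_const hX2, fderiv_apply_const hX2, fderiv_apply_const hGd]
    ring
  rw [nabla₂, key, hsymm, dG, hL u hu, hL u hu, hG.fderiv_metric hu (fderiv ℝ X u z),
    hG.fderiv_metric hu z, hG.fderiv_metric hu z, lieGam_apply, lieGam_apply]
  simp only [map_add, map_sub, add_apply, sub_apply]
  ring

/-- If the Lie derivative of the connection along `X` maps each `(v, v)` to a multiple of `v`, the
1-form dual to `X` satisfies the Eisenhart equation. -/
theorem eisLocal_eq_zero_of_parallel {n : ℕ} (b₀ : Module.Basis (Fin n) ℝ E)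
    (hX : ContDiffOn ℝ ∞ X Ω) (hθ : ContDiffOn ℝ ∞ θ Ω)
    (h : ∀ w ∈ Ω, ∀ y, θ w y = G w (X w) y) (hu : u ∈ Ω)
    (hp : ∀ (v : E) (f g : E →ₗ[ℝ] ℝ),
      f (lieGam G X u v v) * g v = g (lieGam G X u v v) * f v) (z y x : E) :
    eisLocal n G θ u z y x = 0 := by
  obtain ⟨b, hb⟩ := (hG.pos u hu).exists_orthonormal b₀
  set τ : E → ℝ := fun w => ∑ l, b.repr (lieGam G X u w (b l)) l with hτ
  have h1 : ∀ a c d, ((n : ℝ) + 1) * G u (lieGam G X u a c) d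
      = τ c * G u a d + τ a * G u c d := fun a c d => by
    have := bilin_eq_of_parallel b (hG.lieGam_symm hX hu) hp
      (((G u).flip d : E →L[ℝ] ℝ) : E →ₗ[ℝ] ℝ) a c
    simpa using this
  have h2 : ∀ z y x, 2 * ((n : ℝ) + 1) * nabla₂ G (symNabla G θ) u z y x
      = 2 * τ z * G u y x + τ y * G u z x + τ x * G u z y := fun z y x => by
    have e := hG.two_mul_nabla₂_symNabla hX hθ h hu z y x
    have e1 := h1 z y x
    have e2 := h1 z x y
    rw [hG.symm hu y] at e
    rw [hG.symm hu x y] at e2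
    linear_combination ((n : ℝ) + 1) * e + e1 + e2
  have hτl : ∃ t : E →L[ℝ] ℝ, ∀ w, t w = τ w :=
    ⟨∑ l, LinearMap.toContinuousLinearMap ((b.coord l).comp
      ((lieGam G X u).flip (b l) : E →ₗ[ℝ] E)), fun w => by simp [hτ]⟩
  obtain ⟨t, ht⟩ := hτl
  have hn1 : ((n : ℝ) + 1) ≠ 0 := by positivity
  -- The trace of the preceding identity over its last two slots is (2n + 2) τ z, so τ is the
  -- differential of the divergence.
  have h3 : ∀ z, fderiv ℝ (diverg G θ) u z = τ z := fun z => by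
    rw [hG.fderiv_diverg hθ hu hb]
    have h5 : ∑ i, G u z (b i) * τ (b i) = τ z := by
      simp only [← ht]; exact sum_mul_apply hb t z
    have h4 : 2 * ((n : ℝ) + 1) * ∑ i, nabla₂ G (symNabla G θ) u z (b i) (b i)
        = 2 * ((n : ℝ) + 1) * τ z := by
      rw [Finset.mul_sum]
      have : ∀ i, 2 * ((n : ℝ) + 1) * nabla₂ G (symNabla G θ) u z (b i) (b i)
          = 2 * τ z + 2 * (G u z (b i) * τ (b i)) := fun i => by
        rw [h2, show G u (b i) (b i) = 1 by simpa using hb i i]; ring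
      simp only [this, Finset.sum_add_distrib, ← Finset.mul_sum, h5]
      simp
      ring
    exact mul_left_cancel₀ (mul_ne_zero two_ne_zero hn1) h4
  rw [eisLocal, h2, h3, h3, h3]
  ring

end MetricOn

/-! ### Comparison with the formulas in components -/

variable {n : ℕ}

/-- The model space. -/
abbrev Eucl (n : ℕ) : Type := EuclideanSpace ℝ (Fin n)

/-- The standard basis of the model space. -/
def stdBasis (n : ℕ) : Module.Basis (Fin n) ℝ (Eucl n) := (EuclideanSpace.basisFun (Fin n) ℝ).toBasis

@[simp] theorem stdBasis_apply (i : Fin n) : stdBasis n i = EuclideanSpace.single i (1 : ℝ) := by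
  simp [stdBasis]

@[simp] theorem stdBasis_repr (x : Eucl n) (i : Fin n) : (stdBasis n).repr x i = x i := by
  simp [stdBasis]

theorem eq_sum_single (x : Eucl n) : x = ∑ i, x i • EuclideanSpace.single i (1 : ℝ) := by
  conv_lhs => rw [← (stdBasis n).sum_repr x]
  simp [-Module.Basis.sum_repr]

/-- The matrix of a bilinear form in the standard basis. -/
def formMatrix (B : Form (Eucl n)) : Matrix (Fin n) (Fin n) ℝ :=
  Matrix.of fun i j => B (EuclideanSpace.single i (1 : ℝ)) (EuclideanSpace.single j (1 : ℝ))

theorem gramOf_stdBasis (B : Form (Eucl n)) :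
    gramOf B.toLinearMap₁₂ (stdBasis n) = formMatrix B := by
  ext i j; simp [gramOf, formMatrix]

theorem formMatrix_det_pos {B : Form (Eucl n)} (hB : PosForm B.toLinearMap₁₂) :
    0 < (formMatrix B).det := by
  rw [← gramOf_stdBasis]; exact hB.gramOf_det_pos _

theorem formTrace_eq_sum {B : Form (Eucl n)} (hB : PosForm B.toLinearMap₁₂) (C : Form (Eucl n)) :
    formTrace B C = ∑ i, ∑ j, (formMatrix B)⁻¹ i j *
      C (EuclideanSpace.single i (1 : ℝ)) (EuclideanSpace.single j (1 : ℝ)) := by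
  rw [formTrace_eq_traceIn hB C (stdBasis n), traceIn, gramOf_stdBasis]
  simp

theorem raise_apply {B : Form (Eucl n)} (hB : PosForm B.toLinearMap₁₂) (l : Eucl n →L[ℝ] ℝ)
    (i : Fin n) :
    raise B l i = ∑ j, (formMatrix B)⁻¹ i j * l (EuclideanSpace.single j (1 : ℝ)) := by
  have hd : IsUnit (formMatrix B).det := (formMatrix_det_pos hB).ne'.isUnit
  have h1 : ∀ j, l (EuclideanSpace.single j (1 : ℝ)) = ∑ k, formMatrix B j k * raise B l k := by
    intro j
    rw [← form_raise hB l, show B (raise B l) (EuclideanSpace.single j (1 : ℝ))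
      = B (EuclideanSpace.single j (1 : ℝ)) (raise B l) from hB.symm _ _]
    conv_lhs => rw [eq_sum_single (raise B l)]
    simp [formMatrix, mul_comm]
  have h2 : ∀ k, ∑ j, (formMatrix B)⁻¹ i j * formMatrix B j k = if i = k then 1 else 0 := by
    intro k
    have := congrFun (congrFun (Matrix.nonsing_inv_mul _ hd) i) k
    rwa [Matrix.mul_apply, Matrix.one_apply] at this
  calc raise B l i
      = ∑ k, (∑ j, (formMatrix B)⁻¹ i j * formMatrix B j k) * raise B l k := by simp [h2]
    _ = _ := by
        simp only [Finset.sum_mul, h1, Finset.mul_sum]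
        rw [Finset.sum_comm]
        exact Finset.sum_congr rfl fun _ _ => Finset.sum_congr rfl fun _ _ => by ring

theorem sum_apply_single {V : Type*} [NormedAddCommGroup V] [NormedSpace ℝ V]
    (l : Eucl n →L[ℝ] V)
    (x : Eucl n) : ∑ i, x i • l (EuclideanSpace.single i (1 : ℝ)) = l x := by
  conv_rhs => rw [eq_sum_single x]
  simp

theorem sum_mul_of_isLinearMap {f : Eucl n → ℝ} (hf : IsLinearMap ℝ f) (x : Eucl n) :
    ∑ i, f (EuclideanSpace.single i (1 : ℝ)) * x i = f x := by
  have := sum_apply_single (LinearMap.toContinuousLinearMap (hf.mk' f)) x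
  simpa [mul_comm] using this

namespace MetricOn

variable {Ω : Set (Eucl n)} {G : Eucl n → Form (Eucl n)} (hG : MetricOn Ω G)
  {θ : Eucl n → Eucl n →L[ℝ] ℝ} {u : Eucl n}
include hG

theorem pd_matrix (hu : u ∈ Ω) (i j k : Fin n) :
    Coord.pd i (fun w => formMatrix (G w) j k) u = fderiv ℝ G u (EuclideanSpace.single i (1 : ℝ))
      (EuclideanSpace.single j (1 : ℝ)) (EuclideanSpace.single k (1 : ℝ)) := by
  rw [← fderiv_apply_const₂ (hG.differentiableAt hu)]; rfl

theorem christoffel_eq (hu : u ∈ Ω) (m i j : Fin n) :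
    Coord.christoffel (fun w => formMatrix (G w)) u m i j
      = gam G u (EuclideanSpace.single i (1 : ℝ)) (EuclideanSpace.single j (1 : ℝ)) m := by
  rw [gam_apply, raise_apply (hG.pos u hu), Coord.christoffel, Finset.mul_sum]
  refine Finset.sum_congr rfl fun l _ => ?_
  rw [hG.pd_matrix hu, hG.pd_matrix hu, hG.pd_matrix hu, koszulForm_apply]
  ring

theorem covDeriv_one (hθ : ContDiffOn ℝ ∞ θ Ω) (hu : u ∈ Ω) (i j : Fin n) :
    Coord.covDeriv (fun w => formMatrix (G w))
      (fun w (I : Fin 1 → Fin n) => θ w (EuclideanSpace.single (I 0) (1 : ℝ))) u ![i, j]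
      = nabla₁ G θ u (EuclideanSpace.single i (1 : ℝ)) (EuclideanSpace.single j (1 : ℝ)) := by
  have hd : DifferentiableAt ℝ θ u :=
    (hθ.contDiffAt (hG.mem_nhds hu)).differentiableAt (by simp)
  rw [nabla₁_apply, Coord.covDeriv, ← fderiv_apply_const hd, ← sum_apply_single (θ u)]
  simp [hG.christoffel_eq hu, Fin.tail, Coord.pd]

theorem symDeriv_eq (hθ : ContDiffOn ℝ ∞ θ Ω) (hu : u ∈ Ω) (I : Fin 2 → Fin n) :
    Coord.symDeriv (fun w => formMatrix (G w))
      (fun w (I : Fin 1 → Fin n) => θ w (EuclideanSpace.single (I 0) (1 : ℝ))) u I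
      = symNabla G θ u (EuclideanSpace.single (I 0) (1 : ℝ))
        (EuclideanSpace.single (I 1) (1 : ℝ)) := by
  rw [Coord.symDeriv, hG.covDeriv_one hθ hu, hG.covDeriv_one hθ hu, symNabla_apply]

theorem codiff_eq (hθ : ContDiffOn ℝ ∞ θ Ω) (hu : u ∈ Ω) :
    Coord.codiff (fun w => formMatrix (G w))
      (fun w (I : Fin 1 → Fin n) => θ w (EuclideanSpace.single (I 0) (1 : ℝ))) u
      = - diverg G θ u := by
  rw [Coord.codiff, diverg, formTrace_eq_sum (hG.pos u hu)]
  simp only [hG.covDeriv_one hθ hu]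

theorem covDeriv_two (hθ : ContDiffOn ℝ ∞ θ Ω) (hu : u ∈ Ω) (K : Fin 3 → Fin n) :
    Coord.covDeriv (fun w => formMatrix (G w)) (Coord.symDeriv (fun w => formMatrix (G w))
      (fun w (I : Fin 1 → Fin n) => θ w (EuclideanSpace.single (I 0) (1 : ℝ)))) u K
      = nabla₂ G (symNabla G θ) u (EuclideanSpace.single (K 0) (1 : ℝ))
        (EuclideanSpace.single (K 1) (1 : ℝ)) (EuclideanSpace.single (K 2) (1 : ℝ)) := by
  have hd : DifferentiableAt ℝ (symNabla G θ) u :=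
    ((hG.smooth_symNabla hθ).contDiffAt (hG.mem_nhds hu)).differentiableAt (by simp)
  have e : (fun w => Coord.symDeriv (fun w => formMatrix (G w))
      (fun w (I : Fin 1 → Fin n) => θ w (EuclideanSpace.single (I 0) (1 : ℝ))) w (Fin.tail K))
      =ᶠ[𝓝 u] fun w => symNabla G θ w (EuclideanSpace.single (K 1) (1 : ℝ))
        (EuclideanSpace.single (K 2) (1 : ℝ)) := by
    filter_upwards [hG.mem_nhds hu] with w hw using hG.symDeriv_eq hθ hw _
  rw [nabla₂, Coord.covDeriv, Coord.pd, e.fderiv_eq, ← fderiv_apply_const₂ hd, sub_sub,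
    Fin.sum_univ_two]
  simp only [hG.symDeriv_eq hθ hu, hG.christoffel_eq hu]
  congr 2
  · have := sum_apply_single ((symNabla G θ u).flip (EuclideanSpace.single (K 2) (1 : ℝ))) (gam G u (EuclideanSpace.single (K 0) (1 : ℝ))
        (EuclideanSpace.single (K 1) (1 : ℝ)))
    simpa [Fin.tail, Function.update_self, Function.update_of_ne] using this
  · have := sum_apply_single ((symNabla G θ u) (EuclideanSpace.single (K 1) (1 : ℝ))) (gam G u (EuclideanSpace.single (K 0) (1 : ℝ))
        (EuclideanSpace.single (K 2) (1 : ℝ)))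
    simpa [Fin.tail, Function.update_self, Function.update_of_ne] using this

/-- The signs of the trace terms differ because the component formula uses the codifferential, which
is minus `diverg`. -/
theorem eisenhart_eq (hθ : ContDiffOn ℝ ∞ θ Ω) (hu : u ∈ Ω) (K : Fin 3 → Fin n) :
    Coord.eisenhart (fun w => formMatrix (G w))
      (fun w (I : Fin 1 → Fin n) => θ w (EuclideanSpace.single (I 0) (1 : ℝ))) u K
      = eisMultilinear n G θ u (fun a => EuclideanSpace.single (K a) (1 : ℝ)) := by
  have hpd : ∀ i, Coord.pd i (Coord.codiff (fun w => formMatrix (G w))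
      (fun w (I : Fin 1 → Fin n) => θ w (EuclideanSpace.single (I 0) (1 : ℝ)))) u
      = - fderiv ℝ (diverg G θ) u (EuclideanSpace.single i (1 : ℝ)) := fun i => by
    have e : Coord.codiff (fun w => formMatrix (G w))
      (fun w (I : Fin 1 → Fin n) => θ w (EuclideanSpace.single (I 0) (1 : ℝ)))
      =ᶠ[𝓝 u] fun w => - diverg G θ w := by
      filter_upwards [hG.mem_nhds hu] with w hw using hG.codiff_eq hθ hw
    rw [Coord.pd, e.fderiv_eq, fderiv_fun_neg]; rfl
  rw [Coord.eisenhart, hG.covDeriv_two hθ hu, hpd, hpd, hpd]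
  change _ = eisLocal n G θ u _ _ _
  rw [eisLocal]
  simp only [formMatrix, Matrix.of_apply]
  ring

theorem riemann_eq (hu : u ∈ Ω) (l k i j : Fin n) :
    Coord.riemann (fun w => formMatrix (G w)) u l k i j
      = curv G u (EuclideanSpace.single i (1 : ℝ)) (EuclideanSpace.single j (1 : ℝ))
        (EuclideanSpace.single k (1 : ℝ)) l := by
  have hg : DifferentiableAt ℝ (gam G) u :=
    (hG.smooth_gam.contDiffAt (hG.mem_nhds hu)).differentiableAt (by simp)
  have hpd : ∀ i j k, Coord.pd i (fun w => Coord.christoffel (fun w => formMatrix (G w)) w l j k) u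
      = fderiv ℝ (gam G) u (EuclideanSpace.single i (1 : ℝ)) (EuclideanSpace.single j (1 : ℝ))
        (EuclideanSpace.single k (1 : ℝ)) l := fun i j k => by
    have e : (fun w => Coord.christoffel (fun w => formMatrix (G w)) w l j k) =ᶠ[𝓝 u]
        EuclideanSpace.proj (𝕜 := ℝ) l ∘ fun w => gam G w (EuclideanSpace.single j (1 : ℝ))
          (EuclideanSpace.single k (1 : ℝ)) := by
      filter_upwards [hG.mem_nhds hu] with w hw using hG.christoffel_eq hw l j k
    rw [Coord.pd, e.fderiv_eq, fderiv_comp u (EuclideanSpace.proj (𝕜 := ℝ) l).differentiableAt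
      ((hg.clm_apply (differentiableAt_const _)).clm_apply (differentiableAt_const _)),
      ← fderiv_apply_const₂ hg, ContinuousLinearMap.fderiv]
    rfl
  have hc : ∀ i j k, ∑ m, Coord.christoffel (fun w => formMatrix (G w)) u l i m
      * Coord.christoffel (fun w => formMatrix (G w)) u m j k
      = gam G u (EuclideanSpace.single i (1 : ℝ)) (gam G u (EuclideanSpace.single j (1 : ℝ))
        (EuclideanSpace.single k (1 : ℝ))) l := fun i j k => by
    rw [← sum_apply_single (gam G u (EuclideanSpace.single i (1 : ℝ)))]
    simp [hG.christoffel_eq hu, mul_comm]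
  rw [Coord.riemann, hpd, hpd, Finset.sum_sub_distrib, hc, hc, curv]
  simp
  ring

/-- Curvature is linear in each argument, so the indices are contracted one at a time. This
identifies the numerator of `sectional` with g(R(v, w) w, v). -/
theorem sum_riemann_eq (hu : u ∈ Ω) (v w : Eucl n) :
    ∑ i, ∑ j, ∑ k, ∑ l, ∑ p, formMatrix (G u) l p
      * Coord.riemann (fun w => formMatrix (G w)) u l k i j * v i * w j * w k * v p
      = G u (curv G u v w w) v := by
  have h1 : ∀ i j k, ∑ l, ∑ p, formMatrix (G u) l p
      * Coord.riemann (fun w => formMatrix (G w)) u l k i j * v i * w j * w k * v p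
      = G u (curv G u (EuclideanSpace.single i (1 : ℝ)) (EuclideanSpace.single j (1 : ℝ))
        (EuclideanSpace.single k (1 : ℝ))) v * w k * w j * v i := fun i j k => by
    set z := curv G u (EuclideanSpace.single i (1 : ℝ)) (EuclideanSpace.single j (1 : ℝ))
        (EuclideanSpace.single k (1 : ℝ)) with hz
    rw [← sum_mul_of_isLinearMap (f := fun z => G u z v) ⟨by simp, by simp⟩ z, Finset.sum_mul,
      Finset.sum_mul, Finset.sum_mul]
    refine Finset.sum_congr rfl fun l _ => ?_
    rw [← sum_mul_of_isLinearMap (f := fun v => G u (EuclideanSpace.single l (1 : ℝ)) v)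
      ⟨by simp, by simp⟩ v, Finset.sum_mul, Finset.sum_mul, Finset.sum_mul, Finset.sum_mul]
    refine Finset.sum_congr rfl fun p _ => ?_
    rw [hG.riemann_eq hu, ← hz, formMatrix, Matrix.of_apply]
    ring
  simp only [h1]
  have h2 : ∀ x y, IsLinearMap ℝ fun z => G u (curv G u x y z) v := fun x y =>
    ⟨fun a c => by simp only [curv, map_add, map_sub, add_apply, sub_apply]; ring,
      fun a c => by simp only [curv, map_smul, map_add, map_sub, add_apply, sub_apply, smul_apply,
        smul_eq_mul]; ring⟩
  have h3 : ∀ x z, IsLinearMap ℝ fun y => G u (curv G u x y z) v := fun x z =>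
    ⟨fun a c => by simp only [curv, map_add, map_sub, add_apply, sub_apply]; ring,
      fun a c => by simp only [curv, map_smul, map_add, map_sub, add_apply, sub_apply, smul_apply,
        smul_eq_mul]; ring⟩
  have h4 : ∀ y z, IsLinearMap ℝ fun x => G u (curv G u x y z) v := fun x z =>
    ⟨fun a c => by simp only [curv, map_add, map_sub, add_apply, sub_apply]; ring,
      fun a c => by simp only [curv, map_smul, map_add, map_sub, add_apply, sub_apply, smul_apply,
        smul_eq_mul]; ring⟩
  simp only [← Finset.sum_mul]
  simp only [sum_mul_of_isLinearMap (h2 _ _) w, sum_mul_of_isLinearMap (h3 _ _) w,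
    sum_mul_of_isLinearMap (h4 _ _) v]

end MetricOn

/-! ### Tensor fields in charts -/

section Charts

variable {n : ℕ} {M : Type*} [TopologicalSpace M] [ChartedSpace (EuclideanSpace ℝ (Fin n)) M]

/-- The charts of `M`. -/
abbrev Chart (n : ℕ) (M : Type*) [TopologicalSpace M] : Type _ :=
  OpenPartialHomeomorph M (EuclideanSpace ℝ (Fin n))

/-- The derivative of the chart `e`. -/
def coordMap (e : Chart n M) (x : M) : TangentSpace (𝓡 n) x →L[ℝ] Eucl n :=
  (mfderiv (𝓡 n) (𝓡 n) e x : TangentSpace (𝓡 n) x →L[ℝ] TangentSpace (𝓡 n) (e x))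

/-- The derivative of the inverse of the chart `e`. -/
def frameMap (e : Chart n M) (u : Eucl n) : Eucl n →L[ℝ] TangentSpace (𝓡 n) (e.symm u) :=
  (mfderiv (𝓡 n) (𝓡 n) e.symm u : TangentSpace (𝓡 n) u →L[ℝ] TangentSpace (𝓡 n) (e.symm u))

theorem frame_eq (e : Chart n M) (u : Eucl n) (i : Fin n) :
    frame e u i = frameMap e u (EuclideanSpace.single i (1 : ℝ)) := rfl

theorem coord_eq (e : Chart n M) (x : M) (i : Fin n) (v : TangentSpace (𝓡 n) x) :
    coord e x i v = coordMap e x v i := rfl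

/-- The inverse of `coordMap`. -/
def frameAt (e : Chart n M) (x : M) : Eucl n →L[ℝ] TangentSpace (𝓡 n) x :=
  ContinuousLinearMap.inverse (coordMap e x)

variable [IsManifold (𝓡 n) ∞ M]

variable {e e' : Chart n M} (he : e ∈ atlas (EuclideanSpace ℝ (Fin n)) M)
  (he' : e' ∈ atlas (EuclideanSpace ℝ (Fin n)) M)

theorem mdifferentiable_chart' (he : e ∈ atlas (EuclideanSpace ℝ (Fin n)) M) :
    e.MDifferentiable (𝓡 n) (𝓡 n) :=
  haveI : IsManifold (𝓡 n) 1 M := IsManifold.of_le (n := ∞) (by simp)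
  mdifferentiable_of_mem_atlas he

/-- `coordMap` as an equivalence. -/
def coordEquiv (he : e ∈ atlas (EuclideanSpace ℝ (Fin n)) M) {x : M} (hx : x ∈ e.source) :
    TangentSpace (𝓡 n) x ≃L[ℝ] Eucl n :=
  (mdifferentiable_chart' he).mfderiv hx

theorem coe_coordEquiv {x : M} (hx : x ∈ e.source) :
    (coordEquiv he hx : TangentSpace (𝓡 n) x →L[ℝ] Eucl n) = coordMap e x := rfl

theorem frameAt_eq {x : M} (hx : x ∈ e.source) :
    frameAt e x = ((coordEquiv he hx).symm : Eucl n →L[ℝ] TangentSpace (𝓡 n) x) := by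
  rw [frameAt, ← coe_coordEquiv he hx, ContinuousLinearMap.inverse_equiv]

include he in
theorem frameAt_coordMap {x : M} (hx : x ∈ e.source) (v : TangentSpace (𝓡 n) x) :
    frameAt e x (coordMap e x v) = v := by
  rw [frameAt_eq he hx]; exact (coordEquiv he hx).symm_apply_apply v

include he in
theorem coordMap_frameAt {x : M} (hx : x ∈ e.source) (v : Eucl n) :
    coordMap e x (frameAt e x v) = v := by
  rw [frameAt_eq he hx]; exact (coordEquiv he hx).apply_symm_apply v

include he in
-- `frameMap` takes values over the point `e.symm u`, while `frameAt` does so over any given x.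
-- Passing to the latter avoids transporting tangent vectors along `e.symm (e x) = x`.
theorem frameMap_eq {u : Eucl n} (hu : u ∈ e.target) : frameMap e u = frameAt e (e.symm u) := by
  ext1 v
  have h : coordMap e (e.symm u) (frameMap e u v) = v := by
    have h1 := (mdifferentiable_chart' he).comp_symm_deriv hu
    exact congrArg (fun L => L v) h1
  rw [← frameAt_coordMap he (e.map_target hu) (frameMap e u v), h]

include he he' in
theorem coordMap_comp {x : M} (hx : x ∈ e.source) (hx' : x ∈ e'.source)
    (v : TangentSpace (𝓡 n) x) :
    coordMap e' x v = fderiv ℝ (fun u => e' (e.symm u)) (e x) (coordMap e x v) := by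
  have h1 := (mdifferentiable_chart' he).mdifferentiableAt hx
  have h2 := (mdifferentiable_chart' he).mdifferentiableAt_symm (e.map_source hx)
  have h3 : MDifferentiableAt (𝓡 n) (𝓡 n) e' (e.symm (e x)) := by
    rw [e.left_inv hx]; exact (mdifferentiable_chart' he').mdifferentiableAt hx'
  have h4 : MDifferentiableAt (𝓡 n) (𝓡 n) (fun u => e' (e.symm u)) (e x) := h3.comp (e x) h2
  have h5 : (e' : M → Eucl n) =ᶠ[𝓝 x] (fun u => e' (e.symm u)) ∘ e := by
    filter_upwards [e.open_source.mem_nhds hx] with y hy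
    simp [e.left_inv hy]
  have h6 : mfderiv (𝓡 n) (𝓡 n) e' x = (mfderiv (𝓡 n) (𝓡 n) (fun u => e' (e.symm u)) (e x)).comp
      (mfderiv (𝓡 n) (𝓡 n) e x) := by
    rw [h5.mfderiv_eq]
    exact mfderiv_comp x h4 h1
  have h7 := congrArg (fun L : TangentSpace (𝓡 n) x →L[ℝ] Eucl n => L v) h6
  rw [mfderiv_eq_fderiv] at h7
  exact h7

include he he' in
theorem frameAt_comp {x : M} (hx : x ∈ e.source) (hx' : x ∈ e'.source) (v : Eucl n) :
    frameAt e' x (fderiv ℝ (fun u => e' (e.symm u)) (e x) v) = frameAt e x v := by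
  conv_lhs => rw [← coordMap_frameAt he hx v]
  rw [← coordMap_comp he he' hx hx', frameAt_coordMap he' hx']

/-- The overlap of two charts, seen in the first one. -/
def overlap (e e' : Chart n M) : Set (Eucl n) := e.target ∩ e.symm ⁻¹' e'.source

theorem isOpen_overlap (e e' : Chart n M) : IsOpen (overlap e e') :=
  e.isOpen_inter_preimage_symm e'.open_source

include he he' in
theorem contDiffOn_overlap : ContDiffOn ℝ ∞ (fun u => e' (e.symm u)) (overlap e e') := by
  have h1 := contMDiffOn_of_mem_maximalAtlas (I := 𝓡 n) (n := ∞)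
    (IsManifold.subset_maximalAtlas he')
  have h2 := contMDiffOn_symm_of_mem_maximalAtlas (I := 𝓡 n) (n := ∞)
    (IsManifold.subset_maximalAtlas he)
  exact contMDiffOn_iff_contDiffOn.1 (h1.comp (h2.mono inter_subset_left) fun u hu => hu.2)

include he he' in
theorem bijective_overlap {u : Eucl n} (hu : u ∈ overlap e e') :
    Function.Bijective (fderiv ℝ (fun u => e' (e.symm u)) u) := by
  have hx : e.symm u ∈ e.source := e.map_target hu.1
  have h : ∀ v, fderiv ℝ (fun u => e' (e.symm u)) u v
      = coordEquiv he' hu.2 ((coordEquiv he hx).symm v) := fun v => by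
    have h1 := coordMap_comp he he' hx hu.2 (frameAt e (e.symm u) v)
    rw [coordMap_frameAt he hx, e.right_inv hu.1, frameAt_eq he hx] at h1
    exact h1.symm
  have h2 : ⇑(fderiv ℝ (fun u => e' (e.symm u)) u)
      = (coordEquiv he' hu.2) ∘ (coordEquiv he hx).symm := funext h
  rw [h2]
  exact (coordEquiv he' hu.2).bijective.comp (coordEquiv he hx).symm.bijective

/-! ### The metric and 1-forms in a chart -/

/-- The metric in the chart `e`. -/
def metricForm (g : Metric n M) (e : Chart n M) (u : Eucl n) : Form (Eucl n) :=
  LinearMap.toContinuousLinearMap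
    { toFun := fun x => (g.inner (e.symm u) (frameMap e u x)).comp (frameMap e u)
      map_add' := fun x y => by ext; simp
      map_smul' := fun c x => by ext; simp }

theorem metricForm_apply (g : Metric n M) (e : Chart n M) (u x y : Eucl n) :
    metricForm g e u x y = g.inner (e.symm u) (frameMap e u x) (frameMap e u y) := rfl

theorem metricComp_eq (g : Metric n M) (e : Chart n M) :
    metricComp g e = fun u => formMatrix (metricForm g e u) := rfl

/-- A field of 1-forms in the chart `e`. -/
def oneForm (θ : TensorField n 1 M) (e : Chart n M) (u : Eucl n) : Eucl n →L[ℝ] ℝ :=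
  LinearMap.toContinuousLinearMap
    (((MultilinearMap.ofSubsingleton ℝ (TangentSpace (𝓡 n) (e.symm u)) ℝ (0 : Fin 1)).symm
      (θ (e.symm u))).comp (frameMap e u : Eucl n →ₗ[ℝ] TangentSpace (𝓡 n) (e.symm u)))

theorem oneForm_apply (θ : TensorField n 1 M) (e : Chart n M) (u y : Eucl n) :
    oneForm θ e u y = θ (e.symm u) (fun _ => frameMap e u y) := by
  rfl

theorem comp_eq_oneForm (θ : TensorField n 1 M) (e : Chart n M) :
    comp e θ = fun u (I : Fin 1 → Fin n) => oneForm θ e u (EuclideanSpace.single (I 0) (1 : ℝ)) := by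
  funext u I
  rw [oneForm_apply, comp]
  congr 1
  funext a
  rw [Subsingleton.elim a 0, frame_eq]

include he in
-- Such a section is the tangent map of `e.symm` applied to a constant vector field.
theorem contMDiffOn_frameMap (v : Eucl n) : ContMDiffOn (𝓡 n) (𝓡 n).tangent ∞
    (fun u => (⟨e.symm u, frameMap e u v⟩ : TangentBundle (𝓡 n) M)) e.target := by
  have h1 := contMDiffOn_symm_of_mem_maximalAtlas (I := 𝓡 n) (n := ∞)
    (IsManifold.subset_maximalAtlas he)
  have h2 := h1.contMDiffOn_tangentMapWithin (m := ∞) (by simp) e.open_target.uniqueMDiffOn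
  have h3 : ContMDiffOn (𝓡 n) (𝓡 n).tangent ∞
      (fun u : Eucl n => (⟨u, v⟩ : TangentBundle (𝓡 n) (Eucl n))) e.target :=
    contMDiffOn_vectorSpace_iff_contDiffOn.2 contDiffOn_const
  refine (h2.comp h3 fun u hu => hu).congr fun u hu => ?_
  simp only [Function.comp_apply, tangentMapWithin]
  rw [mfderivWithin_of_isOpen e.open_target hu]
  rfl

theorem posForm_inner (g : Metric n M) (x : M) : PosForm (g.inner x).toLinearMap₁₂ :=
  ⟨fun v w => g.symm x v w, fun v hv => g.pos x v hv⟩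

include he in
theorem metricOn (g : Metric n M) : MetricOn e.target (metricForm g e) where
  isOpen := e.open_target
  smooth := by
    refine contDiffOn_form fun x y => ?_
    intro u hu
    have hu' : ContMDiffWithinAt (𝓡 n) (𝓡 n) ∞ e.symm e.target u :=
      contMDiffOn_symm_of_mem_maximalAtlas (I := 𝓡 n) (n := ∞)
        (IsManifold.subset_maximalAtlas he) u hu
    have h1 : ContMDiffWithinAt (𝓡 n) ((𝓡 n).prod 𝓘(ℝ)) ∞
      (fun w => Bundle.TotalSpace.mk' ℝ (E := Bundle.Trivial M ℝ) (e.symm w)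
        (g.inner (e.symm w) (frameMap e w x) (frameMap e w y))) e.target u := by
      apply ContMDiffWithinAt.clm_bundle_apply₂ (F₁ := Eucl n) (F₂ := Eucl n)
      · exact g.contMDiff.contMDiffAt.comp_contMDiffWithinAt u hu'
      · exact contMDiffOn_frameMap he x u hu
      · exact contMDiffOn_frameMap he y u hu
    simp only [Bundle.contMDiffWithinAt_totalSpace] at h1
    exact contMDiffWithinAt_iff_contDiffWithinAt.1 h1.2
  pos := fun u hu => by
    refine ⟨fun x y => g.symm _ _ _, fun x hx => g.pos _ _ fun h => hx ?_⟩
    have h1 := congrArg (coordMap e (e.symm u)) h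
    rw [frameMap_eq he hu] at h1
    rwa [coordMap_frameAt he (e.map_target hu), map_zero] at h1

end Charts

section Charts

variable {n : ℕ} {M : Type*} [TopologicalSpace M] [ChartedSpace (EuclideanSpace ℝ (Fin n)) M]
  [IsManifold (𝓡 n) ∞ M] {e e' : Chart n M} (he : e ∈ atlas (EuclideanSpace ℝ (Fin n)) M)
  (he' : e' ∈ atlas (EuclideanSpace ℝ (Fin n)) M) {x : M}

include he in
theorem metricForm_chart (g : Metric n M) (hx : x ∈ e.source) (v w : Eucl n) :
    metricForm g e (e x) v w = g.inner x (frameAt e x v) (frameAt e x w) := by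
  rw [metricForm_apply, frameMap_eq he (e.map_source hx), e.left_inv hx]

include he in
theorem oneForm_chart (θ : TensorField n 1 M) (hx : x ∈ e.source) (v : Eucl n) :
    oneForm θ e (e x) v = θ x (fun _ => frameAt e x v) := by
  rw [oneForm_apply, frameMap_eq he (e.map_source hx), e.left_inv hx]

include he in
theorem comp_chart {r : ℕ} (T : TensorField n r M) (hx : x ∈ e.source) (I : Fin r → Fin n) :
    comp e T (e x) I = T x (fun a => frameAt e x (EuclideanSpace.single (I a) (1 : ℝ))) := by
  simp only [comp, frame_eq]
  rw [frameMap_eq he (e.map_source hx), e.left_inv hx]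

theorem mem_overlap (hx : x ∈ e.source) (hx' : x ∈ e'.source) : e x ∈ overlap e e' :=
  ⟨e.map_source hx, by rwa [mem_preimage, e.left_inv hx]⟩

include he he' in
/-- Coordinate changes are isometries. -/
theorem transition (g : Metric n M) : Transition (overlap e e') e'.target
    (fun u => e' (e.symm u)) (metricForm g e) (metricForm g e') where
  source := ⟨isOpen_overlap e e', (metricOn he g).smooth.mono inter_subset_left,
    fun u hu => (metricOn he g).pos u hu.1⟩
  target := metricOn he' g
  maps := fun u hu => e'.map_source hu.2
  smooth := contDiffOn_overlap he he'
  bij := fun u hu => bijective_overlap he he' hu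
  metric := fun u hu v w => by
    have hx : e.symm u ∈ e.source := e.map_target hu.1
    have h := metricForm_chart he g hx v w
    have h2 := frameAt_comp he he' hx hu.2
    rw [e.right_inv hu.1] at h h2
    rw [h, metricForm_chart he' g hu.2, h2, h2]

include he he' in
theorem pull_oneForm (θ : TensorField n 1 M) :
    Pull₁ (overlap e e') (fun u => e' (e.symm u)) (oneForm θ e) (oneForm θ e') := by
  intro u hu v
  have hx : e.symm u ∈ e.source := e.map_target hu.1
  have h := oneForm_chart he θ hx v
  have h2 := frameAt_comp he he' hx hu.2
  rw [e.right_inv hu.1] at h h2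
  rw [h, oneForm_chart he' θ hu.2, h2]

theorem mem_smoothTensor_one_iff {θ : TensorField n 1 M} : θ ∈ smoothTensor n M 1 ↔
    ∀ e ∈ atlas (EuclideanSpace ℝ (Fin n)) M, ContDiffOn ℝ ∞ (oneForm θ e) e.target := by
  constructor
  · intro h e he
    refine contDiffOn_clm_apply.2 fun y => ?_
    have h1 : ∀ i, ContDiffOn ℝ ∞ (fun u => oneForm θ e u (EuclideanSpace.single i (1 : ℝ)))
        e.target := fun i => by
      have := h e he (fun _ => i)
      rwa [comp_eq_oneForm] at this
    have h2 : ContDiffOn ℝ ∞ (fun u => ∑ i, y i • oneForm θ e u (EuclideanSpace.single i (1 : ℝ)))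
        e.target := ContDiffOn.sum fun i _ => (h1 i).const_smul (y i)
    exact h2.congr fun u _ => (sum_apply_single _ _).symm
  · intro h e he I
    rw [comp_eq_oneForm]
    exact (h e he).clm_apply contDiffOn_const

theorem ofComp_apply {r : ℕ} (e : Chart n M) (x : M)
    (m : MultilinearMap ℝ (fun _ : Fin r => Eucl n) ℝ) (v : Fin r → TangentSpace (𝓡 n) x) :
    ofComp e x (fun I => m (fun a => EuclideanSpace.single (I a) (1 : ℝ))) v
      = m (fun a => coordMap e x (v a)) := by
  have h : (fun a => coordMap e x (v a))
      = fun a => ∑ i, (coordMap e x (v a)) i • EuclideanSpace.single i (1 : ℝ) :=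
    funext fun a => eq_sum_single _
  rw [h, m.map_sum, ofComp, sum_apply]
  refine Finset.sum_congr rfl fun I _ => ?_
  rw [m.map_smul_univ, smul_apply, smul_eq_mul, smul_eq_mul, mul_comm]
  congr 1

theorem chartAt_mem (x : M) :
    chartAt (EuclideanSpace ℝ (Fin n)) x ∈ atlas (EuclideanSpace ℝ (Fin n)) M :=
  chart_mem_atlas _ x

variable (g : Metric n M) {θ : TensorField n 1 M}

include he in
-- By naturality any chart around x may replace the preferred chart of the definition. Only with a
-- chart that stays fixed as x moves can `eisenhart g θ` be differentiated or integrated.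
theorem eisenhart_apply (hθ : θ ∈ smoothTensor n M 1) (hx : x ∈ e.source)
    (v : Fin 3 → TangentSpace (𝓡 n) x) : eisenhart g θ x v
      = eisMultilinear n (metricForm g e) (oneForm θ e) (e x) (fun a => coordMap e x (v a)) := by
  set e₀ := chartAt (EuclideanSpace ℝ (Fin n)) x with he₀
  have h₀ : e₀ ∈ atlas (EuclideanSpace ℝ (Fin n)) M := chartAt_mem x
  have hx₀ : x ∈ e₀.source := mem_chart_source _ x
  have hs := mem_smoothTensor_one_iff.1 hθ
  have h1 : eisenhart g θ x v = eisMultilinear n (metricForm g e₀) (oneForm θ e₀) (e₀ x)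
      (fun a => coordMap e₀ x (v a)) := by
    rw [eisenhart, ← he₀, ← ofComp_apply e₀ x]
    congr 1
    congr 1
    funext I
    rw [← (metricOn h₀ g).eisenhart_eq (hs e₀ h₀) (e₀.map_source hx₀) I, metricComp_eq,
      comp_eq_oneForm]
  rw [h1]
  have h2 := (transition he h₀ g).eisLocal_eq n (pull_oneForm he h₀ θ)
    ((hs e he).mono inter_subset_left) (hs e₀ h₀) (mem_overlap hx hx₀)
    (coordMap e x (v 0)) (coordMap e x (v 1)) (coordMap e x (v 2))
  simp only [← coordMap_comp he h₀ hx hx₀, e.left_inv hx] at h2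
  exact h2.symm

include he in
theorem comp_eisenhart (hθ : θ ∈ smoothTensor n M 1) {u : Eucl n} (hu : u ∈ e.target)
    (I : Fin 3 → Fin n) : comp e (eisenhart g θ) u I
      = eisMultilinear n (metricForm g e) (oneForm θ e) u
        (fun a => EuclideanSpace.single (I a) (1 : ℝ)) := by
  have hx := e.map_target hu
  have h := comp_chart he (eisenhart g θ) hx I
  rw [eisenhart_apply he g hθ hx] at h
  simp only [coordMap_frameAt he hx] at h
  rwa [e.right_inv hu] at h

theorem eisenhart_mem_smoothTensor (hθ : θ ∈ smoothTensor n M 1) :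
    eisenhart g θ ∈ smoothTensor n M 3 := by
  intro e he I
  have h := (metricOn he g).smooth_eisLocal (n := n) (mem_smoothTensor_one_iff.1 hθ e he)
    (EuclideanSpace.single (I 0) (1 : ℝ)) (EuclideanSpace.single (I 1) (1 : ℝ))
    (EuclideanSpace.single (I 2) (1 : ℝ))
  exact h.congr fun u hu => comp_eisenhart he g hθ hu I

/-! ### Contractions -/

/-- The basis `tbasis` of a tangent space. -/
def tanBasis (x : M) : Module.Basis (Fin n) ℝ (TangentSpace (𝓡 n) x) := stdBasis n

theorem tanBasis_apply (x : M) (i : Fin n) : tanBasis x i = tbasis x i := stdBasis_apply i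

theorem gramInv_eq (x : M) : gramInv g x = (gramOf (g.inner x).toLinearMap₁₂ (tanBasis x))⁻¹ := by
  rw [gramInv]
  congr 1
  ext i j
  simp only [gramOf, tanBasis_apply]
  rfl

theorem tensorInner_eq {r : ℕ} (x : M) (S T : CovTensor n r x) :
    tensorInner g x S T = contraction (g.inner x).toLinearMap₁₂ (tanBasis x) S T := by
  simp only [tensorInner, contraction, gramInv_eq, tanBasis_apply]

/-- The coordinate frame at a point, as a basis. -/
def frameBasis (he : e ∈ atlas (EuclideanSpace ℝ (Fin n)) M) (hx : x ∈ e.source) :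
    Module.Basis (Fin n) ℝ (TangentSpace (𝓡 n) x) :=
  (stdBasis n).map (coordEquiv he hx).symm.toLinearEquiv

theorem frameBasis_apply (hx : x ∈ e.source) (i : Fin n) :
    frameBasis he hx i = frameAt e x (EuclideanSpace.single i (1 : ℝ)) := by
  rw [frameBasis, Module.Basis.map_apply, stdBasis_apply, frameAt_eq he hx]; rfl

theorem gramOf_frameBasis (hx : x ∈ e.source) :
    gramOf (g.inner x).toLinearMap₁₂ (frameBasis he hx) = formMatrix (metricForm g e (e x)) := by
  ext i j
  simp only [gramOf, frameBasis_apply, formMatrix, Matrix.of_apply, metricForm_chart he g hx]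
  rfl

include he in
theorem tensorInner_chart {r : ℕ} (S T : TensorField n r M) (hx : x ∈ e.source) :
    tensorInner g x (S x) (T x) = ∑ I : Fin r → Fin n, ∑ J : Fin r → Fin n,
      (∏ a, (formMatrix (metricForm g e (e x)))⁻¹ (I a) (J a)) * comp e S (e x) I
        * comp e T (e x) J := by
  rw [tensorInner_eq, ← contraction_basis_change _ _ (frameBasis he hx), contraction]
  simp only [gramOf_frameBasis, frameBasis_apply, comp_chart he _ hx]

include he in
theorem smooth_tensorInner {r : ℕ} {S T : TensorField n r M} (hS : S ∈ smoothTensor n M r)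
    (hT : T ∈ smoothTensor n M r) :
    ContDiffOn ℝ ∞ (fun u => tensorInner g (e.symm u) (S (e.symm u)) (T (e.symm u))) e.target := by
  have h1 : ∀ i j, ContDiffOn ℝ ∞ (fun u => (formMatrix (metricForm g e u))⁻¹ i j) e.target :=
    contDiffOn_matrix_inv (fun i j => ((metricOn he g).smooth.clm_apply contDiffOn_const).clm_apply
      contDiffOn_const) fun u hu => (formMatrix_det_pos ((metricOn he g).pos u hu)).ne'
  have h2 : ContDiffOn ℝ ∞ (fun u => ∑ I : Fin r → Fin n, ∑ J : Fin r → Fin n,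
      (∏ a, (formMatrix (metricForm g e u))⁻¹ (I a) (J a)) * comp e S u I
        * comp e T u J) e.target :=
    ContDiffOn.sum fun I _ => ContDiffOn.sum fun J _ =>
      ((contDiffOn_prod fun a _ => h1 _ _).mul (hS e he I)).mul (hT e he J)
  refine h2.congr fun u hu => ?_
  rw [tensorInner_chart he g S T (e.map_target hu), e.right_inv hu]

theorem continuous_of_charts {f : M → ℝ} (h : ∀ e ∈ atlas (EuclideanSpace ℝ (Fin n)) M,
    ContinuousOn (fun u => f (e.symm u)) e.target) : Continuous f := by
  refine continuous_iff_continuousAt.2 fun x => ?_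
  set e := chartAt (EuclideanSpace ℝ (Fin n)) x
  have hx : x ∈ e.source := mem_chart_source _ x
  have h1 : ContinuousAt (fun u => f (e.symm u)) (e x) :=
    (h e (chartAt_mem x)).continuousAt (e.open_target.mem_nhds (e.map_source hx))
  have h2 : ContinuousAt (fun y => f (e.symm (e y))) x :=
    ContinuousAt.comp (f := e) h1 (e.continuousAt hx)
  refine h2.congr ?_
  filter_upwards [e.open_source.mem_nhds hx] with y hy
  rw [e.left_inv hy]

theorem continuous_tensorInner {r : ℕ} {S T : TensorField n r M} (hS : S ∈ smoothTensor n M r)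
    (hT : T ∈ smoothTensor n M r) : Continuous fun x => tensorInner g x (S x) (T x) :=
  continuous_of_charts fun _ he => (smooth_tensorInner he g hS hT).continuousOn

theorem tensorInner_comm {r : ℕ} (x : M) (S T : CovTensor n r x) :
    tensorInner g x S T = tensorInner g x T S := by
  rw [tensorInner_eq, tensorInner_eq, contraction_comm fun v w => (posForm_inner g x).symm v w]

theorem tensorInner_self_nonneg {r : ℕ} (x : M) (S : CovTensor n r x) :
    0 ≤ tensorInner g x S S := by
  rw [tensorInner_eq]; exact (posForm_inner g x).contraction_self_nonneg _ _

theorem eq_zero_of_tensorInner {r : ℕ} {x : M} {S : CovTensor n r x}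
    (h : tensorInner g x S S = 0) : S = 0 := by
  rw [tensorInner_eq] at h; exact (posForm_inner g x).contraction_self_eq_zero _ h

/-- A `g`-orthonormal basis in coordinates. -/
theorem exists_orthonormal_chart (hx : x ∈ e.source) :
    ∃ b : Module.Basis (Fin n) ℝ (TangentSpace (𝓡 n) x),
      (∀ i j, (g.inner x).toLinearMap₁₂ (b i) (b j) = if i = j then 1 else 0) ∧
      ∀ i j, (metricForm g e (e x)).toLinearMap₁₂
        (b.map (coordEquiv he hx).toLinearEquiv i) (b.map (coordEquiv he hx).toLinearEquiv j)
          = if i = j then 1 else 0 := by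
  obtain ⟨b, hb⟩ := (posForm_inner g x).exists_orthonormal (tanBasis x)
  refine ⟨b, hb, fun i j => ?_⟩
  rw [← hb i j]
  have h1 : ∀ i, b.map (coordEquiv he hx).toLinearEquiv i = coordMap e x (b i) := fun i => rfl
  rw [h1, h1]
  change metricForm g e (e x) _ _ = _
  rw [metricForm_chart he g hx, frameAt_coordMap he hx, frameAt_coordMap he hx]
  rfl

theorem update_vec_one {V : Type*} (v y z a : V) :
    Function.update ![v, y, z] 1 a = ![v, a, z] := by
  funext i; fin_cases i <;> rfl

theorem update_vec_two {V : Type*} (v y z a : V) :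
    Function.update ![v, y, z] 2 a = ![v, y, a] := by
  funext i; fin_cases i <;> rfl

theorem eisenhart_mem (hθ : θ ∈ smoothTensor n M 1) : eisenhart g θ ∈ smoothSymTraceFree g := by
  refine ⟨eisenhart_mem_smoothTensor g hθ, fun x v w z => ?_, fun x v => ?_⟩
  · set e := chartAt (EuclideanSpace ℝ (Fin n)) x
    have he : e ∈ atlas (EuclideanSpace ℝ (Fin n)) M := chartAt_mem x
    have hx : x ∈ e.source := mem_chart_source _ x
    rw [eisenhart_apply he g hθ hx, eisenhart_apply he g hθ hx]
    exact (metricOn he g).eisLocal_symm n (mem_smoothTensor_one_iff.1 hθ e he)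
      (e.map_source hx) _ _ _
  · set e := chartAt (EuclideanSpace ℝ (Fin n)) x
    have he : e ∈ atlas (EuclideanSpace ℝ (Fin n)) M := chartAt_mem x
    have hx : x ∈ e.source := mem_chart_source _ x
    obtain ⟨b, hb, hb'⟩ := exists_orthonormal_chart he g hx
    -- The bilinear form in the last two arguments: its trace in the standard basis, which the
    -- definition asks for, equals the trace in the orthonormal basis, where `trace_eisLocal`
    -- applies.
    let C : TangentSpace (𝓡 n) x →ₗ[ℝ] TangentSpace (𝓡 n) x →ₗ[ℝ] ℝ :=
      LinearMap.mk₂ ℝ (fun y z => eisenhart g θ x ![v, y, z])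
        (fun y y' z => by
          have := (eisenhart g θ x).map_update_add ![v, y, z] 1 y y'
          rwa [update_vec_one, update_vec_one, update_vec_one] at this)
        (fun c y z => by
          have := (eisenhart g θ x).map_update_smul ![v, y, z] 1 c y
          rwa [update_vec_one, update_vec_one] at this)
        (fun y z z' => by
          have := (eisenhart g θ x).map_update_add ![v, y, z] 2 z z'
          rwa [update_vec_two, update_vec_two, update_vec_two] at this)
        (fun c y z => by
          have := (eisenhart g θ x).map_update_smul ![v, y, z] 2 c z
          rwa [update_vec_two, update_vec_two] at this)
    have h1 := traceIn_basis_change (g.inner x).toLinearMap₁₂ C b (tanBasis x)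
    rw [traceIn_orthonormal _ hb, traceIn, ← gramInv_eq] at h1
    simp only [tanBasis_apply] at h1
    refine h1.trans ?_
    rw [← (metricOn he g).trace_eisLocal (mem_smoothTensor_one_iff.1 hθ e he) (e.map_source hx) hb'
      (coordMap e x v)]
    exact Finset.sum_congr rfl fun i _ => eisenhart_apply he g hθ hx _

end Charts

/-! ### The Riemannian volume -/

/-- The density `√(det g_ij)`. -/
def volDensity {n : ℕ} (G : Eucl n → Form (Eucl n)) (u : Eucl n) : ℝ :=
  Real.sqrt (formMatrix (G u)).det

theorem volDensity_nonneg {n : ℕ} (G : Eucl n → Form (Eucl n)) (u : Eucl n) :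
    0 ≤ volDensity G u := Real.sqrt_nonneg _

namespace MetricOn

variable {n : ℕ} {Ω : Set (Eucl n)} {G : Eucl n → Form (Eucl n)} (h : MetricOn Ω G)
include h

theorem volDensity_pos {u : Eucl n} (hu : u ∈ Ω) : 0 < volDensity G u :=
  Real.sqrt_pos.2 (formMatrix_det_pos (h.pos u hu))

theorem smooth_det : ContDiffOn ℝ ∞ (fun u => (formMatrix (G u)).det) Ω :=
  contDiffOn_matrix_det fun _ _ => (h.smooth.clm_apply contDiffOn_const).clm_apply contDiffOn_const

theorem smooth_volDensity : ContDiffOn ℝ ∞ (volDensity G) Ω :=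
  h.smooth_det.sqrt fun u hu => (formMatrix_det_pos (h.pos u hu)).ne'

end MetricOn

/-- The matrix of a pulled back form. -/
theorem formMatrix_pullback_det {n : ℕ} {B B' : Form (Eucl n)} {P : Eucl n →L[ℝ] Eucl n}
    (h : ∀ v w, B v w = B' (P v) (P w)) :
    (formMatrix B).det = P.det ^ 2 * (formMatrix B').det := by
  set A := LinearMap.toMatrix (stdBasis n) (stdBasis n) (P : Eucl n →ₗ[ℝ] Eucl n) with hA
  have h1 : ∀ k i, A k i = P (EuclideanSpace.single i 1) k := fun k i => by
    rw [hA, LinearMap.toMatrix_apply, stdBasis_repr, stdBasis_apply]; rfl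
  have h2 : formMatrix B = A.transpose * formMatrix B' * A := by
    ext i j
    simp only [Matrix.mul_apply, Matrix.transpose_apply, h1, formMatrix, Matrix.of_apply]
    rw [h]
    have h4 := eq_sum_single (P (EuclideanSpace.single i 1))
    have h5 := eq_sum_single (P (EuclideanSpace.single j 1))
    calc B' (P (EuclideanSpace.single i 1)) (P (EuclideanSpace.single j 1))
        = B' (∑ k, P (EuclideanSpace.single i 1) k • EuclideanSpace.single k (1 : ℝ))
          (∑ l, P (EuclideanSpace.single j 1) l • EuclideanSpace.single l (1 : ℝ)) := by
          rw [← h4, ← h5]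
      _ = _ := by
          simp only [map_sum, map_smul, sum_apply, smul_apply, smul_eq_mul, Finset.mul_sum,
            Finset.sum_mul]
          refine Finset.sum_congr rfl fun l _ => Finset.sum_congr rfl fun k _ => ?_
          ring
  have h3 : A.det = P.det := by
    rw [hA, LinearMap.det_toMatrix]
  rw [h2, Matrix.det_mul, Matrix.det_mul, Matrix.det_transpose, h3]
  ring

section Volume

variable {n : ℕ} {M : Type*} [TopologicalSpace M] [ChartedSpace (EuclideanSpace ℝ (Fin n)) M]
  [IsManifold (𝓡 n) ∞ M] {e e' : Chart n M} (he : e ∈ atlas (EuclideanSpace ℝ (Fin n)) M)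
  (he' : e' ∈ atlas (EuclideanSpace ℝ (Fin n)) M) [MeasurableSpace M] [BorelSpace M]
  (g : Metric n M)

theorem measurableSet_target_preimage (e : Chart n M) {A : Set M} (hA : MeasurableSet A) :
    MeasurableSet (e.symm ⁻¹' A ∩ e.target) := by
  have h1 : Measurable (e.target.domRestrict e.symm) := e.continuousOn_symm.domRestrict.measurable
  have h2 := e.open_target.measurableSet.subtype_image (h1 hA)
  have h3 : (Subtype.val '' (e.target.domRestrict e.symm ⁻¹' A)) = e.symm ⁻¹' A ∩ e.target := by
    ext u
    constructor
    · rintro ⟨w, hw, rfl⟩; exact ⟨hw, w.2⟩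
    · rintro ⟨hu, hu'⟩; exact ⟨⟨u, hu'⟩, hu, rfl⟩
  rwa [h3] at h2

include he in
theorem aemeasurable_density : AEMeasurable
    (fun u => ENNReal.ofReal (volDensity (metricForm g e) u)) (volume.restrict e.target) :=
  ((metricOn he g).smooth_volDensity.continuousOn.aemeasurable
    e.open_target.measurableSet).ennreal_ofReal

theorem aemeasurable_symm (e : Chart n M) {f : Eucl n → ENNReal} :
    AEMeasurable e.symm ((volume.restrict e.target).withDensity f) :=
  (e.continuousOn_symm.aemeasurable e.open_target.measurableSet).mono_ac
    (withDensity_absolutelyContinuous _ _)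

theorem chartVolume_apply (e : Chart n M) {A : Set M} (hA : MeasurableSet A) :
    chartVolume g e A = ∫⁻ u in e.symm ⁻¹' A ∩ e.target,
      ENNReal.ofReal (volDensity (metricForm g e) u) := by
  rw [chartVolume, Measure.map_apply_of_aemeasurable (aemeasurable_symm e) hA,
    withDensity_apply', Measure.restrict_restrict' e.open_target.measurableSet]
  rfl

include he he' in
/-- The change of variables formula. -/
theorem chartVolume_eq {A : Set M} (hA : MeasurableSet A) (h : A ⊆ e.source) (h' : A ⊆ e'.source) :
    chartVolume g e A = chartVolume g e' A := by
  rw [chartVolume_apply g e hA, chartVolume_apply g e' hA]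
  have h1 : e'.symm ⁻¹' A ∩ e'.target
      = (fun u => e' (e.symm u)) '' (e.symm ⁻¹' A ∩ e.target) := by
    ext w
    constructor
    · rintro ⟨hw, hw'⟩
      refine ⟨e (e'.symm w), ⟨?_, e.map_source (h hw)⟩, ?_⟩
      · rwa [mem_preimage, e.left_inv (h hw)]
      · simp only [e.left_inv (h hw), e'.right_inv hw']
    · rintro ⟨u, ⟨hu, hu'⟩, rfl⟩
      exact ⟨by simpa only [mem_preimage, e'.left_inv (h' hu)] using hu, e'.map_source (h' hu)⟩
  have h2 : ∀ u ∈ e.symm ⁻¹' A ∩ e.target, u ∈ overlap e e' := fun u hu => ⟨hu.2, h' hu.1⟩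
  have T := transition he he' g
  rw [h1, lintegral_image_eq_lintegral_abs_det_fderiv_mul volume
    (measurableSet_target_preimage e hA)
    (fun u hu => (T.differentiableAt (h2 u hu)).hasFDerivAt.hasFDerivWithinAt)
    (fun u hu w hw hh => by
      have h3 := congrArg e'.symm hh
      simp only [e'.left_inv (h' hu.1), e'.left_inv (h' hw.1)] at h3
      exact e.symm.injOn hu.2 hw.2 h3)]
  -- The determinant of the metric picks up the square of the Jacobian determinant, and its square
  -- root is the factor in the change of variables.
  refine setLIntegral_congr_fun (measurableSet_target_preimage e hA) fun u hu => ?_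
  rw [← ENNReal.ofReal_mul (abs_nonneg _), volDensity, volDensity,
    formMatrix_pullback_det (T.metric u (h2 u hu)), Real.sqrt_mul (sq_nonneg _),
    Real.sqrt_sq_eq_abs]

variable [CompactSpace M] [Nonempty M]

include he in
-- On each piece of the gluing the chart of that piece may be replaced by `e`, and the disjoint
-- pieces exhaust M.
theorem vol_apply {A : Set M} (hA : MeasurableSet A) (h : A ⊆ e.source) :
    vol g A = chartVolume g e A := by
  set S : ℕ → Set M := fun i => (chartAt (EuclideanSpace ℝ (Fin n)) (chartSeq n M i)).source with hS
  have hm : ∀ k, MeasurableSet (disjointed S k) := fun k =>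
    MeasurableSet.disjointed (fun i => (chartAt (EuclideanSpace ℝ (Fin n))
      (chartSeq n M i)).open_source.measurableSet) k
  have h1 : ∀ k, chartVolume g (chartAt (EuclideanSpace ℝ (Fin n)) (chartSeq n M k))
      (A ∩ disjointed S k) = chartVolume g e (A ∩ disjointed S k) := fun k =>
    chartVolume_eq (chartAt_mem _) he g (hA.inter (hm k))
      (inter_subset_right.trans (disjointed_subset S k)) (inter_subset_left.trans h)
  rw [vol, Measure.sum_apply _ hA]
  simp only [Measure.restrict_apply hA]
  refine (tsum_congr h1).trans ?_
  rw [← measure_iUnion (fun i j hij => ((disjoint_disjointed S) hij).mono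
    inter_subset_right inter_subset_right) (fun k => hA.inter (hm k)), ← inter_iUnion,
    iUnion_disjointed]
  congr 1
  have h2 : ⋃ i, S i = univ := (exists_chart_cover n M).choose_spec
  rw [h2, inter_univ]

include he in
theorem vol_restrict : (vol g).restrict e.source = chartVolume g e := by
  ext A hA
  have hs := e.open_source.measurableSet
  rw [Measure.restrict_apply hA, vol_apply he g (hA.inter hs) inter_subset_right,
    chartVolume_apply g e hA, chartVolume_apply g e (hA.inter hs)]
  congr 2
  ext u
  constructor
  · rintro ⟨hu, hu'⟩; exact ⟨hu.1, hu'⟩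
  · rintro ⟨hu, hu'⟩; exact ⟨⟨hu, e.map_target hu'⟩, hu'⟩

/-- The density is integrable on compact subsets of a chart target, so the volume is locally finite,
and M is compact. -/
instance : IsFiniteMeasure (vol g) := by
  have : IsLocallyFiniteMeasure (vol g) := ⟨fun x => by
    set e := chartAt (EuclideanSpace ℝ (Fin n)) x
    have he : e ∈ atlas (EuclideanSpace ℝ (Fin n)) M := chartAt_mem x
    have hx : x ∈ e.source := mem_chart_source _ x
    obtain ⟨K, hK, hxK, hKt⟩ := exists_compact_subset e.open_target (e.map_source hx)
    have hA : IsOpen (e.source ∩ e ⁻¹' interior K) := e.isOpen_inter_preimage isOpen_interior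
    refine ⟨e.source ∩ e ⁻¹' interior K, hA.mem_nhds ⟨hx, hxK⟩, ?_⟩
    rw [vol_apply he g hA.measurableSet inter_subset_left, chartVolume_apply g e hA.measurableSet]
    have h1 : IntegrableOn (volDensity (metricForm g e)) K volume :=
      ((metricOn he g).smooth_volDensity.continuousOn.mono hKt).integrableOn_compact hK
    refine lt_of_le_of_lt (lintegral_mono_set fun u hu => ?_) h1.lintegral_lt_top
    have h2 := hu.1.2
    rw [mem_preimage, e.right_inv hu.2] at h2
    exact interior_subset h2⟩
  infer_instance

include he in
theorem integral_vol {f : M → ℝ} (hf : Continuous f) (h0 : ∀ x ∉ e.source, f x = 0) :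
    ∫ x, f x ∂(vol g) = ∫ u in e.target, volDensity (metricForm g e) u * f (e.symm u) := by
  rw [← setIntegral_eq_integral_of_forall_compl_eq_zero h0, vol_restrict he g, chartVolume,
    integral_map (aemeasurable_symm e) hf.aestronglyMeasurable]
  refine (integral_withDensity_eq_integral_toReal_smul₀ (aemeasurable_density he g)
    (ae_of_all _ fun _ => ENNReal.ofReal_lt_top) _).trans ?_
  refine integral_congr_ae (ae_of_all _ fun u => ?_)
  simp only [smul_eq_mul]
  rw [ENNReal.toReal_ofReal (volDensity_nonneg _ _)]

/-- The density is positive, so a nonempty open null set would give a nonempty open set of Lebesgue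
measure zero. This turns vanishing almost everywhere into vanishing, for continuous functions. -/
instance : (vol g).IsOpenPosMeasure := by
  refine ⟨fun U hU ⟨x, hxU⟩ h => ?_⟩
  set e := chartAt (EuclideanSpace ℝ (Fin n)) x
  have he : e ∈ atlas (EuclideanSpace ℝ (Fin n)) M := chartAt_mem x
  have hx : x ∈ e.source := mem_chart_source _ x
  have hm := (hU.inter e.open_source).measurableSet
  have h1 : vol g (U ∩ e.source) = 0 := measure_mono_null inter_subset_left h
  rw [vol_apply he g hm inter_subset_right, chartVolume_apply g e hm,
    lintegral_eq_zero_iff' ((aemeasurable_density he g).mono_measure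
      (Measure.restrict_mono_set _ inter_subset_right))] at h1
  have h2 := (ae_restrict_iff' (measurableSet_target_preimage e hm)).1 h1
  have ho : IsOpen (e.symm ⁻¹' (U ∩ e.source) ∩ e.target) := by
    rw [inter_comm]; exact e.isOpen_inter_preimage_symm (hU.inter e.open_source)
  refine (ho.measure_pos volume ⟨e x, ?_, e.map_source hx⟩).ne' ?_
  · rw [mem_preimage, e.left_inv hx]; exact ⟨hxU, hx⟩
  · refine measure_mono_null (fun u hu => ?_) (ae_iff.1 h2)
    simp only [mem_ofPred_eq, Classical.not_imp]
    exact ⟨hu, (ENNReal.ofReal_pos.2 ((metricOn he g).volDensity_pos hu.2)).ne'⟩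

end Volume

/-! ### The divergence theorem -/

/-- The determinant is multilinear in the rows, and replacing row i of the identity by w gives
determinant w i; Cramer's map at the identity records this. -/
theorem fderiv_det_of_eq_one {n : ℕ} {E : Type*} [NormedAddCommGroup E] [NormedSpace ℝ E]
    {A : E → Matrix (Fin n) (Fin n) ℝ} {u z : E} (hA : ∀ i j, DifferentiableAt ℝ (fun w => A w i j) u)
    (h1 : A u = 1) :
    fderiv ℝ (fun w => (A w).det) u z = ∑ i, fderiv ℝ (fun w => A w i i) u z := by
  let f : ContinuousMultilinearMap ℝ (fun _ : Fin n => Fin n → ℝ) ℝ :=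
    ⟨(Matrix.detRowAlternating (R := ℝ) (n := Fin n)).toMultilinearMap, by
      exact Continuous.matrix_det (A := fun B : Fin n → Fin n → ℝ => Matrix.of B) continuous_id⟩
  have hd : ∀ B : Fin n → Fin n → ℝ, f B = (Matrix.of B).det := fun B => rfl
  have hAd : HasFDerivAt (fun w => (fun i j => A w i j : Fin n → Fin n → ℝ))
      (ContinuousLinearMap.pi fun i => ContinuousLinearMap.pi fun j =>
        fderiv ℝ (fun w => A w i j) u) u :=
    hasFDerivAt_pi.2 fun i => hasFDerivAt_pi.2 fun j => (hA i j).hasFDerivAt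
  have h2 := ((f.hasFDerivAt (fun i j => A u i j)).comp u hAd).fderiv
  have h3 : (⇑f ∘ fun w => (fun i j => A w i j : Fin n → Fin n → ℝ)) = fun w => (A w).det := rfl
  rw [h3] at h2
  rw [h2]
  simp only [ContinuousLinearMap.comp_apply, ContinuousMultilinearMap.linearDeriv_apply]
  refine Finset.sum_congr rfl fun i _ => ?_
  have h4 := congrArg (fun L => L (fun j => fderiv ℝ (fun w => A w i j) u z) i)
    (Matrix.cramer_one (n := Fin n) (α := ℝ))
  simp only [Module.End.one_apply] at h4
  rw [← h4, ← Matrix.transpose_one, Matrix.cramer_transpose_apply]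
  rw [hd, h1]
  rfl

namespace MetricOn

variable {n : ℕ} {Ω : Set (Eucl n)} {G : Eucl n → Form (Eucl n)} (h : MetricOn Ω G)
include h

/-- Multiplying by the fixed inverse matrix at u reduces to the derivative at the identity, which is
the metric trace of dG. By ∇g = 0 that trace is twice the trace of the connection. -/
theorem fderiv_det {u : Eucl n} (hu : u ∈ Ω) (z : Eucl n) :
    fderiv ℝ (fun w => (formMatrix (G w)).det) u z
      = 2 * (formMatrix (G u)).det * traceCLM (Eucl n) (gam G u z) := by
  set B := formMatrix (G u) with hB
  have hBd : 0 < B.det := formMatrix_det_pos (h.pos u hu)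
  have hent : ∀ i j, DifferentiableAt ℝ (fun w => formMatrix (G w) i j) u := fun i j =>
    ((h.differentiableAt hu).clm_apply (differentiableAt_const _)).clm_apply (differentiableAt_const _)
  have hentA : ∀ i j, DifferentiableAt ℝ (fun w => (B⁻¹ * formMatrix (G w)) i j) u := fun i j => by
    simp only [Matrix.mul_apply]
    exact DifferentiableAt.fun_sum fun k _ => (hent k j).const_mul _
  have h1 : (fun w => (formMatrix (G w)).det)
      = fun w => B.det * (B⁻¹ * formMatrix (G w)).det := by
    funext w
    rw [← Matrix.det_mul, Matrix.mul_nonsing_inv_cancel_left _ _ hBd.ne'.isUnit]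
  have h2 : fderiv ℝ (fun w => (B⁻¹ * formMatrix (G w)).det) u z
      = formTrace (G u) (fderiv ℝ G u z) := by
    rw [fderiv_det_of_eq_one hentA (Matrix.nonsing_inv_mul _ hBd.ne'.isUnit),
      formTrace_eq_sum (h.pos u hu)]
    refine Finset.sum_congr rfl fun i _ => ?_
    simp only [Matrix.mul_apply]
    rw [fderiv_fun_sum fun k _ => (hent k i).const_mul _, sum_apply]
    refine Finset.sum_congr rfl fun j _ => ?_
    rw [fderiv_const_mul (hent j i), smul_apply, smul_eq_mul]
    congr 1
    rw [h.fderiv_symm hu]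
    exact fderiv_apply_const₂ (h.differentiableAt hu) _ _ _
  have hdetd : DifferentiableAt ℝ (fun w => (B⁻¹ * formMatrix (G w)).det) u := by
    have h3 : (fun w => (B⁻¹ * formMatrix (G w)).det)
        = fun w => B.det⁻¹ * (formMatrix (G w)).det := by
      funext w; rw [Matrix.det_mul, Matrix.det_nonsing_inv, Ring.inverse_eq_inv']
    rw [h3]
    exact ((h.smooth_det.contDiffAt (h.mem_nhds hu)).differentiableAt (by simp)).const_mul _
  rw [h1, fderiv_const_mul hdetd, smul_apply, smul_eq_mul, h2]
  obtain ⟨b, hb⟩ := (h.pos u hu).exists_orthonormal (stdBasis n)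
  rw [formTrace_orthonormal (h.pos u hu) _ hb, traceCLM_orthonormal _ hb]
  have h4 : ∀ i, fderiv ℝ G u z (b i) (b i) = 2 * G u (gam G u z (b i)) (b i) := fun i => by
    rw [h.fderiv_metric hu, h.symm hu (b i)]; ring
  simp only [h4, ← Finset.mul_sum]
  ring

theorem fderiv_volDensity {u : Eucl n} (hu : u ∈ Ω) (z : Eucl n) :
    fderiv ℝ (volDensity G) u z = volDensity G u * traceCLM (Eucl n) (gam G u z) := by
  have hp := formMatrix_det_pos (h.pos u hu)
  have hd : DifferentiableAt ℝ (fun w => (formMatrix (G w)).det) u :=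
    (h.smooth_det.contDiffAt (h.mem_nhds hu)).differentiableAt (by simp)
  have h1 : fderiv ℝ (volDensity G) u = _ := (hd.hasFDerivAt.sqrt hp.ne').fderiv
  have h2 := Real.mul_self_sqrt hp.le
  rw [h1, smul_apply, smul_eq_mul, h.fderiv_det hu, volDensity]
  have h3 : Real.sqrt (formMatrix (G u)).det ≠ 0 := (Real.sqrt_pos.2 hp).ne'
  field_simp
  rw [sq, h2]

theorem diverg_eq_trace {θ : Eucl n → Eucl n →L[ℝ] ℝ} (hθ : ContDiffOn ℝ ∞ θ Ω) {u : Eucl n}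
    (hu : u ∈ Ω) : diverg G θ u
      = traceCLM (Eucl n) (fderiv ℝ (sharp G θ) u) + traceCLM (Eucl n) (gam G u (sharp G θ u)) := by
  obtain ⟨b, hb⟩ := (h.pos u hu).exists_orthonormal (stdBasis n)
  rw [diverg, formTrace_orthonormal (h.pos u hu) _ hb, traceCLM_orthonormal _ hb,
    traceCLM_orthonormal _ hb, ← Finset.sum_add_distrib]
  refine Finset.sum_congr rfl fun i _ => ?_
  rw [h.nabla₁_eq_sharp hθ hu, map_add, add_apply, h.gam_symm hu (b i)]

/-- The classical formula √det g · div ξ = ∑ ∂_i (√det g ξ^i): differentiating the density supplies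
exactly the connection term of the divergence. It reduces the divergence theorem to Lebesgue
measure. -/
theorem trace_fderiv_density_smul {θ : Eucl n → Eucl n →L[ℝ] ℝ} (hθ : ContDiffOn ℝ ∞ θ Ω)
    {u : Eucl n} (hu : u ∈ Ω) :
    traceCLM (Eucl n) (fderiv ℝ (fun w => volDensity G w • sharp G θ w) u)
      = volDensity G u * diverg G θ u := by
  have hX : DifferentiableAt ℝ (sharp G θ) u :=
    ((h.smooth_sharp hθ).contDiffAt (h.mem_nhds hu)).differentiableAt (by simp)
  have hv : DifferentiableAt ℝ (volDensity G) u :=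
    (h.smooth_volDensity.contDiffAt (h.mem_nhds hu)).differentiableAt (by simp)
  rw [fderiv_fun_smul hv hX, map_add, map_smul, h.diverg_eq_trace hθ hu, smul_eq_mul, mul_add,
    add_right_inj, ← h.fderiv_volDensity hu, traceCLM_apply _ (stdBasis n)]
  simp only [stdBasis_repr, stdBasis_apply, ContinuousLinearMap.smulRight_apply]
  conv_rhs => rw [eq_sum_single (sharp G θ u), map_sum]
  simp [mul_comm]

end MetricOn

/-! ### Test functions and integration by parts -/

/-- Test functions on `Ω`: smooth, with compact support in `Ω`. -/
structure IsTest {E F : Type*} [NormedAddCommGroup E] [NormedSpace ℝ E] [NormedAddCommGroup F]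
    [NormedSpace ℝ F] (Ω : Set E) (f : E → F) : Prop where
  smooth : ContDiff ℝ ∞ f
  compact : HasCompactSupport f
  supp : tsupport f ⊆ Ω

namespace IsTest

variable {E F : Type*} [NormedAddCommGroup E] [NormedSpace ℝ E] [NormedAddCommGroup F]
  [NormedSpace ℝ F] {Ω : Set E} {f : E → F}

theorem of_contDiffOn (hf : ContDiffOn ℝ ∞ f Ω) (hΩ : IsOpen Ω) {K : Set E} (hK : IsCompact K)
    (hKΩ : K ⊆ Ω) (h0 : ∀ u ∉ K, f u = 0) : IsTest Ω f := by
  have hs : tsupport f ⊆ K := closure_minimal (fun u hu => by_contra fun h => hu (h0 u h)) hK.isClosed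
  refine ⟨contDiff_iff_contDiffAt.2 fun u => ?_, hK.of_isClosed_subset (isClosed_tsupport f) hs,
    hs.trans hKΩ⟩
  by_cases hu : u ∈ K
  · exact hf.contDiffAt (hΩ.mem_nhds (hKΩ hu))
  · have h1 : f =ᶠ[𝓝 u] fun _ => 0 := by
      filter_upwards [hK.isClosed.isOpen_compl.mem_nhds hu] with w hw using h0 w hw
    exact contDiffAt_const.congr_of_eventuallyEq h1

theorem of_indicator (hf : ContDiffOn ℝ ∞ f Ω) (hΩ : IsOpen Ω) {K : Set E} (hK : IsCompact K)
    (hKΩ : K ⊆ Ω) (h0 : ∀ u ∈ Ω, u ∉ K → f u = 0) : IsTest Ω (Ω.indicator f) := by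
  refine of_contDiffOn (hf.congr fun u hu => indicator_of_mem hu f) hΩ hK hKΩ fun u hu => ?_
  by_cases h : u ∈ Ω
  · rw [indicator_of_mem h, h0 u h hu]
  · exact indicator_of_notMem h f

theorem eq_zero (hf : IsTest Ω f) {u : E} (hu : u ∉ Ω) : f u = 0 :=
  image_eq_zero_of_notMem_tsupport fun h => hu (hf.supp h)

theorem clm_apply {H : Type*} [NormedAddCommGroup H] [NormedSpace ℝ H] {A : E → F →L[ℝ] H}
    (hΩ : IsOpen Ω) (hA : ContDiffOn ℝ ∞ A Ω) (hf : IsTest Ω f) : IsTest Ω fun u => A u (f u) :=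
  of_contDiffOn (hA.clm_apply hf.smooth.contDiffOn) hΩ hf.compact hf.supp fun u hu => by
    rw [image_eq_zero_of_notMem_tsupport hu, map_zero]

theorem smul (hΩ : IsOpen Ω) {a : E → ℝ} (ha : ContDiffOn ℝ ∞ a Ω) (hf : IsTest Ω f) :
    IsTest Ω fun u => a u • f u :=
  of_contDiffOn (ha.smul hf.smooth.contDiffOn) hΩ hf.compact hf.supp fun u hu => by
    rw [image_eq_zero_of_notMem_tsupport hu, smul_zero]

theorem smul_right (hΩ : IsOpen Ω) {a : E → ℝ} {X : E → F} (hX : ContDiffOn ℝ ∞ X Ω)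
    (ha : IsTest Ω a) : IsTest Ω fun u => a u • X u :=
  of_contDiffOn (ha.smooth.contDiffOn.smul hX) hΩ ha.compact ha.supp fun u hu => by
    rw [image_eq_zero_of_notMem_tsupport hu, zero_smul]

theorem add (hΩ : IsOpen Ω) {f' : E → F} (hf : IsTest Ω f) (hf' : IsTest Ω f') :
    IsTest Ω fun u => f u + f' u :=
  of_contDiffOn (hf.smooth.add hf'.smooth).contDiffOn hΩ (hf.compact.isCompact.union
    hf'.compact.isCompact) (union_subset hf.supp hf'.supp) fun u hu => by
    rw [image_eq_zero_of_notMem_tsupport fun h => hu (Or.inl h),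
      image_eq_zero_of_notMem_tsupport fun h => hu (Or.inr h), add_zero]

theorem fderiv_apply (hΩ : IsOpen Ω) (hf : IsTest Ω f) (v : E) :
    IsTest Ω fun u => fderiv ℝ f u v := by
  refine of_contDiffOn ((hf.smooth.fderiv_right (m := ∞) (by simp)).clm_apply
    contDiff_const).contDiffOn hΩ hf.compact hf.supp fun u hu => ?_
  rw [image_eq_zero_of_notMem_tsupport (f := fderiv ℝ f) fun h => hu (tsupport_fderiv_subset ℝ h)]
  rfl

variable [MeasurableSpace E] [BorelSpace E] [FiniteDimensional ℝ E] {μ : Measure E}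
  [μ.IsAddHaarMeasure]

theorem integrable (hf : IsTest Ω f) : Integrable f μ :=
  hf.smooth.continuous.integrable_of_hasCompactSupport hf.compact

theorem setIntegral (hf : IsTest Ω f) : ∫ u in Ω, f u ∂μ = ∫ u, f u ∂μ :=
  setIntegral_eq_integral_of_forall_compl_eq_zero fun _ hu => hf.eq_zero hu

/-- Integration by parts against the constant function 1; only products with the test function have
to be integrable. -/
theorem integral_fderiv {f : E → ℝ} (hΩ : IsOpen Ω) (hf : IsTest Ω f) (v : E) :
    ∫ u, fderiv ℝ f u v ∂μ = 0 := by
  have h := integral_mul_fderiv_eq_neg_fderiv_mul_of_integrable (μ := μ) (f := fun _ : E => (1 : ℝ))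
    (g := f) (v := v) (by simp) (by simpa using (hf.fderiv_apply hΩ v).integrable)
    (by simpa using hf.integrable) (fun x _ => differentiableAt_const _)
    (fun x _ => hf.smooth.differentiable (by simp) x)
  simpa using h

end IsTest

theorem integral_trace_fderiv {n : ℕ} {Ω : Set (Eucl n)} {F : Eucl n → Eucl n} (hΩ : IsOpen Ω)
    (hF : IsTest Ω F) : ∫ u, traceCLM (Eucl n) (fderiv ℝ F u) = 0 := by
  have h1 : ∀ i : Fin n, IsTest Ω fun u => F u i := fun i =>
    hF.clm_apply (A := fun _ => (EuclideanSpace.proj i : Eucl n →L[ℝ] ℝ)) hΩ contDiffOn_const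
  have h2 : ∀ u, traceCLM (Eucl n) (fderiv ℝ F u)
      = ∑ i, fderiv ℝ (fun w => F w i) u (EuclideanSpace.single i (1 : ℝ)) := fun u => by
    rw [traceCLM_apply _ (stdBasis n)]
    refine Finset.sum_congr rfl fun i _ => ?_
    rw [stdBasis_repr, stdBasis_apply]
    have h3 := ((EuclideanSpace.proj i : Eucl n →L[ℝ] ℝ).hasFDerivAt.comp u
      (hF.smooth.differentiable (by simp) u).hasFDerivAt).fderiv
    exact (congrArg (fun L => L (EuclideanSpace.single i (1 : ℝ))) h3).symm
  simp only [h2]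
  rw [integral_finsetSum _ fun i _ => ((h1 i).fderiv_apply hΩ _).integrable]
  exact Finset.sum_eq_zero fun i _ => (h1 i).integral_fderiv hΩ _

theorem MetricOn.integral_diverg {n : ℕ} {Ω : Set (Eucl n)} {G : Eucl n → Form (Eucl n)}
    (h : MetricOn Ω G) {θ : Eucl n → Eucl n →L[ℝ] ℝ} (hθ : IsTest Ω θ) :
    ∫ u in Ω, volDensity G u * diverg G θ u = 0 := by
  have hF : IsTest Ω fun u => volDensity G u • sharp G θ u :=
    (hθ.clm_apply h.isOpen h.smooth_raise).smul h.isOpen h.smooth_volDensity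
  rw [setIntegral_congr_fun h.isOpen.measurableSet fun u hu =>
    (h.trace_fderiv_density_smul hθ.smooth.contDiffOn hu).symm,
    setIntegral_eq_integral_of_forall_compl_eq_zero, integral_trace_fderiv h.isOpen hF]
  intro u hu
  have h1 : fderiv ℝ (fun w => volDensity G w • sharp G θ w) u = 0 :=
    image_eq_zero_of_notMem_tsupport fun h' => hu (hF.supp (tsupport_fderiv_subset ℝ h'))
  rw [h1, map_zero]

/-! ### Locality and additivity of the divergence -/

theorem nabla₁_congr {E : Type*} [NormedAddCommGroup E] [NormedSpace ℝ E]
    {G : E → Form E} {θ θ' : E → E →L[ℝ] ℝ} {u : E}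
    (h : θ =ᶠ[𝓝 u] θ') : nabla₁ G θ u = nabla₁ G θ' u := by
  rw [nabla₁, nabla₁, h.fderiv_eq, h.eq_of_nhds]

theorem diverg_congr {E : Type*} [NormedAddCommGroup E] [NormedSpace ℝ E] [FiniteDimensional ℝ E]
    {G : E → Form E} {θ θ' : E → E →L[ℝ] ℝ} {u : E}
    (h : θ =ᶠ[𝓝 u] θ') : diverg G θ u = diverg G θ' u := by
  rw [diverg, diverg, nabla₁_congr h]

theorem diverg_sum {E : Type*} [NormedAddCommGroup E] [NormedSpace ℝ E] [FiniteDimensional ℝ E]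
    {ι : Type*} {t : Finset ι} {G : E → Form E} {θ : ι → E → E →L[ℝ] ℝ} {u : E}
    (h : ∀ k ∈ t, DifferentiableAt ℝ (θ k) u) :
    diverg G (fun w => ∑ k ∈ t, θ k w) u = ∑ k ∈ t, diverg G (θ k) u := by
  have h1 : nabla₁ G (fun w => ∑ k ∈ t, θ k w) u = ∑ k ∈ t, nabla₁ G (θ k) u := by
    ext z y
    simp only [sum_apply, nabla₁_apply, fderiv_fun_sum h, Finset.sum_sub_distrib]
  simp only [diverg, formTrace, h1]
  have h2 : (raise (G u)).comp (∑ k ∈ t, nabla₁ G (θ k) u)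
      = ∑ k ∈ t, (raise (G u)).comp (nabla₁ G (θ k) u) := by
    ext z; simp
  rw [h2, map_sum]

theorem diverg_zero {E : Type*} [NormedAddCommGroup E] [NormedSpace ℝ E] [FiniteDimensional ℝ E]
    {G : E → Form E} {u : E} : diverg G (fun _ => 0) u = 0 := by
  simpa using diverg_sum (t := (∅ : Finset ℕ)) (G := G) (θ := fun _ _ => 0) (u := u) (by simp)

/-! ### Partitions of unity and smooth fields of 1-forms -/

section Global

variable {n : ℕ} {M : Type*} [TopologicalSpace M] [ChartedSpace (EuclideanSpace ℝ (Fin n)) M]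
  [IsManifold (𝓡 n) ∞ M] {e e' : Chart n M} (he : e ∈ atlas (EuclideanSpace ℝ (Fin n)) M)
  (he' : e' ∈ atlas (EuclideanSpace ℝ (Fin n)) M)

variable (n M) in
/-- Smooth functions, in terms of charts. -/
def smoothFun : Set (M → ℝ) :=
  {f | ∀ e ∈ atlas (EuclideanSpace ℝ (Fin n)) M,
    ContDiffOn ℝ ∞ (fun u => f (e.symm u)) e.target}

variable (n M) in
theorem exists_partition [CompactSpace M] [T2Space M] : ∃ (t : Finset M) (ρ : M → M → ℝ),
    (∀ k, tsupport (ρ k) ⊆ (chartAt (EuclideanSpace ℝ (Fin n)) k).source) ∧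
    (∀ k, ρ k ∈ smoothFun n M) ∧ ∀ x, ∑ k ∈ t, ρ k x = 1 := by
  obtain ⟨f, hf⟩ := SmoothPartitionOfUnity.exists_isSubordinate_chartAt_source (𝓡 n) M
  have h1 := f.locallyFinite.finite_nonempty_of_compact
  refine ⟨h1.toFinset, fun k => f k, hf, fun k e he => ?_, fun x => ?_⟩
  · have h2 := contMDiffOn_symm_of_mem_maximalAtlas (I := 𝓡 n) (n := ∞)
      (IsManifold.subset_maximalAtlas he)
    exact contMDiffOn_iff_contDiffOn.1 ((f k).contMDiff.comp_contMDiffOn h2)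
  · rw [← f.sum_eq_one (mem_univ x)]
    refine (finsum_eq_sum_of_support_subset _ fun k hk => ?_).symm
    simp only [Finite.coe_toFinset]
    exact ⟨x, hk⟩

theorem oneForm_smul (a : M → ℝ) (W : TensorField n 1 M) (e : Chart n M) (u : Eucl n) :
    oneForm (fun x => a x • W x) e u = a (e.symm u) • oneForm W e u := by
  ext v; rfl

theorem oneForm_sum {ι : Type*} (t : Finset ι) (W : ι → TensorField n 1 M) (e : Chart n M)
    (u : Eucl n) : oneForm (fun x => ∑ k ∈ t, W k x) e u = ∑ k ∈ t, oneForm (W k) e u := by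
  ext v
  simp [oneForm_apply, sum_apply]

theorem smul_mem_smoothTensor {a : M → ℝ} (ha : a ∈ smoothFun n M) {W : TensorField n 1 M}
    (hW : W ∈ smoothTensor n M 1) : (fun x => a x • W x) ∈ smoothTensor n M 1 := by
  rw [mem_smoothTensor_one_iff] at hW ⊢
  intro e he
  exact ((ha e he).smul (hW e he)).congr fun u _ => oneForm_smul a W e u

theorem sum_mem_smoothTensor {ι : Type*} {t : Finset ι} {W : ι → TensorField n 1 M}
    (hW : ∀ k ∈ t, W k ∈ smoothTensor n M 1) :
    (fun x => ∑ k ∈ t, W k x) ∈ smoothTensor n M 1 := by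
  rw [mem_smoothTensor_one_iff]
  intro e he
  exact (ContDiffOn.sum fun k hk => mem_smoothTensor_one_iff.1 (hW k hk) e he).congr
    fun u _ => oneForm_sum t W e u

/-- Functions supported in the domain of a chart give test functions. -/
theorem isTest_indicator [CompactSpace M] {F : Type*} [NormedAddCommGroup F] [NormedSpace ℝ F]
    {f : Eucl n → F} (hf : ContDiffOn ℝ ∞ f e.target) {K : Set M} (hK : IsClosed K)
    (hKe : K ⊆ e.source) (h0 : ∀ u ∈ e.target, e.symm u ∉ K → f u = 0) :
    IsTest e.target (e.target.indicator f) := by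
  refine IsTest.of_indicator hf e.open_target
    (hK.isCompact.image_of_continuousOn (e.continuousOn.mono hKe))
    (image_subset_iff.2 fun x hx => e.map_source (hKe hx)) fun u hu h => h0 u hu fun h' => h ?_
  exact ⟨e.symm u, h', e.right_inv hu⟩

/-! ### The divergence of a field of 1-forms -/

variable (g : Metric n M)

/-- The divergence of (the vector field dual to) a field of 1-forms. -/
def divField (W : TensorField n 1 M) (x : M) : ℝ :=
  diverg (metricForm g (chartAt (EuclideanSpace ℝ (Fin n)) x))
    (oneForm W (chartAt (EuclideanSpace ℝ (Fin n)) x)) (chartAt (EuclideanSpace ℝ (Fin n)) x x)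

variable {W : TensorField n 1 M}

include he in
theorem divField_chart (hW : W ∈ smoothTensor n M 1) {x : M} (hx : x ∈ e.source) :
    divField g W x = diverg (metricForm g e) (oneForm W e) (e x) := by
  rw [mem_smoothTensor_one_iff] at hW
  have h₀ := chartAt_mem (n := n) x
  have hx₀ := mem_chart_source (EuclideanSpace ℝ (Fin n)) x
  have h := (transition he h₀ g).diverg_eq (pull_oneForm he h₀ W)
    ((hW e he).mono inter_subset_left) (hW _ h₀) (mem_overlap hx hx₀)
  simp only [e.left_inv hx] at h
  exact h.symm

theorem continuous_divField (hW : W ∈ smoothTensor n M 1) : Continuous (divField g W) :=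
  continuous_of_charts fun e he =>
    ((metricOn he g).smooth_diverg (mem_smoothTensor_one_iff.1 hW e he)).continuousOn.congr
      fun u hu => by
        rw [divField_chart he g hW (e.map_target hu), e.right_inv hu]

theorem divField_sum {ι : Type*} {t : Finset ι} {W : ι → TensorField n 1 M}
    (hW : ∀ k ∈ t, W k ∈ smoothTensor n M 1) (x : M) :
    divField g (fun x => ∑ k ∈ t, W k x) x = ∑ k ∈ t, divField g (W k) x := by
  have h₀ := chartAt_mem (n := n) x
  have hx₀ := mem_chart_source (EuclideanSpace ℝ (Fin n)) x
  have h1 : oneForm (fun x => ∑ k ∈ t, W k x) (chartAt (EuclideanSpace ℝ (Fin n)) x)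
      = fun u => ∑ k ∈ t, oneForm (W k) (chartAt (EuclideanSpace ℝ (Fin n)) x) u :=
    funext fun u => oneForm_sum t W _ u
  rw [divField, h1]
  refine diverg_sum fun k hk => ?_
  exact (((mem_smoothTensor_one_iff.1 (hW k hk)) _ h₀).contDiffAt ((chartAt _ x).open_target.mem_nhds
    ((chartAt _ x).map_source hx₀))).differentiableAt (by simp)

theorem divField_eq_zero {K : Set M} (hK : IsClosed K) (hWK : ∀ y ∉ K, W y = 0) {x : M}
    (hx : x ∉ K) : divField g W x = 0 := by
  set e := chartAt (EuclideanSpace ℝ (Fin n)) x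
  have hx₀ : x ∈ e.source := mem_chart_source _ x
  have h1 : oneForm W e =ᶠ[𝓝 (e x)] fun _ => 0 := by
    have h2 := e.isOpen_inter_preimage_symm hK.isOpen_compl
    filter_upwards [h2.mem_nhds ⟨e.map_source hx₀, by
      rw [mem_preimage, e.left_inv hx₀]; exact hx⟩] with u hu
    ext v
    rw [oneForm_apply, hWK _ hu.2]
    rfl
  rw [divField, diverg_congr h1, diverg_zero]

variable [MeasurableSpace M] [BorelSpace M] [CompactSpace M] [Nonempty M]

theorem integrable_of_continuous {f : M → ℝ} (hf : Continuous f) : Integrable f (vol g) :=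
  hf.integrable_of_hasCompactSupport (HasCompactSupport.of_compactSpace f)

include he in
theorem integral_divField_of_support (hW : W ∈ smoothTensor n M 1) {K : Set M} (hK : IsClosed K)
    (hKe : K ⊆ e.source) (hWK : ∀ y ∉ K, W y = 0) : ∫ x, divField g W x ∂(vol g) = 0 := by
  have hs := mem_smoothTensor_one_iff.1 hW e he
  have hT : IsTest e.target (e.target.indicator (oneForm W e)) :=
    isTest_indicator hs hK hKe fun u hu h => by
      ext v
      rw [oneForm_apply, hWK _ h]
      rfl
  rw [integral_vol he g (continuous_divField g hW) fun x hx =>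
    divField_eq_zero g hK hWK fun h => hx (hKe h),
    ← (metricOn he g).integral_diverg hT]
  refine setIntegral_congr_fun e.open_target.measurableSet fun u hu => ?_
  have h1 : e.target.indicator (oneForm W e) =ᶠ[𝓝 u] oneForm W e := by
    filter_upwards [e.open_target.mem_nhds hu] with w hw using indicator_of_mem hw _
  rw [divField_chart he g hW (e.map_target hu), e.right_inv hu, diverg_congr h1]

/-- The divergence theorem. -/
theorem integral_divField [T2Space M] (hW : W ∈ smoothTensor n M 1) :
    ∫ x, divField g W x ∂(vol g) = 0 := by
  obtain ⟨t, ρ, hρ, hρs, h1⟩ := exists_partition n M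
  have hs : ∀ k ∈ t, (fun x => ρ k x • W x) ∈ smoothTensor n M 1 := fun k _ =>
    smul_mem_smoothTensor (hρs k) hW
  -- The divergence of each piece integrates to zero in its own chart. Additivity of the divergence
  -- is all that is needed, and derivatives of the cut-off functions never appear.
  have h2 : W = fun x => ∑ k ∈ t, ρ k x • W x := by
    funext x; rw [← Finset.sum_smul, h1, one_smul]
  rw [h2, funext (divField_sum g hs), integral_finsetSum _ fun k hk =>
    integrable_of_continuous g (continuous_divField g (hs k hk))]
  refine Finset.sum_eq_zero fun k hk => ?_
  exact integral_divField_of_support (chartAt_mem k) g (hs k hk) (isClosed_tsupport (ρ k)) (hρ k)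
    fun y hy => by rw [image_eq_zero_of_notMem_tsupport hy, zero_smul]

end Global

/-! ### The kernel of the Eisenhart operator -/

/-- The strict Cauchy–Schwarz inequality. The denominator in `sectional` is then positive, so its
sign is that of the curvature term. -/
theorem PosForm.gram_two_pos {V : Type*} [AddCommGroup V] [Module ℝ V] {B : V →ₗ[ℝ] V →ₗ[ℝ] ℝ}
    (hB : PosForm B) {v w : V} (h : LinearIndependent ℝ ![v, w]) :
    0 < B v v * B w w - B v w ^ 2 := by
  have hw : w ≠ 0 := h.ne_zero 1
  have hww := hB.pos w hw
  have hz : B w w • v - B v w • w ≠ 0 := fun hz => by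
    have := (LinearIndependent.pair_iff.1 h (B w w) (- B v w) (by rw [neg_smul, ← sub_eq_add_neg, hz])).1
    exact hww.ne' this
  have h1 := hB.pos _ hz
  have h2 : B (B w w • v - B v w • w) (B w w • v - B v w • w)
      = B w w * (B v v * B w w - B v w ^ 2) := by
    simp only [map_sub, map_smul, LinearMap.sub_apply, LinearMap.smul_apply, smul_eq_mul]
    rw [hB.symm w v]; ring
  rw [h2] at h1
  exact (mul_pos_iff_of_pos_left hww).1 h1

theorem curv_self {E : Type*} [NormedAddCommGroup E] [NormedSpace ℝ E] (G : E → Form E)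
    (u x z : E) : curv G u x x z = 0 := by simp [curv]

theorem curv_smul_left {E : Type*} [NormedAddCommGroup E] [NormedSpace ℝ E] (G : E → Form E)
    (u x y z : E) (c : ℝ) : curv G u (c • x) y z = c • curv G u x y z := by
  simp [curv, smul_sub, smul_add]

theorem curv_zero_right {E : Type*} [NormedAddCommGroup E] [NormedSpace ℝ E] (G : E → Form E)
    (u x y : E) : curv G u x y 0 = 0 := by simp [curv]

section Global

variable {n : ℕ} {M : Type*} [TopologicalSpace M] [ChartedSpace (EuclideanSpace ℝ (Fin n)) M]
  [IsManifold (𝓡 n) ∞ M] {e e' : Chart n M} (he : e ∈ atlas (EuclideanSpace ℝ (Fin n)) M)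
  (he' : e' ∈ atlas (EuclideanSpace ℝ (Fin n)) M) (g : Metric n M)

theorem sectional_eq (x : M) (v w : TangentSpace (𝓡 n) x) {e : Chart n M}
    (he : e = chartAt (EuclideanSpace ℝ (Fin n)) x) : sectional g x v w
      = metricForm g e (e x) (curv (metricForm g e) (e x) (coordMap e x v) (coordMap e x w)
          (coordMap e x w)) (coordMap e x v)
        / (g.inner x v v * g.inner x w w - g.inner x v w ^ 2) := by
  have hm : e ∈ atlas (EuclideanSpace ℝ (Fin n)) M := he ▸ chartAt_mem x
  have hx : x ∈ e.source := he ▸ mem_chart_source _ x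
  rw [sectional, ← he, ← (metricOn hm g).sum_riemann_eq (e.map_source hx)]
  simp only [metricComp_eq, coord_eq]

variable {x : M}

/-- For dependent vectors, which the curvature hypothesis does not cover, the expression vanishes by
antisymmetry of the curvature. This case must be included because ξ may be zero or parallel to a
basis vector. -/
theorem curv_nonpos (hx : ∀ v w : TangentSpace (𝓡 n) x, LinearIndependent ℝ ![v, w] →
    sectional g x v w ≤ 0) {e : Chart n M} (he : e = chartAt (EuclideanSpace ℝ (Fin n)) x)
    (v w : Eucl n) : metricForm g e (e x) (curv (metricForm g e) (e x) v w w) v ≤ 0 := by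
  have hm : e ∈ atlas (EuclideanSpace ℝ (Fin n)) M := he ▸ chartAt_mem x
  have hxs : x ∈ e.source := he ▸ mem_chart_source _ x
  by_cases h : LinearIndependent ℝ ![frameAt e x v, frameAt e x w]
  · have h1 := hx _ _ h
    have h2 := (posForm_inner g x).gram_two_pos h
    rw [sectional_eq g x _ _ he, coordMap_frameAt hm hxs, coordMap_frameAt hm hxs] at h1
    by_contra h3
    exact absurd h1 (not_le.2 (div_pos (not_le.1 h3) h2))
  · rw [LinearIndependent.pair_iff] at h
    push Not at h
    obtain ⟨s, t, hst, hne⟩ := h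
    have h1 := congrArg (coordMap e x) hst
    simp only [map_add, map_smul, coordMap_frameAt hm hxs, map_zero] at h1
    by_cases hs : s = 0
    · have h2 : w = 0 := by
        rw [hs, zero_smul, zero_add] at h1
        exact (smul_eq_zero.1 h1).resolve_left (hne hs)
      rw [h2, curv_zero_right]; simp
    · have h2 : v = (-(s⁻¹ * t)) • w := by
        rw [neg_smul, mul_smul, ← smul_neg, ← eq_neg_of_add_eq_zero_left h1, smul_smul,
          inv_mul_cancel₀ hs, one_smul]
      rw [h2, curv_smul_left, curv_self]; simp

theorem curv_neg (hx : ∀ v w : TangentSpace (𝓡 n) x, LinearIndependent ℝ ![v, w] →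
    sectional g x v w < 0) {e : Chart n M} (he : e = chartAt (EuclideanSpace ℝ (Fin n)) x)
    {v w : Eucl n} (h : LinearIndependent ℝ ![v, w]) :
    metricForm g e (e x) (curv (metricForm g e) (e x) v w w) v < 0 := by
  have hm : e ∈ atlas (EuclideanSpace ℝ (Fin n)) M := he ▸ chartAt_mem x
  have hxs : x ∈ e.source := he ▸ mem_chart_source _ x
  have h0 : LinearIndependent ℝ ![frameAt e x v, frameAt e x w] := by
    rw [LinearIndependent.pair_iff] at h ⊢
    intro s t hst
    have h1 := congrArg (coordMap e x) hst
    simp only [map_add, map_smul, coordMap_frameAt hm hxs, map_zero] at h1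
    exact h s t h1
  have h1 := hx _ _ h0
  have h2 := (posForm_inner g x).gram_two_pos h0
  rw [sectional_eq g x _ _ he, coordMap_frameAt hm hxs, coordMap_frameAt hm hxs] at h1
  by_contra h3
  exact absurd h1 (not_lt.2 (div_nonneg (not_lt.1 h3) h2.le))

/-! #### The Bochner field -/

/-- The covector at `x` that is given by `l` in the chart `e`. -/
def ofCovector (e : Chart n M) (x : M) (l : Eucl n →L[ℝ] ℝ) : CovTensor n 1 x :=
  MultilinearMap.ofSubsingleton ℝ (TangentSpace (𝓡 n) x) ℝ (0 : Fin 1)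
    ((l.comp (coordMap e x) : TangentSpace (𝓡 n) x →L[ℝ] ℝ) : TangentSpace (𝓡 n) x →ₗ[ℝ] ℝ)

theorem ofCovector_apply (e : Chart n M) (x : M) (l : Eucl n →L[ℝ] ℝ)
    (v : Fin 1 → TangentSpace (𝓡 n) x) : ofCovector e x l v = l (coordMap e x (v 0)) := rfl

/-- The field of 1-forms whose divergence enters the Bochner formula. -/
def bochnerField (θ : TensorField n 1 M) : TensorField n 1 M := fun x =>
  ofCovector (chartAt (EuclideanSpace ℝ (Fin n)) x) x
    (bochnerForm n (metricForm g (chartAt (EuclideanSpace ℝ (Fin n)) x))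
      (oneForm θ (chartAt (EuclideanSpace ℝ (Fin n)) x)) (chartAt (EuclideanSpace ℝ (Fin n)) x x))

variable {θ : TensorField n 1 M}

include he in
-- Naturality of the Bochner form; the pointwise choice of chart in `bochnerField` therefore does
-- not spoil its smoothness.
theorem oneForm_bochnerField (hθ : θ ∈ smoothTensor n M 1) {u : Eucl n} (hu : u ∈ e.target) :
    oneForm (bochnerField g θ) e u = bochnerForm n (metricForm g e) (oneForm θ e) u := by
  rw [mem_smoothTensor_one_iff] at hθ
  have hx := e.map_target hu
  have h₀ := chartAt_mem (n := n) (e.symm u)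
  have hx₀ := mem_chart_source (EuclideanSpace ℝ (Fin n)) (e.symm u)
  ext v
  have h1 := oneForm_chart he (bochnerField g θ) hx v
  have h2 := (transition he h₀ g).pull_bochnerForm n (pull_oneForm he h₀ θ)
    ((hθ e he).mono inter_subset_left) (hθ _ h₀) u ⟨hu, hx₀⟩ v
  rw [e.right_inv hu] at h1
  rw [h1, h2, bochnerField, ofCovector_apply, coordMap_comp he h₀ hx hx₀, coordMap_frameAt he hx,
    e.right_inv hu]

theorem bochnerField_mem (hθ : θ ∈ smoothTensor n M 1) : bochnerField g θ ∈ smoothTensor n M 1 :=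
  mem_smoothTensor_one_iff.2 fun e he =>
    ((metricOn he g).smooth_bochnerForm (n := n) (mem_smoothTensor_one_iff.1 hθ e he)).congr
      fun _ hu => oneForm_bochnerField he g hθ hu

include he in
theorem eisLocal_eq_zero (hθ : θ ∈ smoothTensor n M 1) (h : eisenhart g θ = 0) {u : Eucl n}
    (hu : u ∈ e.target) (z y x : Eucl n) :
    eisLocal n (metricForm g e) (oneForm θ e) u z y x = 0 := by
  have hx := e.map_target hu
  have h1 := eisenhart_apply he g hθ hx ![frameAt e _ z, frameAt e _ y, frameAt e _ x]
  have h2 : (fun a => coordMap e (e.symm u) (![frameAt e _ z, frameAt e _ y, frameAt e _ x] a))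
      = ![z, y, x] := by
    funext a; fin_cases a <;> exact coordMap_frameAt he hx _
  rw [h2, h, e.right_inv hu] at h1
  exact h1.symm

include he in
theorem divField_bochnerField (hθ : θ ∈ smoothTensor n M 1) (h : eisenhart g θ = 0)
    (hx : x ∈ e.source) (b : Module.Basis (Fin n) ℝ (Eucl n))
    (hb : ∀ i j, metricForm g e (e x) (b i) (b j) = if i = j then 1 else 0) :
    divField g (bochnerField g θ) x
      = bochnerLead n * (∑ i, ∑ j, nabla₁ (metricForm g e) (oneForm θ e) (e x) (b i) (b j) ^ 2)
        - ∑ i, ∑ j, nabla₁ (metricForm g e) (oneForm θ e) (e x) (b i) (b j)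
          * nabla₁ (metricForm g e) (oneForm θ e) (e x) (b j) (b i)
        + bochnerDiv n * diverg (metricForm g e) (oneForm θ e) (e x) ^ 2
        - (bochnerLead n + 1) * ∑ i, metricForm g e (e x)
          (curv (metricForm g e) (e x) (sharp (metricForm g e) (oneForm θ e) (e x)) (b i) (b i))
            (sharp (metricForm g e) (oneForm θ e) (e x)) := by
  rw [divField_chart he g (bochnerField_mem g hθ) hx,
    ← (metricOn he g).diverg_bochnerForm (mem_smoothTensor_one_iff.1 hθ e he) (e.map_source hx) hb
      fun z y x => eisLocal_eq_zero he g hθ h (e.map_source hx) z y x]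
  refine diverg_congr ?_
  filter_upwards [e.open_target.mem_nhds (e.map_source hx)] with u hu
    using oneForm_bochnerField he g hθ hu

/-- The inequality 2ab ≤ a² + b², giving tr(T ∘ T) ≤ |T|² for T = ∇θ. -/
theorem sum_mul_swap_le {ι : Type*} [Fintype ι] (T : ι → ι → ℝ) :
    ∑ i, ∑ j, T i j * T j i ≤ ∑ i, ∑ j, T i j ^ 2 := by
  have h1 : ∑ i, ∑ j, T i j * T j i ≤ ∑ i, ∑ j, (1 / 2) * (T i j ^ 2 + T j i ^ 2) :=
    Finset.sum_le_sum fun i _ => Finset.sum_le_sum fun j _ => by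
      nlinarith [sq_nonneg (T i j - T j i)]
  have h2 : ∑ i, ∑ j, T j i ^ 2 = ∑ i, ∑ j, T i j ^ 2 := Finset.sum_comm
  simp only [← Finset.mul_sum, Finset.sum_add_distrib, h2] at h1
  linarith

/-- The integrand in the Bochner formula dominates `|∇θ|²` and the curvature term. -/
theorem le_divField_bochnerField (hn : 2 ≤ n) (hθ : θ ∈ smoothTensor n M 1)
    (h : eisenhart g θ = 0) {e : Chart n M} (he : e = chartAt (EuclideanSpace ℝ (Fin n)) x)
    (b : Module.Basis (Fin n) ℝ (Eucl n))
    (hb : ∀ i j, metricForm g e (e x) (b i) (b j) = if i = j then 1 else 0) :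
    1 / 4 * (∑ i, ∑ j, nabla₁ (metricForm g e) (oneForm θ e) (e x) (b i) (b j) ^ 2)
        - (bochnerLead n + 1) * ∑ i, metricForm g e (e x)
          (curv (metricForm g e) (e x) (sharp (metricForm g e) (oneForm θ e) (e x)) (b i) (b i))
            (sharp (metricForm g e) (oneForm θ e) (e x)) ≤ divField g (bochnerField g θ) x := by
  have hm : e ∈ atlas (EuclideanSpace ℝ (Fin n)) M := he ▸ chartAt_mem x
  have hx : x ∈ e.source := he ▸ mem_chart_source _ x
  have hn' : (2 : ℝ) ≤ n := by exact_mod_cast hn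
  rw [divField_bochnerField hm g hθ h hx b hb]
  have h1 := sum_mul_swap_le fun i j => nabla₁ (metricForm g e) (oneForm θ e) (e x) (b i) (b j)
  have h2 : 0 ≤ ∑ i, ∑ j, nabla₁ (metricForm g e) (oneForm θ e) (e x) (b i) (b j) ^ 2 :=
    Finset.sum_nonneg fun i _ => Finset.sum_nonneg fun j _ => sq_nonneg _
  have h3 : 0 ≤ bochnerDiv n * diverg (metricForm g e) (oneForm θ e) (e x) ^ 2 := by
    refine mul_nonneg (div_nonneg ?_ ?_) (sq_nonneg _) <;> linarith
  -- The value of `bochnerLead` at n = 2, and its minimum for n ≥ 2. The excess over 1 is the factor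
  -- 1/4 kept in front of |∇θ|².
  have h4 : (5 : ℝ) / 4 ≤ bochnerLead n := by rw [bochnerLead]; linarith
  nlinarith [mul_nonneg (sub_nonneg.2 h4) h2]

variable [MeasurableSpace M] [BorelSpace M] [CompactSpace M] [Nonempty M] [T2Space M]

/-- The divergence is continuous and nonnegative, its integral is zero, and the volume charges every
nonempty open set. -/
theorem divField_bochnerField_eq_zero (hn : 2 ≤ n) (hg : ∀ (x : M) (v w : TangentSpace (𝓡 n) x),
    LinearIndependent ℝ ![v, w] → sectional g x v w ≤ 0)
    (hθ : θ ∈ smoothTensor n M 1) (h : eisenhart g θ = 0) (x : M) :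
    divField g (bochnerField g θ) x = 0 := by
  have hW := bochnerField_mem g hθ
  have h0 : ∀ x, 0 ≤ divField g (bochnerField g θ) x := fun x => by
    obtain ⟨b, -, hb⟩ := exists_orthonormal_chart (chartAt_mem x) g
      (mem_chart_source (EuclideanSpace ℝ (Fin n)) x)
    refine le_trans ?_ (le_divField_bochnerField g hn hθ h rfl _ hb)
    have h1 := Finset.sum_nonpos fun i (_ : i ∈ Finset.univ) => curv_nonpos g (hg x) rfl
      (sharp (metricForm g (chartAt (EuclideanSpace ℝ (Fin n)) x))
        (oneForm θ (chartAt (EuclideanSpace ℝ (Fin n)) x)) (chartAt (EuclideanSpace ℝ (Fin n)) x x))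
        (b.map (coordEquiv (chartAt_mem x) (mem_chart_source (EuclideanSpace ℝ (Fin n)) x)).toLinearEquiv i)
    have h2 : 0 ≤ bochnerLead n + 1 := by rw [bochnerLead]; positivity
    have h3 := mul_nonpos_of_nonneg_of_nonpos h2 h1
    refine le_trans ?_ (sub_nonneg.2 (h3.trans (mul_nonneg (by norm_num)
      (Finset.sum_nonneg fun i _ => Finset.sum_nonneg fun j _ => sq_nonneg _))))
    exact le_rfl
  have hc := continuous_divField g hW
  have h1 := (integral_eq_zero_iff_of_nonneg h0 (integrable_of_continuous g hc)).1
    (integral_divField g hW)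
  exact congrFun ((hc.ae_eq_iff_eq (vol g) continuous_const).1 h1) x

theorem nabla₁_eq_zero_of_sum {E : Type*} [NormedAddCommGroup E] [NormedSpace ℝ E] {C : Form E}
    (b : Module.Basis (Fin n) ℝ E) (h : ∑ i, ∑ j, C (b i) (b j) ^ 2 ≤ 0) (v w : E) :
    C v w = 0 := by
  have h1 : ∀ i j, C (b i) (b j) = 0 := fun i j => by
    have h2 := (Finset.sum_eq_zero_iff_of_nonneg fun i _ => Finset.sum_nonneg fun j _ =>
      sq_nonneg (C (b i) (b j))).1 (le_antisymm h (Finset.sum_nonneg fun i _ =>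
        Finset.sum_nonneg fun j _ => sq_nonneg _)) i (Finset.mem_univ i)
    exact pow_eq_zero_iff (two_ne_zero) |>.1
      ((Finset.sum_eq_zero_iff_of_nonneg fun j _ => sq_nonneg _).1 h2 j (Finset.mem_univ j))
  have h3 : C.toLinearMap₁₂ = 0 := b.ext fun i => b.ext fun j => h1 i j
  exact congrArg (fun L => L v w) h3

variable (hn : 2 ≤ n) (hθ : θ ∈ smoothTensor n M 1) (h : eisenhart g θ = 0)
include hn hθ h

/-- Both parts of the lower bound for the vanishing divergence are nonnegative, so each is zero. The
curvature terms have a common sign and therefore vanish one by one. -/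
theorem curvature_term_eq_zero (hg : ∀ (x : M) (v w : TangentSpace (𝓡 n) x),
    LinearIndependent ℝ ![v, w] → sectional g x v w ≤ 0)
    {e : Chart n M} (he : e = chartAt (EuclideanSpace ℝ (Fin n)) x)
    (b : Module.Basis (Fin n) ℝ (Eucl n))
    (hb : ∀ i j, metricForm g e (e x) (b i) (b j) = if i = j then 1 else 0) :
    (∀ v w, nabla₁ (metricForm g e) (oneForm θ e) (e x) v w = 0) ∧
    ∀ i, metricForm g e (e x)
      (curv (metricForm g e) (e x) (sharp (metricForm g e) (oneForm θ e) (e x)) (b i) (b i))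
        (sharp (metricForm g e) (oneForm θ e) (e x)) = 0 := by
  have h1 := le_divField_bochnerField g hn hθ h he b hb
  rw [divField_bochnerField_eq_zero g hn hg hθ h] at h1
  have h2 : 0 ≤ ∑ i, ∑ j, nabla₁ (metricForm g e) (oneForm θ e) (e x) (b i) (b j) ^ 2 :=
    Finset.sum_nonneg fun i _ => Finset.sum_nonneg fun j _ => sq_nonneg _
  have h3 : ∀ i, metricForm g e (e x)
      (curv (metricForm g e) (e x) (sharp (metricForm g e) (oneForm θ e) (e x)) (b i) (b i))
        (sharp (metricForm g e) (oneForm θ e) (e x)) ≤ 0 := fun i => curv_nonpos g (hg x) he _ _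
  have h4 := Finset.sum_nonpos fun i (_ : i ∈ Finset.univ) => h3 i
  have h5 : 1 ≤ bochnerLead n + 1 := by rw [bochnerLead]; linarith [n.cast_nonneg (α := ℝ)]
  refine ⟨nabla₁_eq_zero_of_sum b (by nlinarith), fun i => ?_⟩
  have h6 : ∑ i, metricForm g e (e x)
      (curv (metricForm g e) (e x) (sharp (metricForm g e) (oneForm θ e) (e x)) (b i) (b i))
        (sharp (metricForm g e) (oneForm θ e) (e x)) = 0 := by nlinarith
  exact (Finset.sum_eq_zero_iff_of_nonpos fun i _ => h3 i).1 h6 i (Finset.mem_univ i)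

end Global

section Global

variable {n : ℕ} {M : Type*} [TopologicalSpace M] [ChartedSpace (EuclideanSpace ℝ (Fin n)) M]
  [IsManifold (𝓡 n) ∞ M] {e e' : Chart n M} (he : e ∈ atlas (EuclideanSpace ℝ (Fin n)) M)
  (he' : e' ∈ atlas (EuclideanSpace ℝ (Fin n)) M) (g : Metric n M) {θ : TensorField n 1 M} {x : M}

include he in
/-- If `η` is dual to `X`, then `g(θ, η) = θ(X)`. -/
theorem tensorInner_eq_apply {η : TensorField n 1 M} {u X : Eucl n} (hu : u ∈ e.target)
    (h : ∀ v, oneForm η e u v = metricForm g e u X v) :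
    tensorInner g (e.symm u) (θ (e.symm u)) (η (e.symm u)) = oneForm θ e u X := by
  have hx := e.map_target hu
  obtain ⟨b, hb, -⟩ := exists_orthonormal_chart he g hx
  set Y : TangentSpace (𝓡 n) (e.symm u) := frameAt e (e.symm u) X with hY
  have h1 : ∀ v : TangentSpace (𝓡 n) (e.symm u), η (e.symm u) (fun _ => v) = g.inner _ Y v := by
    intro v
    have h2 := oneForm_chart he η hx (coordMap e _ v)
    have h3 := metricForm_chart he g hx X (coordMap e _ v)
    rw [e.right_inv hu] at h2 h3
    rw [frameAt_coordMap he hx] at h2 h3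
    rw [← h2, h, h3]
  have h4 := oneForm_chart he θ hx X
  rw [e.right_inv hu] at h4
  rw [h4, tensorInner_eq, ← contraction_basis_change _ _ b, contraction_orthonormal hb]
  let L : TangentSpace (𝓡 n) (e.symm u) →ₗ[ℝ] ℝ :=
    (MultilinearMap.ofSubsingleton ℝ (TangentSpace (𝓡 n) (e.symm u)) ℝ (0 : Fin 1)).symm
      (θ (e.symm u))
  have hL : ∀ v, L v = θ (e.symm u) (fun _ => v) := fun v => rfl
  have hY2 : L Y = ∑ i, (g.inner (e.symm u)).toLinearMap₁₂ Y (b i) * L (b i) := by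
    conv_lhs => rw [orthonormal_expand hb Y, map_sum]
    exact Finset.sum_congr rfl fun i _ => by rw [map_smul, smul_eq_mul]
  rw [← hL, ← hY, hY2, ← (Equiv.funUnique (Fin 1) (Fin n)).symm.sum_comp]
  refine Finset.sum_congr rfl fun i _ => ?_
  rw [mul_comm]
  exact congrArg (· * L (b i)) (h1 (b i))

include he in
theorem tensorInner_self_eq {u : Eucl n} (hu : u ∈ e.target) :
    tensorInner g (e.symm u) (θ (e.symm u)) (θ (e.symm u))
      = metricForm g e u (sharp (metricForm g e) (oneForm θ e) u)
        (sharp (metricForm g e) (oneForm θ e) u) := by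
  rw [tensorInner_eq_apply he g hu fun v => ((metricOn he g).metric_sharp hu v).symm,
    (metricOn he g).metric_sharp hu]

/-- The length of a parallel 1-form is constant. -/
theorem tensorInner_eq_of_parallel [PreconnectedSpace M] (hθ : θ ∈ smoothTensor n M 1)
    (h : ∀ e ∈ atlas (EuclideanSpace ℝ (Fin n)) M, ∀ u ∈ e.target, ∀ v w,
      nabla₁ (metricForm g e) (oneForm θ e) u v w = 0) (x y : M) :
    tensorInner g x (θ x) (θ x) = tensorInner g y (θ y) (θ y) := by
  have hl : IsLocallyConstant fun x => tensorInner g x (θ x) (θ x) := by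
    refine (IsLocallyConstant.iff_eventually_eq _).2 fun x => ?_
    set e := chartAt (EuclideanSpace ℝ (Fin n)) x
    have he : e ∈ atlas (EuclideanSpace ℝ (Fin n)) M := chartAt_mem x
    have hx : x ∈ e.source := mem_chart_source _ x
    obtain ⟨r, hr, hball⟩ := Metric.isOpen_iff.1 e.open_target (e x) (e.map_source hx)
    have hm := metricOn he g
    have hs := mem_smoothTensor_one_iff.1 hθ e he
    have hf := (smooth_tensorInner he g hθ hθ).differentiableOn (by simp)
    -- By ∇g = 0 the derivative of |ξ|² in direction z is 2 g(∇_z ξ, ξ), which is zero for a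
    -- parallel form.
    have hd : ∀ u ∈ e.target, fderiv ℝ
        (fun u => tensorInner g (e.symm u) (θ (e.symm u)) (θ (e.symm u))) u = 0 := by
      intro u hu
      have h1 : (fun u => tensorInner g (e.symm u) (θ (e.symm u)) (θ (e.symm u))) =ᶠ[𝓝 u]
          fun u => metricForm g e u (sharp (metricForm g e) (oneForm θ e) u)
            (sharp (metricForm g e) (oneForm θ e) u) := by
        filter_upwards [e.open_target.mem_nhds hu] with w hw using tensorInner_self_eq he g hw
      rw [h1.fderiv_eq]
      have hX : DifferentiableAt ℝ (sharp (metricForm g e) (oneForm θ e)) u :=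
        ((hm.smooth_sharp hs).contDiffAt (hm.mem_nhds hu)).differentiableAt (by simp)
      have hG := hm.differentiableAt hu
      ext z
      have h2 := ((hG.hasFDerivAt.clm_apply hX.hasFDerivAt).clm_apply hX.hasFDerivAt).fderiv
      rw [h2]
      have h3 := h e he u hu z (sharp (metricForm g e) (oneForm θ e) u)
      rw [hm.nabla₁_eq_sharp hs hu, map_add, add_apply] at h3
      simp only [add_apply, ContinuousLinearMap.comp_apply, ContinuousLinearMap.flip_apply,
        hm.fderiv_metric hu, zero_apply]
      rw [hm.symm hu _ (fderiv ℝ _ u z), hm.symm hu _ (gam _ u z _)]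
      linarith
    have h4 : ∀ u ∈ Metric.ball (e x) r,
        tensorInner g (e.symm u) (θ (e.symm u)) (θ (e.symm u))
          = tensorInner g x (θ x) (θ x) := fun u hu => by
      have h5 := Metric.isOpen_ball.is_const_of_fderiv_eq_zero
        (convex_ball (e x) r).isPreconnected (hf.mono hball)
        (fun w hw => hd w (hball hw)) hu (Metric.mem_ball_self hr)
      rw [h5, e.left_inv hx]
    filter_upwards [(e.isOpen_inter_preimage Metric.isOpen_ball).mem_nhds
      ⟨hx, Metric.mem_ball_self hr⟩] with y hy
    have h5 := h4 (e y) hy.2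
    rwa [e.left_inv hy.1] at h5
  exact hl.apply_eq_of_isPreconnected isPreconnected_univ (mem_univ x) (mem_univ y)

/-- The Eisenhart operator is injective if the sectional curvature is quasi-negative. -/
theorem eq_zero_of_eisenhart_eq_zero [ConnectedSpace M] [CompactSpace M] [T2Space M]
    (hn : 2 ≤ n) (hg : QuasiNegative g) (hθ : θ ∈ smoothTensor n M 1) (h : eisenhart g θ = 0) :
    θ = 0 := by
  -- The statement involves no measure, but the argument integrates, so M is given its Borel
  -- σ-algebra.
  borelize M
  obtain ⟨hg1, x₀, hx₀⟩ := hg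
  have hs := mem_smoothTensor_one_iff.1 hθ
  have hpar : ∀ e ∈ atlas (EuclideanSpace ℝ (Fin n)) M, ∀ u ∈ e.target, ∀ v w,
      nabla₁ (metricForm g e) (oneForm θ e) u v w = 0 := by
    -- The vanishing of ∇θ is known at each point in the preferred chart there; naturality transfers
    -- it to an arbitrary chart.
    intro e he u hu v w
    have h₀ := chartAt_mem (n := n) (e.symm u)
    have hx₀ := mem_chart_source (EuclideanSpace ℝ (Fin n)) (e.symm u)
    obtain ⟨b, -, hb⟩ := exists_orthonormal_chart h₀ g hx₀
    rw [(transition he h₀ g).pull_nabla₁ (pull_oneForm he h₀ θ)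
      ((hs e he).mono inter_subset_left) (hs _ h₀) u ⟨hu, hx₀⟩]
    exact (curvature_term_eq_zero g hn hθ h hg1 rfl _ hb).1 _ _
  have h0 : tensorInner g x₀ (θ x₀) (θ x₀) = 0 := by
    set e := chartAt (EuclideanSpace ℝ (Fin n)) x₀ with hedef
    have he : e ∈ atlas (EuclideanSpace ℝ (Fin n)) M := chartAt_mem x₀
    have hxe : x₀ ∈ e.source := mem_chart_source _ x₀
    have h1 := tensorInner_self_eq he g (θ := θ) (e.map_source hxe)
    rw [e.left_inv hxe] at h1
    rw [h1]
    obtain ⟨b', -, hb⟩ := exists_orthonormal_chart he g hxe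
    set b := b'.map (coordEquiv he hxe).toLinearEquiv
    have h2 := (curvature_term_eq_zero g hn hθ h hg1 hedef b hb).2
    set ξ := sharp (metricForm g e) (oneForm θ e) (e x₀) with hξ
    by_contra hne
    have hξ0 : ξ ≠ 0 := fun h => hne (by rw [h, map_zero])
    -- Strict negativity excludes every basis vector independent of ξ. But two orthonormal vectors,
    -- which exist since n ≥ 2, cannot both be multiples of ξ.
    have h3 : ∀ i, ∃ c : ℝ, c • ξ = b i := fun i => by
      by_contra hc
      push Not at hc
      exact (curv_neg g hx₀ hedef ((LinearIndependent.pair_iff' hξ0).2 hc)).ne (h2 i)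
    obtain ⟨c, hc⟩ := h3 ⟨0, by omega⟩
    obtain ⟨d, hd⟩ := h3 ⟨1, by omega⟩
    have e1 := hb ⟨0, by omega⟩ ⟨0, by omega⟩
    have e2 := hb ⟨1, by omega⟩ ⟨1, by omega⟩
    have e3 := hb ⟨0, by omega⟩ ⟨1, by omega⟩
    change metricForm g e (e x₀) (b _) (b _) = _ at e1 e2 e3
    rw [← hc] at e1 e3
    rw [← hd] at e2 e3
    simp only [map_smul, smul_apply, smul_eq_mul, if_true, Fin.mk.injEq, zero_ne_one, if_false]
      at e1 e2 e3
    rcases mul_eq_zero.1 e3 with h | h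
    · simp [h] at e2
    · rcases mul_eq_zero.1 h with h | h
      · simp [h] at e1
      · exact hne h
  funext x
  have h1 := tensorInner_eq_of_parallel g hθ hpar x x₀
  rw [h0] at h1
  exact eq_zero_of_tensorInner g h1

/-! ### Positive definiteness from injectivity -/

variable [MeasurableSpace M] [BorelSpace M] [CompactSpace M] [Nonempty M]

theorem l2_comm {r : ℕ} (S T : TensorField n r M) : l2 g S T = l2 g T S := by
  simp only [l2, tensorInner_comm g _ (S _) (T _)]

theorem l2_self_pos {r : ℕ} {S : TensorField n r M} (hS : S ∈ smoothTensor n M r) (h : S ≠ 0) :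
    0 < l2 g S S := by
  obtain ⟨x, hx⟩ := Function.ne_iff.1 h
  refine (continuous_tensorInner g hS hS).integral_pos_of_hasCompactSupport_nonneg_nonzero
    (HasCompactSupport.of_compactSpace _) (fun x => tensorInner_self_nonneg g x _) (x := x)
    fun h0 => hx (eq_zero_of_tensorInner g h0)

/-- The adjoint relation, used with Φ = E θ, gives ⟨A E θ, η⟩ = ⟨E η, E θ⟩. It applies because E θ
lies in the space on which A is prescribed. -/
theorem isPositiveDefinite_of_injective
    (h : ∀ θ ∈ smoothTensor n M 1, eisenhart g θ = 0 → θ = 0)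
    {A : TensorField n 3 M → TensorField n 1 M} (hA : IsFormalAdjoint g A) :
    IsPositiveDefinite g fun θ => A (eisenhart g θ) := by
  have h1 : ∀ θ ∈ smoothTensor n M 1, ∀ η ∈ smoothTensor n M 1,
      l2 g (A (eisenhart g θ)) η = l2 g (eisenhart g η) (eisenhart g θ) := fun θ hθ η hη => by
    rw [l2_comm, hA.2 η hη _ (eisenhart_mem g hθ)]
  refine ⟨fun θ hθ => hA.1 _ (eisenhart_mem g hθ), fun θ hθ η hη => ?_, fun θ hθ hne => ?_⟩
  · rw [h1 θ hθ η hη, l2_comm, hA.2 θ hθ _ (eisenhart_mem g hη)]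
  · rw [h1 θ hθ θ hθ]
    exact l2_self_pos g (eisenhart_mem_smoothTensor g hθ) fun h0 => hne (h θ hθ h0)

end Global

/-! ### Transposes of differential operators -/

/-- The operator `L` on 1-forms on `Ω` has a transpose with respect to Lebesgue measure. -/
structure HasTranspose {n : ℕ} (Ω : Set (Eucl n)) (L : (Eucl n → Eucl n →L[ℝ] ℝ) → Eucl n → ℝ) :
    Prop where
  smooth : ∀ θ, ContDiffOn ℝ ∞ θ Ω → ContDiffOn ℝ ∞ (L θ) Ω
  transpose : ∀ ψ : Eucl n → ℝ, IsTest Ω ψ → ∃ β : Eucl n → Eucl n, IsTest Ω β ∧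
    ∀ θ, ContDiffOn ℝ ∞ θ Ω → ∫ u, L θ u * ψ u = ∫ u, θ u (β u)

namespace HasTranspose

variable {n : ℕ} {Ω : Set (Eucl n)} {L L' : (Eucl n → Eucl n →L[ℝ] ℝ) → Eucl n → ℝ}

/-- Only values on Ω matter, since L is paired with functions supported there. -/
theorem congr (h : HasTranspose Ω L)
    (hL : ∀ θ, ContDiffOn ℝ ∞ θ Ω → ∀ u ∈ Ω, L' θ u = L θ u) : HasTranspose Ω L' where
  smooth θ hθ := (h.smooth θ hθ).congr (hL θ hθ)
  transpose ψ hψ := by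
    obtain ⟨β, hβ, h1⟩ := h.transpose ψ hψ
    refine ⟨β, hβ, fun θ hθ => ?_⟩
    rw [← h1 θ hθ]
    refine integral_congr_ae (ae_of_all _ fun u => ?_)
    by_cases hu : u ∈ Ω
    · simp only [hL θ hθ u hu]
    · simp only [hψ.eq_zero hu, mul_zero]

theorem apply (hΩ : IsOpen Ω) {X : Eucl n → Eucl n} (hX : ContDiffOn ℝ ∞ X Ω) :
    HasTranspose Ω fun θ u => θ u (X u) where
  smooth θ hθ := hθ.clm_apply hX
  transpose ψ hψ := ⟨fun u => ψ u • X u, hψ.smul_right hΩ hX, fun θ _ => by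
    simp [mul_comm]⟩

theorem zero (Ω : Set (Eucl n)) : HasTranspose Ω fun _ _ => 0 where
  smooth _ _ := contDiffOn_const
  transpose ψ _ := ⟨fun _ => 0, ⟨contDiff_const, HasCompactSupport.zero, by simp [tsupport]⟩,
    fun θ _ => by simp⟩

theorem add (hΩ : IsOpen Ω) (h : HasTranspose Ω L) (h' : HasTranspose Ω L') :
    HasTranspose Ω fun θ u => L θ u + L' θ u where
  smooth θ hθ := (h.smooth θ hθ).add (h'.smooth θ hθ)
  transpose ψ hψ := by
    obtain ⟨β, hβ, h1⟩ := h.transpose ψ hψ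
    obtain ⟨β', hβ', h1'⟩ := h'.transpose ψ hψ
    refine ⟨fun u => β u + β' u, hβ.add hΩ hβ', fun θ hθ => ?_⟩
    simp only [add_mul, map_add]
    have e1 : Integrable fun u => L θ u * ψ u := (hψ.smul hΩ (h.smooth θ hθ)).integrable
    have e2 : Integrable fun u => L' θ u * ψ u := (hψ.smul hΩ (h'.smooth θ hθ)).integrable
    rw [integral_add e1 e2, h1 θ hθ, h1' θ hθ,
      integral_add (hβ.clm_apply hΩ hθ).integrable (hβ'.clm_apply hΩ hθ).integrable]

theorem mul (hΩ : IsOpen Ω) {a : Eucl n → ℝ} (ha : ContDiffOn ℝ ∞ a Ω) (h : HasTranspose Ω L) :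
    HasTranspose Ω fun θ u => a u * L θ u where
  smooth θ hθ := ha.mul (h.smooth θ hθ)
  transpose ψ hψ := by
    obtain ⟨β, hβ, h1⟩ := h.transpose _ (hψ.smul hΩ ha)
    refine ⟨β, hβ, fun θ hθ => ?_⟩
    rw [← h1 θ hθ]
    simp only [smul_eq_mul]
    congr 1; funext u; ring

theorem sub (hΩ : IsOpen Ω) (h : HasTranspose Ω L) (h' : HasTranspose Ω L') :
    HasTranspose Ω fun θ u => L θ u - L' θ u :=
  (h.add hΩ (h'.mul hΩ (contDiffOn_const (c := (-1 : ℝ))))).congr fun θ _ u _ => by ring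

theorem sum (hΩ : IsOpen Ω) {ι : Type*} {t : Finset ι}
    {L : ι → (Eucl n → Eucl n →L[ℝ] ℝ) → Eucl n → ℝ} (h : ∀ i ∈ t, HasTranspose Ω (L i)) :
    HasTranspose Ω fun θ u => ∑ i ∈ t, L i θ u := by
  classical
  induction t using Finset.induction_on with
  | empty => simpa using zero Ω
  | insert a s ha ih =>
    simp only [Finset.sum_insert ha]
    exact (h a (Finset.mem_insert_self a s)).add hΩ
      (ih fun i hi => h i (Finset.mem_insert_of_mem hi))

/-- Integration by parts: the transpose of ∂_v ∘ L sends ψ to minus the transpose of L at ∂_v ψ.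
With closure under sums and smooth coefficients, this reaches the second order operator E without
writing its adjoint down. -/
theorem fderiv_apply (hΩ : IsOpen Ω) (h : HasTranspose Ω L) (v : Eucl n) :
    HasTranspose Ω fun θ u => fderiv ℝ (L θ) u v where
  smooth θ hθ := ((h.smooth θ hθ).fderiv_of_isOpen hΩ (m := ∞) (by simp)).clm_apply contDiffOn_const
  transpose ψ hψ := by
    obtain ⟨β, hβ, h1⟩ := h.transpose _ (hψ.fderiv_apply hΩ v)
    refine ⟨fun u => (-1 : ℝ) • β u, hβ.smul hΩ contDiffOn_const, fun θ hθ => ?_⟩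
    have hs := h.smooth θ hθ
    have hT : IsTest Ω fun u => L θ u • ψ u := hψ.smul hΩ hs
    have hT' : IsTest Ω fun u => L θ u • fderiv ℝ ψ u v := (hψ.fderiv_apply hΩ v).smul hΩ hs
    have h2 : ∀ u, fderiv ℝ (L θ) u v * ψ u
        = fderiv ℝ (fun u => L θ u • ψ u) u v - L θ u • fderiv ℝ ψ u v := fun u => by
      by_cases hu : u ∈ Ω
      · rw [fderiv_fun_smul ((hs.contDiffAt (hΩ.mem_nhds hu)).differentiableAt (by simp))
          (hψ.smooth.differentiable (by simp) u)]
        simp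
      · rw [hψ.eq_zero hu, (hT.fderiv_apply hΩ v).eq_zero hu, hT'.eq_zero hu]; simp
    simp only [h2]
    rw [integral_sub (hT.fderiv_apply hΩ v).integrable hT'.integrable, hT.integral_fderiv hΩ]
    simp only [smul_eq_mul, h1 θ hθ, map_smul, neg_one_mul, zero_sub, integral_neg]

/-- Bilinear expressions, evaluated on smooth vector fields. -/
theorem form_apply (hΩ : IsOpen Ω) {C : (Eucl n → Eucl n →L[ℝ] ℝ) → Eucl n → Form (Eucl n)}
    (h : ∀ v w, HasTranspose Ω fun θ u => C θ u v w) {X Y : Eucl n → Eucl n}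
    (hX : ContDiffOn ℝ ∞ X Ω) (hY : ContDiffOn ℝ ∞ Y Ω) :
    HasTranspose Ω fun θ u => C θ u (X u) (Y u) := by
  have hc : ∀ {X : Eucl n → Eucl n}, ContDiffOn ℝ ∞ X Ω → ∀ i, ContDiffOn ℝ ∞ (fun u => X u i) Ω :=
    fun {X} hX i => (EuclideanSpace.proj i : Eucl n →L[ℝ] ℝ).contDiff.comp_contDiffOn hX
  have h1 : HasTranspose Ω fun θ u => ∑ i, ∑ j, X u i * Y u j *
      C θ u (EuclideanSpace.single i 1) (EuclideanSpace.single j 1) :=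
    sum hΩ fun i _ => sum hΩ fun j _ => (h _ _).mul hΩ ((hc hX i).mul (hc hY j))
  refine h1.congr fun θ _ u _ => ?_
  calc C θ u (X u) (Y u) = C θ u (∑ i, X u i • EuclideanSpace.single i (1 : ℝ))
        (∑ i, Y u i • EuclideanSpace.single i (1 : ℝ)) := by
        rw [← eq_sum_single, ← eq_sum_single]
    _ = _ := by
        simp only [map_sum, map_smul, sum_apply, smul_apply, smul_eq_mul, Finset.mul_sum]
        rw [Finset.sum_comm]
        refine Finset.sum_congr rfl fun i _ => Finset.sum_congr rfl fun j _ => ?_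
        ring

end HasTranspose

namespace MetricOn

variable {n : ℕ} {Ω : Set (Eucl n)} {G : Eucl n → Form (Eucl n)} (h : MetricOn Ω G)
include h

theorem hasTranspose_nabla₁ (z y : Eucl n) : HasTranspose Ω fun θ u => nabla₁ G θ u z y := by
  have h1 : HasTranspose Ω fun θ u => fderiv ℝ (fun w => θ w y) u z :=
    (HasTranspose.apply h.isOpen contDiffOn_const).fderiv_apply h.isOpen z
  have h2 : HasTranspose Ω fun θ u => θ u (gam G u z y) := HasTranspose.apply h.isOpen
    ((h.smooth_gam.clm_apply contDiffOn_const).clm_apply contDiffOn_const)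
  refine (h1.sub h.isOpen h2).congr fun θ hθ u hu => ?_
  rw [nabla₁_apply, fderiv_apply_const ((hθ.contDiffAt (h.mem_nhds hu)).differentiableAt (by simp))]

theorem hasTranspose_symNabla (z y : Eucl n) : HasTranspose Ω fun θ u => symNabla G θ u z y :=
  (((h.hasTranspose_nabla₁ z y).add h.isOpen (h.hasTranspose_nabla₁ y z)).mul h.isOpen
    (contDiffOn_const (c := (1 / 2 : ℝ)))).congr fun _ _ _ _ => symNabla_apply _ _ _ _ _

theorem smooth_inv (i j : Fin n) : ContDiffOn ℝ ∞ (fun u => (formMatrix (G u))⁻¹ i j) Ω :=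
  contDiffOn_matrix_inv (fun _ _ => (h.smooth.clm_apply contDiffOn_const).clm_apply
    contDiffOn_const) (fun u hu => (formMatrix_det_pos (h.pos u hu)).ne') i j

theorem hasTranspose_diverg : HasTranspose Ω fun θ u => diverg G θ u :=
  (HasTranspose.sum h.isOpen fun i (_ : i ∈ Finset.univ) => HasTranspose.sum h.isOpen
    fun j (_ : j ∈ Finset.univ) => (h.hasTranspose_nabla₁ (EuclideanSpace.single i 1)
      (EuclideanSpace.single j 1)).mul h.isOpen (h.smooth_inv i j)).congr
    fun _ _ _ hu => formTrace_eq_sum (h.pos _ hu) _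

theorem hasTranspose_nabla₂ (z y x : Eucl n) :
    HasTranspose Ω fun θ u => nabla₂ G (symNabla G θ) u z y x := by
  have hg : ∀ v w : Eucl n, ContDiffOn ℝ ∞ (fun u => gam G u v w) Ω := fun v w =>
    (h.smooth_gam.clm_apply contDiffOn_const).clm_apply contDiffOn_const
  have h1 : HasTranspose Ω fun θ u => fderiv ℝ (fun w => symNabla G θ w y x) u z :=
    (h.hasTranspose_symNabla y x).fderiv_apply h.isOpen z
  have h2 : HasTranspose Ω fun θ u => symNabla G θ u (gam G u z y) x :=
    HasTranspose.form_apply h.isOpen h.hasTranspose_symNabla (hg z y) contDiffOn_const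
  have h3 : HasTranspose Ω fun θ u => symNabla G θ u y (gam G u z x) :=
    HasTranspose.form_apply h.isOpen h.hasTranspose_symNabla contDiffOn_const (hg z x)
  refine ((h1.sub h.isOpen h2).sub h.isOpen h3).congr fun θ hθ u hu => ?_
  rw [nabla₂, fderiv_apply_const₂ (((h.smooth_symNabla hθ).contDiffAt
    (h.mem_nhds hu)).differentiableAt (by simp))]

theorem hasTranspose_eisLocal (z y x : Eucl n) :
    HasTranspose Ω fun θ u => eisLocal n G θ u z y x := by
  have hg : ∀ v w : Eucl n, ContDiffOn ℝ ∞ (fun u => G u v w) Ω := fun v w =>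
    (h.smooth.clm_apply contDiffOn_const).clm_apply contDiffOn_const
  have hd : ∀ v, HasTranspose Ω fun θ u => fderiv ℝ (diverg G θ) u v := fun v =>
    h.hasTranspose_diverg.fderiv_apply h.isOpen v
  exact ((((h.hasTranspose_nabla₂ z y x).mul h.isOpen
    (contDiffOn_const (c := 2 * ((n : ℝ) + 1)))).sub h.isOpen
    ((hd z).mul h.isOpen (contDiffOn_const.mul (hg y x)))).sub h.isOpen
    ((hd y).mul h.isOpen (hg z x))).sub h.isOpen ((hd x).mul h.isOpen (hg z y))

end MetricOn

/-! ### The formal adjoint -/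

section Global

variable {n : ℕ} {M : Type*} [TopologicalSpace M] [ChartedSpace (EuclideanSpace ℝ (Fin n)) M]
  [IsManifold (𝓡 n) ∞ M] {e e' : Chart n M} (he : e ∈ atlas (EuclideanSpace ℝ (Fin n)) M)
  (he' : e' ∈ atlas (EuclideanSpace ℝ (Fin n)) M)

open Classical in
/-- The field of 1-forms that is given by `l` in the chart `e`, extended by zero. -/
def extendForm (e : Chart n M) (l : Eucl n → Eucl n →L[ℝ] ℝ) : TensorField n 1 M := fun x =>
  if x ∈ e.source then ofCovector e x (l (e x)) else 0

include he in
theorem oneForm_extendForm (l : Eucl n → Eucl n →L[ℝ] ℝ) {u : Eucl n} (hu : u ∈ e.target) :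
    oneForm (extendForm e l) e u = l u := by
  have hx := e.map_target hu
  ext v
  have h1 := oneForm_chart he (extendForm e l) hx v
  rw [e.right_inv hu] at h1
  rw [h1, extendForm, if_pos hx, ofCovector_apply, coordMap_frameAt he hx, e.right_inv hu]

include he in
-- Near a point outside the chart domain the extension is zero, because the support has compact
-- image and is thus closed in the Hausdorff space M.
theorem extendForm_mem [T2Space M] {l : Eucl n → Eucl n →L[ℝ] ℝ} (hl : IsTest e.target l) :
    extendForm e l ∈ smoothTensor n M 1 := by
  refine mem_smoothTensor_one_iff.2 fun e' he' u₀ hu₀ => ContDiffAt.contDiffWithinAt ?_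
  by_cases hx : e'.symm u₀ ∈ e.source
  · have T : ContDiffOn ℝ ∞ (fun u => e (e'.symm u)) (overlap e' e) := contDiffOn_overlap he' he
    have ho := isOpen_overlap e' e
    have h1 : ContDiffOn ℝ ∞ (fun u => (l (e (e'.symm u))).comp
        (fderiv ℝ (fun u => e (e'.symm u)) u)) (overlap e' e) :=
      (hl.smooth.comp_contDiffOn T).clm_comp (T.fderiv_of_isOpen ho (by simp))
    refine (h1.contDiffAt (ho.mem_nhds ⟨hu₀, hx⟩)).congr_of_eventuallyEq ?_
    filter_upwards [ho.mem_nhds ⟨hu₀, hx⟩] with u hu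
    ext v
    rw [pull_oneForm he' he _ u hu v, oneForm_extendForm he l (e.map_source hu.2)]
    rfl
  · have hK : IsCompact (e.symm '' tsupport l) :=
      hl.compact.isCompact.image_of_continuousOn (e.continuousOn_symm.mono hl.supp)
    have hKs : e.symm '' tsupport l ⊆ e.source :=
      image_subset_iff.2 fun u hu => e.map_target (hl.supp hu)
    have h0 : ∀ y ∉ e.symm '' tsupport l, extendForm e l y = 0 := fun y hy => by
      by_cases hye : y ∈ e.source
      · rw [extendForm, if_pos hye, image_eq_zero_of_notMem_tsupport (f := l)
          fun h => hy ⟨e y, h, e.left_inv hye⟩]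
        rfl
      · rw [extendForm, if_neg hye]
    have ho := e'.isOpen_inter_preimage_symm hK.isClosed.isOpen_compl
    have h1 : oneForm (extendForm e l) e' =ᶠ[𝓝 u₀] fun _ => 0 := by
      filter_upwards [ho.mem_nhds ⟨hu₀, fun h => hx (hKs h)⟩] with u hu
      ext v
      rw [oneForm_apply, h0 _ hu.2]
      rfl
    exact contDiffAt_const.congr_of_eventuallyEq h1

variable (g : Metric n M) [MeasurableSpace M] [BorelSpace M] [CompactSpace M] [Nonempty M]

include he in
-- Lowering β with the metric and dividing by the volume density undoes both weights of the L²
-- product, so the Lebesgue pairing of θ with β remains.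
theorem l2_extendForm [T2Space M] {θ : TensorField n 1 M} (hθ : θ ∈ smoothTensor n M 1)
    {β : Eucl n → Eucl n} (hβ : IsTest e.target β) :
    l2 g θ (extendForm e fun u => (volDensity (metricForm g e) u)⁻¹ • metricForm g e u (β u))
      = ∫ u, oneForm θ e u (β u) := by
  have hm := metricOn he g
  set l : Eucl n → Eucl n →L[ℝ] ℝ :=
    fun u => (volDensity (metricForm g e) u)⁻¹ • metricForm g e u (β u) with hl
  have hlT : IsTest e.target l := (hβ.clm_apply hm.isOpen hm.smooth).smul hm.isOpen
    (hm.smooth_volDensity.inv fun u hu => (hm.volDensity_pos hu).ne')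
  have hs := extendForm_mem he hlT
  have h0 : ∀ x ∉ e.source, tensorInner g x (θ x) (extendForm e l x) = 0 := fun x hx => by
    rw [extendForm, if_neg hx]
    simp [tensorInner]
  rw [l2, integral_vol he g (continuous_tensorInner g hθ hs) h0,
    ← (hβ.clm_apply hm.isOpen (mem_smoothTensor_one_iff.1 hθ e he)).setIntegral]
  refine setIntegral_congr_fun e.open_target.measurableSet fun u hu => ?_
  have hp := hm.volDensity_pos hu
  rw [tensorInner_eq_apply he g hu (X := (volDensity (metricForm g e) u)⁻¹ • β u) fun v => by
    rw [oneForm_extendForm he l hu, hl, map_smul]]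
  rw [map_smul, smul_eq_mul, mul_inv_cancel_left₀ hp.ne']

theorem tensorInner_sum {r : ℕ} {ι : Type*} (t : Finset ι) (x : M) (S : CovTensor n r x)
    (T : ι → CovTensor n r x) :
    tensorInner g x S (∑ k ∈ t, T k) = ∑ k ∈ t, tensorInner g x S (T k) := by
  simp only [tensorInner, sum_apply, Finset.mul_sum]
  exact (Finset.sum_congr rfl fun I _ => Finset.sum_comm).trans Finset.sum_comm

theorem l2_sum {r : ℕ} {ι : Type*} {t : Finset ι} {S : TensorField n r M} {T : ι → TensorField n r M}
    (hS : S ∈ smoothTensor n M r) (hT : ∀ k ∈ t, T k ∈ smoothTensor n M r) :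
    l2 g S (fun x => ∑ k ∈ t, T k x) = ∑ k ∈ t, l2 g S (T k) := by
  simp only [l2, tensorInner_sum]
  exact integral_finsetSum _ fun k hk =>
    integrable_of_continuous g (continuous_tensorInner g hS (hT k hk))

include he in
theorem exists_local_adjoint [T2Space M] {ρ : M → ℝ} (hρ : ρ ∈ smoothFun n M)
    (hρe : tsupport ρ ⊆ e.source) {Φ : TensorField n 3 M} (hΦ : Φ ∈ smoothTensor n M 3) :
    ∃ η ∈ smoothTensor n M 1, ∀ θ ∈ smoothTensor n M 1,
      ∫ x, ρ x * tensorInner g x (eisenhart g θ x) (Φ x) ∂(vol g) = l2 g θ η := by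
  have hm := metricOn he g
  -- The coefficient of the component I of E θ in ρ g(E θ, Φ) √det g. Its extension by zero is a
  -- test function, since the support of ρ is compact in the chart domain.
  set c : (Fin 3 → Fin n) → Eucl n → ℝ := fun I u => ρ (e.symm u) * (volDensity (metricForm g e) u *
    ∑ J : Fin 3 → Fin n, (∏ a, (formMatrix (metricForm g e u))⁻¹ (I a) (J a)) * comp e Φ u J) with hc
  have hcs : ∀ I, ContDiffOn ℝ ∞ (c I) e.target := fun I =>
    (hρ e he).mul (hm.smooth_volDensity.mul (ContDiffOn.sum fun J _ =>
      (contDiffOn_prod fun a _ => hm.smooth_inv _ _).mul (hΦ e he J)))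
  have hψ : ∀ I, IsTest e.target (e.target.indicator (c I)) := fun I =>
    isTest_indicator (hcs I) (isClosed_tsupport ρ) hρe fun u _ h => by
      rw [hc]; simp only [image_eq_zero_of_notMem_tsupport h, zero_mul]
  choose β hβ hβ' using fun I : Fin 3 → Fin n =>
    (hm.hasTranspose_eisLocal (EuclideanSpace.single (I 0) 1) (EuclideanSpace.single (I 1) 1)
      (EuclideanSpace.single (I 2) 1)).transpose _ (hψ I)
  have hη : ∀ I, extendForm e (fun u => (volDensity (metricForm g e) u)⁻¹ •
      metricForm g e u (β I u)) ∈ smoothTensor n M 1 := fun I => extendForm_mem he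
    (((hβ I).clm_apply hm.isOpen hm.smooth).smul hm.isOpen
    (hm.smooth_volDensity.inv fun u hu => (hm.volDensity_pos hu).ne'))
  refine ⟨fun x => ∑ I, extendForm e (fun u => (volDensity (metricForm g e) u)⁻¹ •
    metricForm g e u (β I u)) x, sum_mem_smoothTensor fun I _ => hη I, fun θ hθ => ?_⟩
  have hs := mem_smoothTensor_one_iff.1 hθ e he
  rw [l2_sum g hθ fun I _ => hη I]
  simp only [l2_extendForm he g hθ (hβ _), ← hβ' _ _ hs]
  have hT : ∀ I : Fin 3 → Fin n, IsTest e.target fun u => eisLocal n (metricForm g e) (oneForm θ e) u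
      (EuclideanSpace.single (I 0) 1) (EuclideanSpace.single (I 1) 1)
      (EuclideanSpace.single (I 2) 1) * e.target.indicator (c I) u := fun I =>
    (hψ I).smul hm.isOpen (hm.smooth_eisLocal hs _ _ _)
  have hcont : Continuous fun x => ρ x * tensorInner g x (eisenhart g θ x) (Φ x) :=
    (continuous_of_charts fun e he => (hρ e he).continuousOn).mul
      (continuous_tensorInner g (eisenhart_mem_smoothTensor g hθ) hΦ)
  rw [integral_vol he g hcont fun x hx => by
      rw [image_eq_zero_of_notMem_tsupport fun h => hx (hρe h), zero_mul],
    ← integral_finsetSum _ fun I _ => (hT I).integrable,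
    ← setIntegral_eq_integral_of_forall_compl_eq_zero (s := e.target) fun u hu =>
      Finset.sum_eq_zero fun I _ => (hT I).eq_zero hu]
  refine setIntegral_congr_fun e.open_target.measurableSet fun u hu => ?_
  have h1 := tensorInner_chart he g (eisenhart g θ) Φ (e.map_target hu)
  rw [e.right_inv hu] at h1
  rw [h1, Finset.mul_sum, Finset.mul_sum]
  refine Finset.sum_congr rfl fun I _ => ?_
  rw [indicator_of_mem hu, hc]
  simp only [Finset.mul_sum]
  refine Finset.sum_congr rfl fun J _ => ?_
  rw [comp_eisenhart he g hθ hu]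
  change _ = eisMultilinear n (metricForm g e) (oneForm θ e) u
        (fun a => EuclideanSpace.single (I a) (1 : ℝ)) * _
  ring

/-- The local adjoints for the functions of a partition of unity add up to an adjoint. For a field Φ
that is not smooth the value of A is set to zero. -/
theorem exists_isFormalAdjoint [T2Space M] : ∃ A, IsFormalAdjoint g A := by
  obtain ⟨t, ρ, hρ, hρs, h1⟩ := exists_partition n M
  have h2 : ∀ Φ : TensorField n 3 M, ∃ η : TensorField n 1 M, Φ ∈ smoothTensor n M 3 →
      η ∈ smoothTensor n M 1 ∧
        ∀ θ ∈ smoothTensor n M 1, l2 g (eisenhart g θ) Φ = l2 g θ η := fun Φ => by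
    by_cases hΦ : Φ ∈ smoothTensor n M 3
    · choose η hη hη' using fun k =>
        exists_local_adjoint (chartAt_mem k) g (hρs k) (hρ k) hΦ
      refine ⟨fun x => ∑ k ∈ t, η k x, fun _ => ⟨sum_mem_smoothTensor fun k _ => hη k,
        fun θ hθ => ?_⟩⟩
      have hc := continuous_tensorInner g (eisenhart_mem_smoothTensor g hθ) hΦ
      rw [l2_sum g hθ fun k _ => hη k]
      simp only [← hη' _ _ hθ]
      have hk : ∀ k, Continuous fun x => ρ k x * tensorInner g x (eisenhart g θ x) (Φ x) :=
        fun k => (continuous_of_charts fun e he => (hρs k e he).continuousOn).mul hc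
      rw [← integral_finsetSum _ fun k _ => integrable_of_continuous g (hk k), l2]
      simp only [← Finset.sum_mul, h1, one_mul]
    · exact ⟨0, fun h => absurd h hΦ⟩
  choose A hA using h2
  exact ⟨A, fun Φ hΦ => (hA Φ hΦ.1).1, fun θ hθ Φ hΦ => (hA Φ hΦ.1).2 θ hθ⟩

end Global

/-! ### Variations of geodesics -/

theorem fderiv_fderiv_comm {D F : Type*} [NormedAddCommGroup D] [NormedSpace ℝ D]
    [NormedAddCommGroup F] [NormedSpace ℝ F] {W : D → F} {O : Set D} (hO : IsOpen O)
    (hW : ContDiffOn ℝ ∞ W O) {q : D} (hq : q ∈ O) (a b : D) :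
    fderiv ℝ (fun r => fderiv ℝ W r a) q b = fderiv ℝ (fun r => fderiv ℝ W r b) q a := by
  have h1 := hW.contDiffAt (hO.mem_nhds hq)
  have h2 : DifferentiableAt ℝ (fderiv ℝ W) q :=
    ((hW.fderiv_of_isOpen hO (m := ∞) (by simp)).contDiffAt (hO.mem_nhds hq)).differentiableAt
      (by simp)
  rw [fderiv_apply_const h2, fderiv_apply_const h2]
  exact (h1.isSymmSndFDerivAt (by simpa using WithTop.coe_le_coe.2 (le_top : (2 : ℕ∞) ≤ ⊤))) b a

theorem hasDerivAt_fst {F : Type*} [NormedAddCommGroup F] [NormedSpace ℝ F] {W : ℝ × ℝ → F}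
    {t s : ℝ} (h : DifferentiableAt ℝ W (t, s)) :
    HasDerivAt (fun r => W (r, s)) (fderiv ℝ W (t, s) (1, 0)) t :=
  HasFDerivAt.comp_hasDerivAt (f := fun r : ℝ => (r, s)) t h.hasFDerivAt
    ((hasDerivAt_id t).prodMk (hasDerivAt_const t s))

theorem hasDerivAt_snd {F : Type*} [NormedAddCommGroup F] [NormedSpace ℝ F] {W : ℝ × ℝ → F}
    {t s : ℝ} (h : DifferentiableAt ℝ W (t, s)) :
    HasDerivAt (fun r => W (t, r)) (fderiv ℝ W (t, s) (0, 1)) s :=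
  HasFDerivAt.comp_hasDerivAt (f := fun r : ℝ => (t, r)) s h.hasFDerivAt
    ((hasDerivAt_const s t).prodMk (hasDerivAt_id s))

section Variation

variable {E : Type*} [NormedAddCommGroup E] [NormedSpace ℝ E] [FiniteDimensional ℝ E]
  [CompleteSpace E] {Ω : Set E} {G : E → Form E} {X : E → E} {Z : ℝ × ℝ → E} {O : Set (ℝ × ℝ)}

/-- The covariant acceleration of the curves `s ↦ Z (t, s)`. -/
def accelVar (G : E → Form E) (Z : ℝ × ℝ → E) (q : ℝ × ℝ) : E :=
  fderiv ℝ (fun r => fderiv ℝ Z r (0, 1)) q (0, 1)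
    + gam G (Z q) (fderiv ℝ Z q (0, 1)) (fderiv ℝ Z q (0, 1))

namespace MetricOn

variable (h : MetricOn Ω G) (hX : ContDiffOn ℝ ∞ X Ω) (hO : IsOpen O) (hZ : ContDiffOn ℝ ∞ Z O)
  (hm : MapsTo Z O Ω)
include h hO hZ hm

theorem smooth_accelVar : ContDiffOn ℝ ∞ (accelVar G Z) O := by
  have hs : ContDiffOn ℝ ∞ (fun r => fderiv ℝ Z r (0, 1)) O :=
    (hZ.fderiv_of_isOpen hO (m := ∞) (by simp)).clm_apply contDiffOn_const
  exact ((hs.fderiv_of_isOpen hO (m := ∞) (by simp)).clm_apply contDiffOn_const).add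
    (((h.smooth_gam.comp hZ hm).clm_apply hs).clm_apply hs)

include hX

/-- The derivative of the acceleration of the curves `s ↦ Z (t, s)` at `t = 0`, if
`s ↦ Z (0, s)` is a geodesic and `X` is the variation field. -/
theorem fderiv_accelVar (h0 : (0, 0) ∈ O) (hXZ : ∀ s, (0, s) ∈ O → fderiv ℝ Z (0, s) (1, 0) = X (Z (0, s)))
    (hg : accelVar G Z (0, 0) = 0) :
    fderiv ℝ (accelVar G Z) (0, 0) (1, 0)
      = lieGam G X (Z (0, 0)) (fderiv ℝ Z (0, 0) (0, 1)) (fderiv ℝ Z (0, 0) (0, 1)) := by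
  set Zs : ℝ × ℝ → E := fun r => fderiv ℝ Z r (0, 1) with hZs
  set Zt : ℝ × ℝ → E := fun r => fderiv ℝ Z r (1, 0) with hZt
  have hd : ∀ {W : ℝ × ℝ → E}, ContDiffOn ℝ ∞ W O → ∀ q ∈ O, DifferentiableAt ℝ W q :=
    fun hW q hq => (hW.contDiffAt (hO.mem_nhds hq)).differentiableAt (by simp)
  have hsm : ∀ {W : ℝ × ℝ → E}, ContDiffOn ℝ ∞ W O → ∀ a,
      ContDiffOn ℝ ∞ (fun r => fderiv ℝ W r a) O := fun hW a =>
    (hW.fderiv_of_isOpen hO (m := ∞) (by simp)).clm_apply contDiffOn_const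
  have hs : ContDiffOn ℝ ∞ Zs O := hsm hZ _
  have ht : ContDiffOn ℝ ∞ Zt O := hsm hZ _
  have hXd : ∀ w ∈ Ω, DifferentiableAt ℝ X w := fun w hw =>
    (hX.contDiffAt (h.mem_nhds hw)).differentiableAt (by simp)
  have hX2 : ∀ w ∈ Ω, DifferentiableAt ℝ (fderiv ℝ X) w := fun w hw =>
    ((hX.fderiv_of_isOpen h.isOpen (m := ∞) (by simp)).contDiffAt
      (h.mem_nhds hw)).differentiableAt (by simp)
  have hev : ∀ {s : ℝ}, ((0 : ℝ), s) ∈ O → ∀ᶠ r in 𝓝 s, ((0 : ℝ), r) ∈ O := fun {s} hs =>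
    (Continuous.prodMk_right (0 : ℝ)).continuousAt.preimage_mem_nhds (hO.mem_nhds hs)
  -- The variation field is X along the whole base curve, so it can be differentiated in s; mixed
  -- partial derivatives then turn the s-derivatives of ∂_t Z into t-derivatives.
  have h1 : ∀ s, ((0 : ℝ), s) ∈ O → fderiv ℝ Zt (0, s) (0, 1)
      = fderiv ℝ X (Z (0, s)) (Zs (0, s)) := fun s hsO => by
    have e1 := hasDerivAt_snd (hd ht _ hsO)
    have e2 : HasDerivAt (fun s => X (Z (0, s))) (fderiv ℝ X (Z (0, s)) (Zs (0, s))) s :=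
      (hXd _ (hm hsO)).hasFDerivAt.comp_hasDerivAt s (hasDerivAt_snd (hd hZ _ hsO))
    refine e1.unique (e2.congr_of_eventuallyEq ?_)
    filter_upwards [hev hsO] with r hr using hXZ r hr
  have h2 : fderiv ℝ (fun r => fderiv ℝ Zt r (0, 1)) (0, 0) (0, 1)
      = fderiv ℝ (fderiv ℝ X) (Z (0, 0)) (Zs (0, 0)) (Zs (0, 0))
        + fderiv ℝ X (Z (0, 0)) (fderiv ℝ Zs (0, 0) (0, 1)) := by
    have e1 := hasDerivAt_snd (hd (hsm ht (0, 1)) _ h0)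
    have e2 : HasDerivAt (fun s => fderiv ℝ X (Z (0, s)) (Zs (0, s)))
        (fderiv ℝ (fderiv ℝ X) (Z (0, 0)) (Zs (0, 0)) (Zs (0, 0))
        + fderiv ℝ X (Z (0, 0)) (fderiv ℝ Zs (0, 0) (0, 1))) 0 := by
      have e3 : HasDerivAt (fun s => fderiv ℝ X (Z (0, s)))
          (fderiv ℝ (fderiv ℝ X) (Z (0, 0)) (Zs (0, 0))) 0 :=
        HasFDerivAt.comp_hasDerivAt (f := fun s => Z (0, s)) (0 : ℝ) (hX2 _ (hm h0)).hasFDerivAt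
          (hasDerivAt_snd (hd hZ _ h0))
      exact e3.clm_apply (hasDerivAt_snd (hd hs _ h0))
    refine e1.unique (e2.congr_of_eventuallyEq ?_)
    filter_upwards [hev h0] with r hr using h1 r hr
  have h3 : fderiv ℝ Zs (0, 0) (1, 0) = fderiv ℝ X (Z (0, 0)) (Zs (0, 0)) := by
    rw [← h1 0 h0]; exact fderiv_fderiv_comm hO hZ h0 _ _
  have h4 : fderiv ℝ (fun r => fderiv ℝ Zs r (0, 1)) (0, 0) (1, 0)
      = fderiv ℝ (fun r => fderiv ℝ Zt r (0, 1)) (0, 0) (0, 1) := by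
    rw [fderiv_fderiv_comm hO hs h0]
    have e : (fun r => fderiv ℝ Zs r (1, 0)) =ᶠ[𝓝 (0, 0)] fun r => fderiv ℝ Zt r (0, 1) := by
      filter_upwards [hO.mem_nhds h0] with r hr using fderiv_fderiv_comm hO hZ hr _ _
    rw [e.fderiv_eq]
  -- The geodesic equation replaces the second s-derivative by minus the connection term, which
  -- accounts for the term of `lieGam` with the derivative of X applied to `gam`.
  have h5 : fderiv ℝ Zs (0, 0) (0, 1) = - gam G (Z (0, 0)) (Zs (0, 0)) (Zs (0, 0)) :=
    eq_neg_of_add_eq_zero_left hg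
  have hΓ := h.smooth_gam.comp hZ hm
  have hΓd : DifferentiableAt ℝ (gam G) (Z (0, 0)) :=
    (h.smooth_gam.contDiffAt (h.mem_nhds (hm h0))).differentiableAt (by simp)
  have hΓZ : DifferentiableAt ℝ (fun r => gam G (Z r)) (0, 0) :=
    (hΓ.contDiffAt (hO.mem_nhds h0)).differentiableAt (by simp)
  have hΓt : fderiv ℝ (fun r => gam G (Z r)) (0, 0) (1, 0)
      = fderiv ℝ (gam G) (Z (0, 0)) (X (Z (0, 0))) := by
    rw [← hXZ 0 h0]
    exact congrArg (fun L => L (1, 0)) (fderiv_comp (0, 0) hΓd (hd hZ _ h0))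
  have hsd := hd hs _ h0
  have e1 : HasFDerivAt (accelVar G Z) _ (0, 0) := (hd (hsm hs (0, 1)) _ h0).hasFDerivAt.add
    ((hΓZ.hasFDerivAt.clm_apply hsd.hasFDerivAt).clm_apply hsd.hasFDerivAt)
  rw [e1.fderiv]
  simp only [add_apply, ContinuousLinearMap.comp_apply, ContinuousLinearMap.flip_apply, h4, h2, h3,
    hΓt, h5, lieGam_apply, map_neg]
  abel

/-- If moreover the curves `s ↦ Z (t, s)` are geodesics up to parametrisation, then the Lie
derivative of the connection along `X` preserves directions. -/
theorem lieGam_parallel (h0 : (0, 0) ∈ O)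
    (hXZ : ∀ s, (0, s) ∈ O → fderiv ℝ Z (0, s) (1, 0) = X (Z (0, s)))
    (hg : accelVar G Z (0, 0) = 0)
    (hpre : ∀ t, (t, 0) ∈ O → ∃ k : ℝ, accelVar G Z (t, 0) = k • fderiv ℝ Z (t, 0) (0, 1))
    (φ ψ : E →ₗ[ℝ] ℝ) :
    φ (lieGam G X (Z (0, 0)) (fderiv ℝ Z (0, 0) (0, 1)) (fderiv ℝ Z (0, 0) (0, 1)))
        * ψ (fderiv ℝ Z (0, 0) (0, 1))
      = ψ (lieGam G X (Z (0, 0)) (fderiv ℝ Z (0, 0) (0, 1)) (fderiv ℝ Z (0, 0) (0, 1)))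
        * φ (fderiv ℝ Z (0, 0) (0, 1)) := by
  rw [← h.fderiv_accelVar hX hO hZ hm h0 hXZ hg]
  set Φ := LinearMap.toContinuousLinearMap φ
  set Ψ := LinearMap.toContinuousLinearMap ψ
  have hline : ∀ {W : ℝ × ℝ → E}, ContDiffOn ℝ ∞ W O →
      HasDerivAt (fun t => W (t, 0)) (fderiv ℝ W (0, 0) (1, 0)) 0 := fun hW =>
    hasDerivAt_fst ((hW.contDiffAt (hO.mem_nhds h0)).differentiableAt (by simp))
  have hA := hline (h.smooth_accelVar hO hZ hm)
  have hs := hline ((hZ.fderiv_of_isOpen hO (m := ∞) (by simp)).clm_apply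
    (contDiffOn_const (c := ((0 : ℝ), (1 : ℝ)))))
  -- The two-by-two minor of acceleration and velocity vanishes for all small t. Since the
  -- acceleration is zero at t = 0, the derivative of the minor involves only the derivative of the
  -- acceleration.
  have e1 := ((Φ.hasFDerivAt.comp_hasDerivAt (0 : ℝ) hA).mul
    (Ψ.hasFDerivAt.comp_hasDerivAt (0 : ℝ) hs)).sub
    ((Ψ.hasFDerivAt.comp_hasDerivAt (0 : ℝ) hA).mul (Φ.hasFDerivAt.comp_hasDerivAt (0 : ℝ) hs))
  have e2 := e1.unique ((hasDerivAt_const (0 : ℝ) (0 : ℝ)).congr_of_eventuallyEq (by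
    filter_upwards [(Continuous.prodMk_left (0 : ℝ)).continuousAt.preimage_mem_nhds
      (hO.mem_nhds h0)] with t ht
    obtain ⟨k, hk⟩ := hpre t ht
    simp only [Pi.sub_apply, Pi.mul_apply, Function.comp_apply, hk, map_smul, smul_eq_mul]
    ring))
  simp only [Function.comp_apply, hg, map_zero, zero_mul, add_zero] at e2
  exact sub_eq_zero.1 e2

end MetricOn

end Variation

/-! ### Geodesics -/

namespace MetricOn

variable {E : Type*} [NormedAddCommGroup E] [NormedSpace ℝ E] [FiniteDimensional ℝ E]
  [CompleteSpace E] {Ω Ω' : Set E} {G : E → Form E} (h : MetricOn Ω G)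

theorem mono (h : MetricOn Ω G) (hΩ : IsOpen Ω') (hs : Ω' ⊆ Ω) : MetricOn Ω' G :=
  ⟨hΩ, h.smooth.mono hs, fun u hu => h.pos u (hs hu)⟩

include h in
-- The geodesic equation as a first order system for position and velocity, on the open set of pairs
-- with position in Ω.
theorem exists_geodesic {u : E} (hu : u ∈ Ω) (v : E) : ∃ ε > (0 : ℝ), ∃ c : ℝ → E,
    ContDiffOn ℝ ∞ c (Ioo (-ε) ε) ∧ c 0 = u ∧ deriv c 0 = v ∧
    ∀ t ∈ Ioo (-ε) ε, c t ∈ Ω ∧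
      deriv (deriv c) t + gam G (c t) (deriv c t) (deriv c t) = 0 := by
  let V : E × E → E × E := fun p => (p.2, - gam G p.1 p.2 p.2)
  have hV : ContDiffOn ℝ ∞ V (Ω ×ˢ univ) := contDiffOn_snd.prodMk
    ((((h.smooth_gam.comp contDiffOn_fst fun p hp => hp.1).clm_apply contDiffOn_snd).clm_apply
      contDiffOn_snd).neg)
  have ho : IsOpen (Ω ×ˢ (univ : Set E)) := h.isOpen.prod isOpen_univ
  have h0 : (u, v) ∈ Ω ×ˢ (univ : Set E) := ⟨hu, trivial⟩
  obtain ⟨α, hα0, ε, hε, hα⟩ :=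
    (((hV.contDiffAt (ho.mem_nhds h0)).of_le (by simp)) : ContDiffAt ℝ 1 V (u, v)).exists_forall_mem_closedBall_exists_eq_forall_mem_Ioo_hasDerivAt₀ 0
  simp only [zero_sub, zero_add] at hα
  have hαc : ContinuousAt α 0 := (hα 0 ⟨by linarith, hε⟩).continuousAt
  obtain ⟨r, hr, hball⟩ := Metric.mem_nhds_iff.1
    (hαc.preimage_mem_nhds (ho.mem_nhds (hα0.symm ▸ h0)))
  -- Halving keeps the closed interval [-δ, δ] inside both the interval of existence and the one
  -- where the solution stays in the domain of the system.
  set δ := min ε r / 2 with hδ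
  have hm : 0 < min ε r := lt_min hε hr
  have hδ0 : 0 < δ := by positivity
  have hδε : δ < ε := by have := min_le_left ε r; linarith
  have hδr : δ < r := by have := min_le_right ε r; linarith
  have hmaps : MapsTo α (Icc (-δ) δ) (Ω ×ˢ univ) := fun t ht => hball (by
    rw [Metric.mem_ball, dist_zero_right, Real.norm_eq_abs]
    exact lt_of_le_of_lt (abs_le.2 ht) hδr)
  have hder : ∀ t ∈ Icc (-δ) δ, HasDerivAt α (V (α t)) t := fun t ht =>
    hα t ⟨by linarith [ht.1], by linarith [ht.2]⟩
  -- The existence theorem yields a differentiable solution only; its smoothness follows from that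
  -- of the vector field.
  have hsm : ContDiffOn ℝ ∞ α (Icc (-δ) δ) :=
    ODE.contDiffOn_enat_Icc_of_hasDerivWithinAt (n := ⊤) (f := fun _ => V) (u := Ω ×ˢ univ)
      (hV.comp contDiffOn_snd fun p hp => hp.2) (fun t ht => (hder t ht).hasDerivWithinAt) hmaps
  have hd1 : ∀ t ∈ Icc (-δ) δ, HasDerivAt (fun t => (α t).1) (α t).2 t := fun t ht =>
    (hder t ht).fst
  have hd2 : ∀ t ∈ Icc (-δ) δ, HasDerivAt (fun t => (α t).2)
      (- gam G (α t).1 (α t).2 (α t).2) t := fun t ht => (hder t ht).snd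
  have h00 : (0 : ℝ) ∈ Icc (-δ) δ := ⟨by linarith, hδ0.le⟩
  refine ⟨δ, hδ0, fun t => (α t).1, contDiff_fst.comp_contDiffOn (hsm.mono Ioo_subset_Icc_self),
    congrArg Prod.fst hα0, by rw [(hd1 0 h00).deriv, hα0], fun t ht => ⟨(hmaps (Ioo_subset_Icc_self ht)).1, ?_⟩⟩
  have h1 : deriv (fun t => (α t).1) =ᶠ[𝓝 t] fun t => (α t).2 := by
    filter_upwards [isOpen_Ioo.mem_nhds ht] with s hs using (hd1 s (Ioo_subset_Icc_self hs)).deriv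
  rw [h1.deriv_eq, (hd2 t (Ioo_subset_Icc_self ht)).deriv, h1.eq_of_nhds, neg_add_cancel]

end MetricOn

theorem accelVar_eq {E : Type*} [NormedAddCommGroup E] [NormedSpace ℝ E]
    {G : E → Form E} {Z : ℝ × ℝ → E} {O : Set (ℝ × ℝ)} (hO : IsOpen O) (hZ : ContDiffOn ℝ ∞ Z O)
    {t s : ℝ} (h : (t, s) ∈ O) : accelVar G Z (t, s)
      = deriv (deriv fun r => Z (t, r)) s
        + gam G (Z (t, s)) (deriv (fun r => Z (t, r)) s) (deriv (fun r => Z (t, r)) s) := by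
  have hs : ContDiffOn ℝ ∞ (fun r => fderiv ℝ Z r (0, 1)) O :=
    (hZ.fderiv_of_isOpen hO (m := ∞) (by simp)).clm_apply contDiffOn_const
  have hd : ∀ r, (t, r) ∈ O → deriv (fun r => Z (t, r)) r = fderiv ℝ Z (t, r) (0, 1) :=
    fun r hr => (hasDerivAt_snd ((hZ.contDiffAt (hO.mem_nhds hr)).differentiableAt (by simp))).deriv
  have h1 : (deriv fun r => Z (t, r)) =ᶠ[𝓝 s] fun r => fderiv ℝ Z (t, r) (0, 1) := by
    filter_upwards [(Continuous.prodMk_right t).continuousAt.preimage_mem_nhds (hO.mem_nhds h)]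
      with r hr using hd r hr
  rw [h1.deriv_eq, hd s h, (hasDerivAt_snd (W := fun r => fderiv ℝ Z r (0, 1))
    ((hs.contDiffAt (hO.mem_nhds h)).differentiableAt (by simp))).deriv, accelVar]

section Global

variable {n : ℕ} {M : Type*} [TopologicalSpace M] [ChartedSpace (EuclideanSpace ℝ (Fin n)) M]
  [IsManifold (𝓡 n) ∞ M] {e e' : Chart n M} (he : e ∈ atlas (EuclideanSpace ℝ (Fin n)) M)
  (he' : e' ∈ atlas (EuclideanSpace ℝ (Fin n)) M) (g : Metric n M)

include he in
theorem accel_eq {γ : ℝ → M} {t : ℝ} (ht : γ t ∈ e.source) (m : Fin n) :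
    accel g e γ t m = (deriv (deriv fun s => e (γ s)) t
      + gam (metricForm g e) (e (γ t)) (deriv (fun s => e (γ s)) t)
        (deriv (fun s => e (γ s)) t)) m := by
  set a := deriv (fun s => e (γ s)) t with ha
  have hu := e.map_source ht
  have h1 : gam (metricForm g e) (e (γ t)) a a = ∑ i, ∑ j, (a i * a j) •
      gam (metricForm g e) (e (γ t)) (EuclideanSpace.single i 1) (EuclideanSpace.single j 1) := by
    calc gam (metricForm g e) (e (γ t)) a a
        = gam (metricForm g e) (e (γ t)) (∑ i, a i • EuclideanSpace.single i (1 : ℝ))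
          (∑ j, a j • EuclideanSpace.single j (1 : ℝ)) := by rw [← eq_sum_single]
      _ = _ := by
        simp only [map_sum, map_smul, sum_apply, smul_apply, Finset.smul_sum, smul_smul]
        rw [Finset.sum_comm]
        refine Finset.sum_congr rfl fun i _ => Finset.sum_congr rfl fun j _ => ?_
        rw [mul_comm]
  rw [accel, h1, metricComp_eq]
  simp only [(metricOn he g).christoffel_eq hu, PiLp.add_apply, WithLp.ofLp_sum, Finset.sum_apply,
    PiLp.smul_apply, smul_eq_mul]
  congr 1
  refine Finset.sum_congr rfl fun i _ => Finset.sum_congr rfl fun j _ => ?_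
  ring

include he in
/-- Solutions of the geodesic equation in one chart are geodesics. -/
theorem isGeodesicOn_of_chart {c : ℝ → Eucl n} {J : Set ℝ} (hJ : IsOpen J)
    (hc : ContDiffOn ℝ ∞ c J) (ht : ∀ t ∈ J, c t ∈ e.target)
    (h : ∀ t ∈ J, deriv (deriv c) t + gam (metricForm g e) (c t) (deriv c t) (deriv c t) = 0) :
    IsGeodesicOn g (fun t => e.symm (c t)) J := by
  refine ⟨?_, fun t htJ e' he' hte m => ?_⟩
  · have h2 := contMDiffOn_symm_of_mem_maximalAtlas (I := 𝓡 n) (n := ∞)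
      (IsManifold.subset_maximalAtlas he)
    exact h2.comp hc.contMDiffOn ht
  · have h1 := (transition he he' g).acceleration_eq (c := c) (t := t)
      (by
        filter_upwards [hJ.mem_nhds htJ] with s hs
        exact (hc.contDiffAt (hJ.mem_nhds hs)).differentiableAt (by simp))
      (((hc.deriv_of_isOpen hJ (m := ∞) (by simp)).contDiffAt (hJ.mem_nhds htJ)).differentiableAt
        (by simp)) ⟨ht t htJ, hte⟩
    rw [accel_eq he' g hte, h1, h t htJ, map_zero]
    rfl

end Global

/-! ### Infinitesimal projective transformations -/

section Global

variable {n : ℕ} {M : Type*} [TopologicalSpace M] [ChartedSpace (EuclideanSpace ℝ (Fin n)) M]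
  [IsManifold (𝓡 n) ∞ M] {e : Chart n M} (he : e ∈ atlas (EuclideanSpace ℝ (Fin n)) M)
  (g : Metric n M) {ξ : (x : M) → TangentSpace (𝓡 n) x}

/-- A vector field in the chart `e`. -/
def vecComp (ξ : (x : M) → TangentSpace (𝓡 n) x) (e : Chart n M) (u : Eucl n) : Eucl n :=
  coordMap e (e.symm u) (ξ (e.symm u))

/-- The 1-form dual to a vector field. -/
def flat (ξ : (x : M) → TangentSpace (𝓡 n) x) : TensorField n 1 M := fun x =>
  MultilinearMap.ofSubsingleton ℝ (TangentSpace (𝓡 n) x) ℝ (0 : Fin 1)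
    (g.inner x (ξ x) : TangentSpace (𝓡 n) x →ₗ[ℝ] ℝ)

theorem flat_apply (x : M) (v : Fin 1 → TangentSpace (𝓡 n) x) :
    flat g ξ x v = g.inner x (ξ x) (v 0) := rfl

include he in
theorem smooth_vecComp (hξ : ContMDiff (𝓡 n) (𝓡 n).tangent ∞
    (fun x => (⟨x, ξ x⟩ : TangentBundle (𝓡 n) M))) : ContDiffOn ℝ ∞ (vecComp ξ e) e.target := by
  have h1 := contMDiffOn_symm_of_mem_maximalAtlas (I := 𝓡 n) (n := ∞)
    (IsManifold.subset_maximalAtlas he)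
  have h2 := (contMDiffOn_of_mem_maximalAtlas (I := 𝓡 n) (n := ∞)
    (IsManifold.subset_maximalAtlas he)).contMDiffOn_tangentMapWithin (m := ∞) (by simp)
      e.open_source.uniqueMDiffOn
  have h3 : ContMDiffOn (𝓡 n) (𝓡 n).tangent ∞
      (fun u => (⟨e.symm u, ξ (e.symm u)⟩ : TangentBundle (𝓡 n) M)) e.target :=
    hξ.comp_contMDiffOn h1
  refine contMDiffOn_vectorSpace_iff_contDiffOn.1
    ((h2.comp h3 fun u hu => e.map_target hu).congr fun u hu => ?_)
  simp only [Function.comp_apply, tangentMapWithin]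
  rw [mfderivWithin_of_isOpen e.open_source (e.map_target hu)]
  exact congrArg (fun w : Eucl n => (⟨w, vecComp ξ e u⟩ : TangentBundle (𝓡 n) (Eucl n)))
    (e.right_inv hu).symm

include he in
theorem oneForm_flat {u : Eucl n} (hu : u ∈ e.target) (v : Eucl n) :
    oneForm (flat g ξ) e u v = metricForm g e u (vecComp ξ e u) v := by
  rw [oneForm_apply, flat_apply, metricForm_apply, frameMap_eq he hu, vecComp,
    frameAt_coordMap he (e.map_target hu)]

theorem flat_mem (hξ : ContMDiff (𝓡 n) (𝓡 n).tangent ∞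
    (fun x => (⟨x, ξ x⟩ : TangentBundle (𝓡 n) M))) : flat g ξ ∈ smoothTensor n M 1 :=
  mem_smoothTensor_one_iff.2 fun e he =>
    ((metricOn he g).smooth.clm_apply (smooth_vecComp he hξ)).congr fun u hu => by
      ext v; exact oneForm_flat he g hu v

include he in
/-- The velocity of an integral curve, in a chart. -/
theorem hasDerivAt_integralCurve {γ : ℝ → M} {ε : ℝ} (hε : 0 < ε)
    (h : IsMIntegralCurveOn γ ξ (Ioo (-ε) ε)) (h0 : γ 0 ∈ e.source) :
    HasDerivAt (fun t => e (γ t)) (vecComp ξ e (e (γ 0))) 0 := by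
  have h1 := (h 0 ⟨by linarith, hε⟩).hasMFDerivAt (Ioo_mem_nhds (by linarith) hε)
  have h2 := ((mdifferentiable_chart' he).mdifferentiableAt h0).hasMFDerivAt
  have h3 : HasFDerivAt (fun t => e (γ t)) ((1 : ℝ →L[ℝ] ℝ).smulRight (vecComp ξ e (e (γ 0)))) 0 := by
    refine hasMFDerivAt_iff_hasFDerivAt.1 ((h2.comp (0 : ℝ) h1).congr_mfderiv ?_)
    ext
    rw [vecComp, e.left_inv h0]
    exact map_smul (coordMap e (γ 0)) (1 : ℝ) (ξ (γ 0))
  simpa using h3.hasDerivAt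

include he in
/-- Infinitesimal projective transformations change the connection along directions only. -/
theorem lieGam_parallel_of_isInfinitesimalProjective (hξ : IsInfinitesimalProjective g ξ)
    {x : M} (hx : x ∈ e.source) (v : Eucl n) (φ ψ : Eucl n →ₗ[ℝ] ℝ) :
    φ (lieGam (metricForm g e) (vecComp ξ e) (e x) v v) * ψ v
      = ψ (lieGam (metricForm g e) (vecComp ξ e) (e x) v v) * φ v := by
  obtain ⟨hs, hloc⟩ := hξ
  obtain ⟨U, hU, hxU, ε, hε, F, hF, hF0, hFi, hFg⟩ := hloc x
  have hm := metricOn he g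
  have hΩ : IsOpen (e.target ∩ e.symm ⁻¹' U) := e.isOpen_inter_preimage_symm hU
  have hux : e x ∈ e.target ∩ e.symm ⁻¹' U :=
    ⟨e.map_source hx, by rwa [mem_preimage, e.left_inv hx]⟩
  -- The geodesic with initial velocity v is built inside the part of the chart over U, so that the
  -- local flow is defined along it.
  obtain ⟨δ, hδ, c, hcs, hc0, hcv, hc⟩ := (hm.mono hΩ inter_subset_left).exists_geodesic hux v
  set γ : ℝ → M := fun s => e.symm (c s) with hγ
  have hgeo : IsGeodesicOn g γ (Ioo (-δ) δ) := isGeodesicOn_of_chart he g isOpen_Ioo hcs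
    (fun t ht => (hc t ht).1.1) fun t ht => (hc t ht).2
  have hγU : MapsTo γ (Ioo (-δ) δ) U := fun t ht => (hc t ht).1.2
  set D : Set (ℝ × ℝ) := Ioo (-ε) ε ×ˢ Ioo (-δ) δ with hD
  have hDo : IsOpen D := isOpen_Ioo.prod isOpen_Ioo
  set W : ℝ × ℝ → M := fun p => F p.1 (γ p.2) with hW
  have hWs : ContMDiffOn 𝓘(ℝ, ℝ × ℝ) (𝓡 n) ∞ W D := by
    have h1 : ContMDiffOn 𝓘(ℝ, ℝ × ℝ) (𝓘(ℝ, ℝ).prod (𝓡 n)) ∞ (fun p : ℝ × ℝ => (p.1, γ p.2)) D :=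
      ContMDiffOn.prodMk contDiff_fst.contMDiff.contMDiffOn
        (hgeo.1.comp contDiff_snd.contMDiff.contMDiffOn fun p hp => hp.2)
    exact hF.comp h1 fun p hp => ⟨hp.1, hγU hp.2⟩
  -- The flow may carry points out of the chart; O keeps the parameters for which the moved geodesic
  -- can be read in `e`.
  set O : Set (ℝ × ℝ) := D ∩ W ⁻¹' e.source with hO
  have hOo : IsOpen O := hWs.continuousOn.isOpen_inter_preimage hDo e.open_source
  set Z : ℝ × ℝ → Eucl n := fun p => e (W p) with hZ
  have hZs : ContDiffOn ℝ ∞ Z O := contMDiffOn_iff_contDiffOn.1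
    ((contMDiffOn_of_mem_maximalAtlas (I := 𝓡 n) (n := ∞)
      (IsManifold.subset_maximalAtlas he)).comp (hWs.mono inter_subset_left) fun p hp => hp.2)
  have hZm : MapsTo Z O e.target := fun p hp => e.map_source hp.2
  have h0δ : (0 : ℝ) ∈ Ioo (-δ) δ := ⟨by linarith, hδ⟩
  have h0ε : (0 : ℝ) ∈ Ioo (-ε) ε := ⟨by linarith, hε⟩
  have hW0 : ∀ s ∈ Ioo (-δ) δ, W (0, s) = γ s := fun s hs => hF0 _ (hγU hs)
  have hγ0 : γ 0 = x := by rw [hγ]; simp only [hc0, e.left_inv hx]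
  have hZ0 : ∀ s ∈ Ioo (-δ) δ, Z (0, s) = c s := fun s hs => by
    rw [hZ]; simp only [hW0 s hs]; exact e.right_inv (hc s hs).1.1
  have h0 : ((0 : ℝ), (0 : ℝ)) ∈ O := ⟨⟨h0ε, h0δ⟩, by
    rw [mem_preimage, hW0 0 h0δ, hγ0]; exact hx⟩
  have hZe : (fun s => Z (0, s)) =ᶠ[𝓝 0] c := by
    filter_upwards [isOpen_Ioo.mem_nhds h0δ] with s hs using hZ0 s hs
  have hZd : ∀ q ∈ O, DifferentiableAt ℝ Z q := fun q hq =>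
    (hZs.contDiffAt (hOo.mem_nhds hq)).differentiableAt (by simp)
  have hv : fderiv ℝ Z (0, 0) (0, 1) = v := by
    rw [← (hasDerivAt_snd (hZd _ h0)).deriv, hZe.deriv_eq, hcv]
  have hu : Z (0, 0) = e x := by rw [hZ0 0 h0δ, hc0]
  -- The three arguments are the flow equation at t = 0, the geodesic equation for the undisturbed
  -- curve, and the projective hypothesis at s = 0, where the proportionality factor may depend on
  -- t.
  have key := hm.lieGam_parallel (smooth_vecComp he hs) hOo hZs hZm h0 (fun s hsO => by
      have h1 := hasDerivAt_integralCurve he hε (hFi (γ s) (hγU hsO.1.2)) hsO.2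
      exact (hasDerivAt_fst (hZd _ hsO)).unique h1)
    (by
      rw [accelVar_eq hOo hZs h0, hZe.deriv.deriv_eq, hZe.deriv_eq, hZ0 0 h0δ]
      exact (hc 0 h0δ).2)
    (fun t ht => by
      obtain ⟨k, hk⟩ := (hFg t ht.1.1 _ _ γ hgeo hγU).2 0 h0δ e he ht.2
      refine ⟨k, ?_⟩
      rw [accelVar_eq hOo hZs ht, ← (hasDerivAt_snd (hZd _ ht)).deriv]
      ext m
      have h1 := hk m
      rw [accel_eq he g ht.2] at h1
      exact h1) φ ψ
  rwa [hv, hu] at key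

theorem eisenhart_flat_eq_zero (hξ : IsInfinitesimalProjective g ξ) :
    eisenhart g (flat g ξ) = 0 := by
  have hs := flat_mem g hξ.1
  funext x
  ext v
  have he := chartAt_mem (n := n) x
  have hx := mem_chart_source (EuclideanSpace ℝ (Fin n)) x
  rw [eisenhart_apply he g hs hx]
  exact (metricOn he g).eisLocal_eq_zero_of_parallel (stdBasis n) (smooth_vecComp he hξ.1)
    (mem_smoothTensor_one_iff.1 hs _ he) (fun w hw y => oneForm_flat he g hw y)
    (((chartAt _ x)).map_source hx)
    (lieGam_parallel_of_isInfinitesimalProjective he g hξ hx) _ _ _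

theorem eq_zero_of_flat_eq_zero (h : flat g ξ = 0) : ξ = 0 := by
  funext x
  by_contra hx
  have h1 := congrFun h x
  have h2 := congrArg (fun T : CovTensor n 1 x => T fun _ => ξ x) h1
  simp only [flat_apply] at h2
  exact (g.pos x (ξ x) hx).ne' h2

end Global

end EisenhartOp

end

/-! ### The main theorem -/

theorem corollary6 (n : ℕ) (hn : 2 ≤ n) {M : Type*} [TopologicalSpace M] [T2Space M]
    [CompactSpace M] [ConnectedSpace M] [ChartedSpace (EuclideanSpace ℝ (Fin n)) M]
    [IsManifold (𝓡 n) ∞ M] [MeasurableSpace M] [BorelSpace M]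
    (g : EisenhartOp.Metric n M) (hg : EisenhartOp.QuasiNegative g) :
    (∀ θ ∈ EisenhartOp.smoothTensor n M 1,
      EisenhartOp.eisenhart g θ ∈ EisenhartOp.smoothSymTraceFree g) ∧
    (∃ A, EisenhartOp.IsFormalAdjoint g A) ∧
    (∀ A, EisenhartOp.IsFormalAdjoint g A →
      EisenhartOp.IsPositiveDefinite g (fun θ => A (EisenhartOp.eisenhart g θ))) ∧
    (∀ θ ∈ EisenhartOp.smoothTensor n M 1, EisenhartOp.eisenhart g θ = 0 → θ = 0) ∧
    (∀ ξ : (x : M) → TangentSpace (𝓡 n) x,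
      EisenhartOp.IsInfinitesimalProjective g ξ → ξ = 0) := by
  have h : ∀ θ ∈ EisenhartOp.smoothTensor n M 1, EisenhartOp.eisenhart g θ = 0 → θ = 0 :=
    fun θ hθ => EisenhartOp.eq_zero_of_eisenhart_eq_zero g hn hg hθ
  exact ⟨fun θ hθ => EisenhartOp.eisenhart_mem g hθ, EisenhartOp.exists_isFormalAdjoint g,
    fun A hA => EisenhartOp.isPositiveDefinite_of_injective g h hA, h,
    fun ξ hξ => EisenhartOp.eq_zero_of_flat_eq_zero g
      (h _ (EisenhartOp.flat_mem g hξ.1) (EisenhartOp.eisenhart_flat_eq_zero g hξ))⟩
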